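/- Let $\Omega\subset\mathbb{R}^2$ be a bounded domain with $C^\infty$ boundary and outward unit normal $n$. There is a constant $C>0$, depending only on $\Omega$, such that the following holds. Let $T\in(0,\infty]$, let $\theta_0\in H^1(\Omega)$, and let $v,u$ be time-dependent $\mathbb{R}^2$-valued functions on $\Omega$ such that, for every finite $T_0\in(0,T]$, $$v\in L^3(0,T_0;W^{2,3}(\Omega)),\qquad u\in L^2(0,T_0;H^1(\Omega)),$$ and $v(t)\cdot n=0$ on $\partial\Omega$ for a.e. $t\in(0,T_0)$. Then there is a function $\theta$ which, for every finite $T_0\in(0,T]$, is the unique solution of $$\theta_t+v\cdot\nabla\theta=-u\cdot e_2,\qquad \theta(0)=\theta_0,$$ on $\Omega\times[0,T_0]$ in the class $$L^\infty(0,T_0;H^1(\Omega))\cap H^1(0,T_0;L^2(\Omega)).$$ Here $e_2=(0,1)$, the equation is understood a.e. in $\Omega\times(0,T_0)$, and functions of this class are identified with their representatives in $C([0,T_0];L^2(\Omega))$. Moreover, for every finite $t\in[0,T]$ we have $\int_0^t\|v\|_{W^{1,\infty}(\Omega)}\,ds<\infty$, $\theta(t)\in H^1(\Omega)$, and $$\|\nabla\theta(t)\|_{L^2(\Omega)}\le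 C\Big(\|\theta_0\|_{H^1(\Omega)}+\int_0^t\|u\|_{H^1(\Omega)}\,ds\Big)\exp\Big(C\int_0^t\|v\|_{W^{1,\infty}(\Omega)}\,ds\Big).$$ -/

import Mathlib

open MeasureTheory Set
open scoped ContDiff ENNReal Topology

noncomputable section

namespace TransportH1

/-- The Euclidean plane. -/
abbrev Plane := EuclideanSpace ℝ (Fin 2)

/-! ### Smooth bounded domains and the outward unit normal -/

/-- `ρ` is a smooth function that describes `Ω` as `{ρ < 0}` near the point `x`, with non-vanishing
gradient at `x`. -/
structure IsLocalDefiningFunction (Ω : Set Plane) (x : Plane) (ρ : Plane → ℝ) : Prop where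
  contDiff : ContDiff ℝ ∞ ρ
  gradient_ne_zero : gradient ρ x ≠ 0
  mem_iff : ∀ᶠ y in 𝓝 x, (y ∈ Ω ↔ ρ y < 0)

/-- Bounded domains (open connected sets) of the plane with `C^∞` boundary. -/
structure IsSmoothBoundedDomain (Ω : Set Plane) : Prop where
  isOpen : IsOpen Ω
  isConnected : IsConnected Ω
  isBounded : Bornology.IsBounded Ω
  exists_definingFunction : ∀ x ∈ frontier Ω, ∃ ρ, IsLocalDefiningFunction Ω x ρ

/-- `ν` is the outward unit normal of `Ω` at the boundary point `x`, that is `∇ρ / |∇ρ|` for a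
local defining function `ρ`. -/
def IsOutwardUnitNormal (Ω : Set Plane) (x ν : Plane) : Prop :=
  ∃ ρ, IsLocalDefiningFunction Ω x ρ ∧ ν = ‖gradient ρ x‖⁻¹ • gradient ρ x

/-! ### Weak derivatives and Sobolev spaces -/

/-- The classical partial derivative in the `i`-th coordinate direction. -/
def partialDeriv (i : Fin 2) (φ : Plane → ℝ) : Plane → ℝ :=
  fun x => fderiv ℝ φ x (EuclideanSpace.single i 1)

/-- The classical derivative `∂₁^{α₁} ∂₂^{α₂} φ`. -/
def multiDeriv (α : Fin 2 → ℕ) (φ : Plane → ℝ) : Plane → ℝ :=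
  (partialDeriv 0)^[α 0] ((partialDeriv 1)^[α 1] φ)

/-- Smooth functions with compact support contained in `U`. -/
structure IsTestFunction {E : Type*} [NormedAddCommGroup E] [NormedSpace ℝ E]
    (U : Set E) (φ : E → ℝ) : Prop where
  contDiff : ContDiff ℝ ∞ φ
  hasCompactSupport : HasCompactSupport φ
  tsupport_subset : tsupport φ ⊆ U

variable {F : Type*} [NormedAddCommGroup F] [NormedSpace ℝ F]

/-- `g` is the weak derivative of order `α` of `f` in `Ω`. -/
def HasWeakDeriv (Ω : Set Plane) (α : Fin 2 → ℕ) (f g : Plane → F) : Prop :=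
  ∀ φ : Plane → ℝ, IsTestFunction Ω φ →
    ∫ x in Ω, multiDeriv α φ x • f x = (-1 : ℝ) ^ (∑ i, α i) • ∫ x in Ω, φ x • g x

/-- Multi-indices `α` with `|α| ≤ k`. -/
abbrev MultiIndex (k : ℕ) := {α : Fin 2 → Fin (k + 1) // ∑ i, (α i : ℕ) ≤ k}

/-- The zero multi-index. -/
def MultiIndex.zero (k : ℕ) : MultiIndex k := ⟨fun _ => 0, by simp⟩

/-- The multi-index of the first derivative in the direction `i`. -/
def MultiIndex.unit {k : ℕ} (i : Fin 2) : MultiIndex (k + 1) :=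
  ⟨fun j => if j = i then 1 else 0, by fin_cases i <;> simp⟩

lemma contDiff_partialDeriv {φ : Plane → ℝ} (h : ContDiff ℝ ∞ φ) (i : Fin 2) :
    ContDiff ℝ ∞ (partialDeriv i φ) :=
  (h.fderiv_right (m := ∞) (by simp)).clm_apply contDiff_const

lemma hasCompactSupport_partialDeriv {φ : Plane → ℝ} (h : HasCompactSupport φ) (i : Fin 2) :
    HasCompactSupport (partialDeriv i φ) :=
  h.fderiv_apply ℝ _

lemma smooth_multiDeriv {φ : Plane → ℝ} (h : ContDiff ℝ ∞ φ) (h' : HasCompactSupport φ)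
    (α : Fin 2 → ℕ) : ContDiff ℝ ∞ (multiDeriv α φ) ∧ HasCompactSupport (multiDeriv α φ) := by
  have key : ∀ (i : Fin 2) (n : ℕ) (ψ : Plane → ℝ), ContDiff ℝ ∞ ψ ∧ HasCompactSupport ψ →
      ContDiff ℝ ∞ ((partialDeriv i)^[n] ψ) ∧ HasCompactSupport ((partialDeriv i)^[n] ψ) := by
    intro i n
    induction n with
    | zero => intro ψ hψ; exact hψ
    | succ n ih =>
      intro ψ hψ
      exact ih _ ⟨contDiff_partialDeriv hψ.1 i, hasCompactSupport_partialDeriv hψ.2 i⟩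
  exact key 0 _ _ (key 1 _ _ ⟨h, h'⟩)

lemma integrable_smul_Lp {Ω : Set Plane} {p : ℝ≥0∞} [Fact (1 ≤ p)] {ψ : Plane → ℝ}
    (hc : Continuous ψ) (hs : HasCompactSupport ψ) (f : Lp F p (volume.restrict Ω)) :
    Integrable (fun x => ψ x • f x) (volume.restrict Ω) :=
  ((Lp.memLp f).locallyIntegrable Fact.out).integrable_smul_left_of_hasCompactSupport hc hs

/-- The Sobolev space `W^{k,p}(Ω; F)`, as a normed space. Its elements are the families `(D^α f)_{|α| ≤ k}` of the weak
derivatives of a function `f` (the member with index `0`), all of them in `L^p(Ω; F)`; the norm is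
`(∑_{|α| ≤ k} ‖D^α f‖_{L^p}^p)^{1/p}`. -/
def sobolevSubmodule (Ω : Set Plane) (F : Type*) [NormedAddCommGroup F] [NormedSpace ℝ F] (k : ℕ)
    (p : ℝ≥0∞) [Fact (1 ≤ p)] :
    Submodule ℝ (PiLp p (fun _ : MultiIndex k => Lp F p (volume.restrict Ω))) where
  carrier := {f | ∀ α : MultiIndex k,
    HasWeakDeriv Ω (fun i => (α.1 i : ℕ)) (f (MultiIndex.zero k)) (f α)}
  zero_mem' := by
    intro α φ _
    have h : ∀ ψ : Plane → ℝ,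
        ∫ x in Ω, ψ x • (0 : Lp F p (volume.restrict Ω)) x = 0 := by
      intro ψ
      rw [← integral_zero Plane F (μ := volume.restrict Ω)]
      refine integral_congr_ae ?_
      filter_upwards [Lp.coeFn_zero F p (volume.restrict Ω)] with x hx
      rw [hx, Pi.zero_apply, smul_zero]
    simp only [PiLp.zero_apply, h, smul_zero]
  add_mem' := by
    intro f g hf hg α φ hφ
    have h : ∀ ψ : Plane → ℝ, Continuous ψ → HasCompactSupport ψ →
        ∀ a b : Lp F p (volume.restrict Ω), ∫ x in Ω, ψ x • (a + b) x
          = (∫ x in Ω, ψ x • a x) + ∫ x in Ω, ψ x • b x := by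
      intro ψ hc hs a b
      rw [← integral_add (integrable_smul_Lp hc hs a) (integrable_smul_Lp hc hs b)]
      refine integral_congr_ae ?_
      filter_upwards [Lp.coeFn_add a b] with x hx
      rw [hx, Pi.add_apply, smul_add]
    have hd := smooth_multiDeriv hφ.contDiff hφ.hasCompactSupport (fun i => (α.1 i : ℕ))
    simp only [PiLp.add_apply]
    rw [h _ hd.1.continuous hd.2, h _ hφ.contDiff.continuous hφ.hasCompactSupport, smul_add,
      hf α φ hφ, hg α φ hφ]
  smul_mem' := by
    intro c f hf α φ hφ
    have h : ∀ (ψ : Plane → ℝ) (a : Lp F p (volume.restrict Ω)),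
        ∫ x in Ω, ψ x • (c • a) x = c • ∫ x in Ω, ψ x • a x := by
      intro ψ a
      rw [← integral_smul]
      refine integral_congr_ae ?_
      filter_upwards [Lp.coeFn_smul c a] with x hx
      rw [hx, Pi.smul_apply, smul_comm]
    simp only [PiLp.smul_apply]
    rw [h, h, hf α φ hφ, smul_comm]

/-- The type of elements of `W^{k,p}(Ω; F)`. -/
abbrev Sobolev (Ω : Set Plane) (F : Type*) [NormedAddCommGroup F] [NormedSpace ℝ F] (k : ℕ)
    (p : ℝ≥0∞) [Fact (1 ≤ p)] : Type _ :=
  sobolevSubmodule Ω F k p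

namespace Sobolev

variable {Ω : Set Plane} {k : ℕ} {p : ℝ≥0∞} [Fact (1 ≤ p)]

/-- The function in `L^p(Ω; F)` underlying an element of `W^{k,p}(Ω; F)`. -/
def toLp (f : Sobolev Ω F k p) : Lp F p (volume.restrict Ω) :=
  f.1 (MultiIndex.zero k)

/-- The weak partial derivative `∂ᵢ f`. -/
def weakPartial (i : Fin 2) (f : Sobolev Ω F (k + 1) p) : Lp F p (volume.restrict Ω) :=
  f.1 (MultiIndex.unit i)

/-- `‖∇f‖_{L²(Ω)}`. -/
def gradNorm (f : Sobolev Ω F 1 2) : ℝ :=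
  Real.sqrt (∑ i, ‖weakPartial i f‖ ^ 2)

/-- `‖f‖_{W^{1,∞}(Ω)}`, the largest of the essential suprema of `|f|`, `|∂₁f|`, `|∂₂f|`. -/
def w1infNorm (f : Sobolev Ω F (k + 1) p) : ℝ≥0∞ :=
  eLpNorm (toLp f) ∞ (volume.restrict Ω) ⊔
    ⨆ i, eLpNorm (weakPartial i f) ∞ (volume.restrict Ω)

end Sobolev

instance factOneLeThree : Fact ((1 : ℝ≥0∞) ≤ 3) := ⟨by norm_num⟩

/-- `w · n = 0` on `∂Ω`: the representative of `w` that is continuous on the closure of `Ω` is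
orthogonal to the outward unit normal at every boundary point. (Elements of `W^{2,3}` of a smooth
bounded planar domain have such a representative.) -/
def NormalTraceZero (Ω : Set Plane) (w : Plane → Plane) : Prop :=
  ∃ W : Plane → Plane, ContinuousOn W (closure Ω) ∧ W =ᵐ[volume.restrict Ω] w ∧
    ∀ x ∈ frontier Ω, ∀ ν, IsOutwardUnitNormal Ω x ν → inner ℝ (W x) ν = 0

/-! ### The transport equation -/

/-- `L²(Ω)`. -/
abbrev L2 (Ω : Set Plane) := Lp ℝ 2 (volume.restrict Ω)

/-- Lebesgue measure on the time interval `[0, S]`. -/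
abbrev timeMeasure (S : ℝ) : Measure ℝ := volume.restrict (Icc 0 S)

/-- `g` is the weak derivative on `(0, S)` of the Banach space valued function `f`. -/
def HasWeakTimeDeriv {X : Type*} [NormedAddCommGroup X] [NormedSpace ℝ X] (S : ℝ)
    (f g : ℝ → X) : Prop :=
  ∀ φ : ℝ → ℝ, IsTestFunction (Ioo 0 S) φ →
    ∫ t in Icc 0 S, deriv φ t • f t = - ∫ t in Icc 0 S, φ t • g t

/-- `θ` is (the representative in `C([0,S]; L²)` of) a solution in
`L^∞(0,S; H¹(Ω)) ∩ H¹(0,S; L²(Ω))` of `θ_t + v·∇θ = -u·e₂`, `θ(0) = θ₀`. Here `Θ` is `θ` as a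
function with values in `H¹(Ω)`, and `θt` is its time derivative. -/
def IsTransportSolution (Ω : Set Plane) (S : ℝ) (v : ℝ → Sobolev Ω Plane 2 3)
    (u : ℝ → Sobolev Ω Plane 1 2) (θ₀ : Sobolev Ω ℝ 1 2) (θ : ℝ → L2 Ω) : Prop :=
  ContinuousOn θ (Icc 0 S) ∧ θ 0 = θ₀.toLp ∧
  ∃ (Θ : ℝ → Sobolev Ω ℝ 1 2) (θt : ℝ → L2 Ω),
    (∀ᵐ t ∂timeMeasure S, (Θ t).toLp = θ t) ∧
    MemLp Θ ∞ (timeMeasure S) ∧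
    MemLp θ 2 (timeMeasure S) ∧ MemLp θt 2 (timeMeasure S) ∧ HasWeakTimeDeriv S θ θt ∧
    ∀ᵐ t ∂timeMeasure S, ∀ᵐ x ∂volume.restrict Ω,
      θt t x + ∑ i, (v t).toLp x i * (Θ t).weakPartial i x = - (u t).toLp x 1

end TransportH1

end

open TransportH1

/-!
The proof is Lagrangian. On a smooth bounded domain `W^{2,3} ⊆ W^{1,∞}` (Morrey's inequality,
`IsSmoothBoundedDomain.exists_morrey`), and a `W^{1,∞}` function is Lipschitz with a constant
controlled by its norm (`IsSmoothBoundedDomain.exists_lipschitz`). So `v(t)` agrees on `Ω` with a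
vector field `V(t)` of the whole plane that is bounded and Lipschitz with a constant
`A(t) ≤ C ‖v(t)‖_{W^{1,∞}}`, and `A` is integrable (`IsSmoothBoundedDomain.exists_tangentField`).
Such a field has a flow `X(t,s)`, which is bi-Lipschitz with constant `exp (2 |∫ₛᵗ A|)`
(`LipField.flow`). As `V` is tangent to `∂Ω`, a local defining function `ρ` of the boundary satisfies
`|d/dt ρ(X)| ≤ K A |ρ(X)|` along trajectories, which therefore never reach the boundary
(`LipField.flow_mem`).

The solution operators of the homogeneous equation are the compositions `E(t,s) f = f ∘ X(s,t)`.
They are jointly continuous on `L²(Ω)`, and the chain rule with Rademacher's theorem shows that they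
preserve `H¹(Ω)` and multiply gradients at most by the square of the Lipschitz constant
(`IsBiLip.exists_comp_sobolev`). With `g = u · e₂`, the solution is given by Duhamel's formula
`θ(t) = E(t,0) θ₀ - ∫₀ᵗ E(t,s) g(s) ds`, from which the bound of the gradient is read off
(`TangentField.exists_duhamel_sobolev`).

To see that `θ` solves the equation (`TangentField.duhamel_sub`), one tests with `ψ ∈ C_c^∞(Ω)`. By
the identity `E(t,s) f - f = -∫ₛᵗ E(t,r) (V(r) · ∇f) dr` (`TangentField.evol_sub_self`), the increment
of `θ` over a short interval `[s, t]` equals that of `-∫ (g + V · ∇θ)` up to two errors: the effect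
of the bi-Lipschitz maps `X(r,t)`, which are close to the identity and almost preserve area
(`IsBiLip.abs_integral_mul_comp_sub_le`), and the term `V · ∇(θ(r) - θ(s))`, which after integration
by parts is controlled by `‖θ(r) - θ(s)‖_{L²}` (`TangentField.exists_abs_inner_advect_le`). Both are of
smaller order than the integral of a fixed integrable function over `[s, t]`, and a function with such
increments is constant (`eq_of_forall_norm_sub_le`). This criterion replaces differentiation in time
throughout.

Uniqueness is the energy estimate. The difference `w` of two solutions satisfies
`‖w(t)‖² = -2 ∫₀ᵗ ⟨V · ∇w, w⟩`. The inequality `-⟨V · ∇f, f⟩ ≤ 2 A ‖f‖²`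
(`TangentField.neg_inner_advect_le`) follows, without traces, from the growth of the `L²` norm under
the flow of the field frozen in time, and Grönwall's inequality gives `w = 0`.

Measurability in time with values in the separable space `H¹` is reduced to that in `L²` by the
Lusin–Souslin theorem (`Sobolev.aestronglyMeasurable_of_toLp`).
-/

noncomputable section

namespace TransportH1

/-! ### Grönwall's inequality with integrable coefficients -/

/-- A function of time is constant as soon as its increments over short intervals are small
compared with those of a fixed function `I`. -/
theorem eq_of_forall_norm_sub_le {E : Type*} [NormedAddCommGroup E] {D : ℝ → E} {I : ℝ → ℝ}
    {a b : ℝ} (hab : a ≤ b)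
    (h : ∀ ε > 0, ∃ δ > 0, ∀ s t, a ≤ s → s ≤ t → t ≤ b → t - s < δ →
      ‖D t - D s‖ ≤ ε * (I t - I s)) : D b = D a := by
  have key : ∀ ε > 0, ‖D b - D a‖ ≤ ε * (I b - I a) := by
    intro ε hε
    obtain ⟨δ, hδ, H⟩ := h ε hε
    obtain ⟨n, hn⟩ := exists_nat_gt ((b - a) / δ)
    have hn0 : (0 : ℝ) < n := lt_of_le_of_lt (div_nonneg (by linarith) hδ.le) hn
    have hn' : (b - a) / n < δ := by
      rw [div_lt_iff₀ hn0]; rw [div_lt_iff₀ hδ] at hn; linarith [mul_comm δ (n : ℝ)]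
    have hq : 0 ≤ (b - a) / n := div_nonneg (by linarith) hn0.le
    set p : ℕ → ℝ := fun k => a + k * ((b - a) / n) with hp
    have hpn : p n = b := by simp only [hp]; field_simp; ring
    have hp0 : p 0 = a := by simp [hp]
    have hstep : ∀ k, p (k + 1) - p k = (b - a) / n := by intro k; simp only [hp]; push_cast; ring
    have hmono : Monotone p := monotone_nat_of_le_succ fun k => by linarith [hstep k]
    rw [← hpn, ← hp0, ← Finset.sum_range_sub (fun k => D (p k)),
      ← Finset.sum_range_sub (fun k => I (p k)), Finset.mul_sum]
    refine norm_sum_le_of_le _ fun k hk => ?_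
    have hk' : k + 1 ≤ n := Finset.mem_range.1 hk
    exact H _ _ (by rw [← hp0]; exact hmono (Nat.zero_le _)) (by linarith [hstep k])
      (by rw [← hpn]; exact hmono hk') (by rw [hstep]; exact hn')
  have hz : ‖D b - D a‖ ≤ 0 := by
    by_contra! hc
    have h1 := key (‖D b - D a‖ / (2 * (|I b - I a| + 1))) (by positivity)
    have h2 : ‖D b - D a‖ / (2 * (|I b - I a| + 1)) * (I b - I a)
        ≤ ‖D b - D a‖ / (2 * (|I b - I a| + 1)) * (|I b - I a| + 1) := by
      gcongr; linarith [le_abs_self (I b - I a)]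
    have h3 : ‖D b - D a‖ / (2 * (|I b - I a| + 1)) * (|I b - I a| + 1) = ‖D b - D a‖ / 2 := by
      have : |I b - I a| + 1 ≠ 0 := by positivity
      field_simp
    linarith
  exact sub_eq_zero.1 (norm_le_zero_iff.1 hz)

section Gronwall

variable {A : ℝ → ℝ}

lemma continuous_primitive (hA : ∀ a b, IntervalIntegrable A volume a b) (s : ℝ) :
    Continuous fun t => ∫ r in s..t, A r :=
  intervalIntegral.continuous_primitive hA s

lemma integral_mono_right (h0 : ∀ t, 0 ≤ A t) (hA : ∀ a b, IntervalIntegrable A volume a b)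
    (s : ℝ) : Monotone fun t => ∫ r in s..t, A r := by
  intro a b hab
  have := intervalIntegral.integral_add_adjacent_intervals (hA s a) (hA a b)
  have h2 : 0 ≤ ∫ r in a..b, A r := intervalIntegral.integral_nonneg hab fun r _ => h0 r
  simp only
  linarith

/-- The fundamental theorem of calculus for `exp (c I)`, with `I` a primitive of `A ∈ L¹`. -/
theorem integral_mul_exp (h0 : ∀ t, 0 ≤ A t) (hA : ∀ a b, IntervalIntegrable A volume a b)
    (c s : ℝ) {a b : ℝ} (hab : a ≤ b) :
    c * ∫ t in a..b, A t * Real.exp (c * ∫ r in s..t, A r)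
      = Real.exp (c * ∫ r in s..b, A r) - Real.exp (c * ∫ r in s..a, A r) := by
  set I : ℝ → ℝ := fun t => ∫ r in s..t, A r with hI
  have hIc : Continuous I := continuous_primitive hA s
  have hIm : Monotone I := integral_mono_right h0 hA s
  have hIsub : ∀ x y, I y - I x = ∫ r in x..y, A r := fun x y =>
    intervalIntegral.integral_interval_sub_left (hA s y) (hA s x)
  have hexp : Continuous fun t => Real.exp (c * I t) := by fun_prop
  have hint : ∀ x y, IntervalIntegrable (fun t => A t * Real.exp (c * I t)) volume x y :=
    fun x y => (hA x y).mul_continuousOn hexp.continuousOn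
  have key := eq_of_forall_norm_sub_le (D := fun t => Real.exp (c * I t)
    - c * ∫ t in a..t, A t * Real.exp (c * I t)) (I := I) hab ?_
  · simp only [intervalIntegral.integral_same] at key
    linarith
  intro ε hε
  obtain ⟨δ, hδ, H⟩ := Metric.uniformContinuousOn_iff.1
    (isCompact_Icc.uniformContinuousOn_of_continuous (hexp.continuousOn (s := Icc a b)))
    (ε / (|c| + 1)) (by positivity)
  refine ⟨δ, hδ, fun x y hx hxy hy hd => ?_⟩
  -- the mean value theorem at an intermediate value `I z` of the continuous function `I`
  obtain ⟨z, hz, hzeq⟩ : ∃ z ∈ Icc x y, Real.exp (c * I y) - Real.exp (c * I x)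
      = c * (I y - I x) * Real.exp (c * I z) := by
    rcases (hIm hxy).eq_or_lt with h | h
    · exact ⟨x, left_mem_Icc.2 hxy, by simp [h]⟩
    · obtain ⟨ξ, hξ, hξ'⟩ := exists_hasDerivAt_eq_slope (fun u => Real.exp (c * u))
        (fun u => Real.exp (c * u) * (c * 1)) h (by fun_prop)
        (fun u _ => ((hasDerivAt_id u).const_mul c).exp)
      obtain ⟨z, hz, rfl⟩ := intermediate_value_Icc hxy hIc.continuousOn (Ioo_subset_Icc_self hξ)
      refine ⟨z, hz, ?_⟩
      rw [eq_div_iff (by linarith)] at hξ'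
      rw [← hξ']; ring
  have e1 : (Real.exp (c * I y) - c * ∫ t in a..y, A t * Real.exp (c * I t))
      - (Real.exp (c * I x) - c * ∫ t in a..x, A t * Real.exp (c * I t))
      = c * ∫ t in x..y, A t * (Real.exp (c * I z) - Real.exp (c * I t)) := by
    have e2 := intervalIntegral.integral_interval_sub_left (hint a y) (hint a x)
    simp only [mul_sub]
    rw [intervalIntegral.integral_sub ((hA x y).mul_const _) (hint x y),
      intervalIntegral.integral_mul_const, ← hIsub, ← e2]
    linear_combination hzeq
  rw [e1, norm_mul]
  have e3 : ‖∫ t in x..y, A t * (Real.exp (c * I z) - Real.exp (c * I t))‖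
      ≤ ∫ t in x..y, A t * (ε / (|c| + 1)) := by
    refine intervalIntegral.norm_integral_le_of_norm_le hxy (ae_of_all _ fun t ht => ?_)
      ((hA x y).mul_const _)
    rw [norm_mul, Real.norm_of_nonneg (h0 t)]
    refine mul_le_mul_of_nonneg_left ?_ (h0 t)
    have := H z ⟨by linarith [hz.1], by linarith [hz.2]⟩ t ⟨by linarith [ht.1], by linarith [ht.2]⟩
      (by rw [Real.dist_eq, abs_lt]; constructor <;> linarith [hz.1, hz.2, ht.1, ht.2])
    rw [Real.dist_eq] at this
    exact this.le
  rw [intervalIntegral.integral_mul_const, ← hIsub] at e3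
  have hnn : 0 ≤ I y - I x := by linarith [hIm hxy]
  calc ‖c‖ * _ ≤ |c| * ((I y - I x) * (ε / (|c| + 1))) := by
        rw [Real.norm_eq_abs]; gcongr
    _ = ε * (I y - I x) * (|c| / (|c| + 1)) := by ring
    _ ≤ ε * (I y - I x) * 1 := by
        gcongr; rw [div_le_one (by positivity)]; linarith
    _ = _ := by ring

/-- Two-sided in time: both for `s ≤ t` and for `t ≤ s`. -/
theorem abs_integral_mul_exp_abs (h0 : ∀ t, 0 ≤ A t)
    (hA : ∀ a b, IntervalIntegrable A volume a b) (s t : ℝ) :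
    |∫ τ in s..t, A τ * Real.exp (2 * |∫ r in s..τ, A r|)|
      = (Real.exp (2 * |∫ r in s..t, A r|) - 1) / 2 := by
  have hIm := integral_mono_right h0 hA s
  rcases le_total s t with hst | hst
  · have hnn : ∀ τ, s ≤ τ → 0 ≤ ∫ r in s..τ, A r := fun τ hτ => by simpa using hIm hτ
    have := integral_mul_exp h0 hA 2 s hst
    rw [intervalIntegral.integral_congr (g := fun τ => A τ * Real.exp (2 * ∫ r in s..τ, A r)),
      abs_of_nonneg, abs_of_nonneg (hnn t hst)]
    · simp at this; linarith
    · exact intervalIntegral.integral_nonneg hst fun τ _ => mul_nonneg (h0 τ) (Real.exp_nonneg _)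
    · intro τ hτ
      rw [uIcc_of_le hst] at hτ
      simp only [abs_of_nonneg (hnn τ hτ.1)]
  · have hnn : ∀ τ, τ ≤ s → ∫ r in s..τ, A r ≤ 0 := fun τ hτ => by simpa using hIm hτ
    have := integral_mul_exp h0 hA (-2) s hst
    rw [intervalIntegral.integral_symm, abs_neg,
      intervalIntegral.integral_congr (g := fun τ => A τ * Real.exp (-2 * ∫ r in s..τ, A r)),
      abs_of_nonneg, abs_of_nonpos (hnn t hst)]
    · simp at this; simp; linarith
    · exact intervalIntegral.integral_nonneg hst fun τ _ => mul_nonneg (h0 τ) (Real.exp_nonneg _)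
    · intro τ hτ
      rw [uIcc_of_le hst] at hτ
      simp only [abs_of_nonpos (hnn τ hτ.2)]
      ring_nf

lemma norm_integral_le_abs_integral {E : Type*} [NormedAddCommGroup E] [NormedSpace ℝ E]
    {f : ℝ → E} {g : ℝ → ℝ} {s t : ℝ} (hg : IntervalIntegrable g volume s t)
    (h : ∀ r ∈ uIcc s t, ‖f r‖ ≤ g r) : ‖∫ r in s..t, f r‖ ≤ |∫ r in s..t, g r| :=
  intervalIntegral.norm_integral_le_abs_of_norm_le
    ((ae_restrict_iff' measurableSet_uIoc).2 (ae_of_all _ fun r hr => h r (uIoc_subset_uIcc hr))) hg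

/-- **Grönwall's inequality** with an integrable coefficient, forward and backward in time. -/
theorem le_mul_exp_of_le_add_abs_integral (h0 : ∀ t, 0 ≤ A t)
    (hA : ∀ a b, IntervalIntegrable A volume a b) {f : ℝ → ℝ} {c s t : ℝ}
    (hf : ContinuousOn f (uIcc s t)) (hf0 : ∀ r ∈ uIcc s t, 0 ≤ f r)
    (h : ∀ r ∈ uIcc s t, f r ≤ c + |∫ τ in s..r, A τ * f τ|) :
    f t ≤ c * Real.exp (2 * |∫ r in s..t, A r|) := by
  have hE : Continuous fun t => Real.exp (2 * |∫ r in s..t, A r|) := by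
    have := continuous_primitive hA s
    fun_prop
  obtain ⟨t', ht', hmax⟩ := isCompact_uIcc.exists_isMaxOn nonempty_uIcc
    (hf.mul (hE.inv₀ fun t => (Real.exp_pos _).ne').continuousOn)
  set m := f t' * (Real.exp (2 * |∫ r in s..t', A r|))⁻¹ with hm
  have hm0 : 0 ≤ m := mul_nonneg (hf0 _ ht') (inv_nonneg.2 (Real.exp_nonneg _))
  have hle : ∀ r ∈ uIcc s t, f r ≤ m * Real.exp (2 * |∫ r in s..r, A r|) := fun r hr => by
    have := hmax hr
    simp only [mem_ofPred_eq, Pi.mul_apply, Pi.inv_apply] at this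
    rwa [← div_eq_mul_inv, div_le_iff₀ (Real.exp_pos _)] at this
  have hbound : ∀ r ∈ uIcc s t,
      f r ≤ c + m * ((Real.exp (2 * |∫ r in s..r, A r|) - 1) / 2) := fun r hr => by
    have hsub : uIcc s r ⊆ uIcc s t := uIcc_subset_uIcc_left hr
    refine (h r hr).trans ?_
    rw [← abs_integral_mul_exp_abs h0 hA s r]
    have : |∫ τ in s..r, A τ * f τ|
        ≤ |∫ τ in s..r, m * (A τ * Real.exp (2 * |∫ r in s..τ, A r|))| := by
      refine norm_integral_le_abs_integral (E := ℝ)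
        (((hA s r).mul_continuousOn hE.continuousOn).const_mul m) fun τ hτ => ?_
      rw [Real.norm_of_nonneg (mul_nonneg (h0 τ) (hf0 τ (hsub hτ)))]
      nlinarith [hle τ (hsub hτ), h0 τ]
    rw [intervalIntegral.integral_const_mul, abs_mul, abs_of_nonneg hm0] at this
    linarith
  have hE1 : 1 ≤ Real.exp (2 * |∫ r in s..t', A r|) := Real.one_le_exp (by positivity)
  have hmc : m ≤ 2 * c := by
    have h1 := hbound t' ht'
    have h2 : f t' = m * Real.exp (2 * |∫ r in s..t', A r|) := by
      rw [hm, inv_mul_cancel_right₀ (Real.exp_pos _).ne']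
    rw [h2] at h1
    set e := Real.exp (2 * |∫ r in s..t', A r|)
    by_contra! hc
    nlinarith [mul_nonneg hm0 (by linarith : 0 ≤ e - 1)]
  have h3 := hbound t right_mem_uIcc
  have hE2 : 1 ≤ Real.exp (2 * |∫ r in s..t, A r|) := Real.one_le_exp (by positivity)
  nlinarith

end Gronwall

/-! ### The flow of a Lipschitz vector field -/

/-- A time-dependent vector field on the plane that is bounded and Lipschitz in space with constant
`A t` at time `t`, where `A` is locally integrable in time. -/
structure LipField (V : ℝ → Plane → Plane) (A : ℝ → ℝ) : Prop where
  measurable : ∀ x, Measurable fun t => V t x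
  norm_le : ∀ t x, ‖V t x‖ ≤ A t
  lipschitz : ∀ t x y, ‖V t x - V t y‖ ≤ A t * ‖x - y‖
  integrable : ∀ a b, IntervalIntegrable A volume a b

namespace LipField

variable {V : ℝ → Plane → Plane} {A : ℝ → ℝ}

lemma nonneg (h : LipField V A) (t : ℝ) : 0 ≤ A t := (norm_nonneg _).trans (h.norm_le t 0)

lemma lipschitzWith (h : LipField V A) (t : ℝ) : LipschitzWith ⟨A t, h.nonneg t⟩ (V t) :=
  LipschitzWith.of_dist_le_mul fun x y => by
    rw [dist_eq_norm, dist_eq_norm]; exact h.lipschitz t x y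

lemma continuous (h : LipField V A) (t : ℝ) : Continuous (V t) := (h.lipschitzWith t).continuous

lemma measurable_uncurry (h : LipField V A) : Measurable fun p : ℝ × Plane => V p.1 p.2 := by
  have := stronglyMeasurable_uncurry_of_continuous_of_stronglyMeasurable
    (u := fun (x : Plane) (t : ℝ) => V t x) (fun t => h.continuous t)
    fun x => (h.measurable x).stronglyMeasurable
  exact this.measurable.comp measurable_swap

lemma measurable_comp (h : LipField V A) {X : ℝ → Plane} (hX : Measurable X) : Measurable fun t => V t (X t) :=
  h.measurable_uncurry.comp (measurable_id.prodMk hX)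

lemma integrable_comp (h : LipField V A) {X : ℝ → Plane} (hX : Measurable X) (a b : ℝ) :
    IntervalIntegrable (fun t => V t (X t)) volume a b :=
  (h.integrable a b).mono_fun' (h.measurable_comp hX).aestronglyMeasurable
    (ae_of_all _ fun t => h.norm_le t _)

lemma norm_integral_le (h : LipField V A) {X : ℝ → Plane} (s t : ℝ) :
    ‖∫ r in s..t, V r (X r)‖ ≤ |∫ r in s..t, A r| :=
  norm_integral_le_abs_integral (h.integrable s t) fun r _ => h.norm_le r _

/-- Integral curves through any point, defined for all times. In the space of bounded continuous
functions, `Y t = exp (-2 |∫ₛᵗ A|) X t` is a fixed point of a contraction of ratio `1/2`. -/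
theorem exists_flowLine (h : LipField V A) (s : ℝ) (x : Plane) : ∃ X : ℝ → Plane, Continuous X ∧
    ∀ t, X t = x + ∫ r in s..t, V r (X r) := by
  set e : ℝ → ℝ := fun t => Real.exp (2 * |∫ r in s..t, A r|) with he
  have hec : Continuous e := by
    have := continuous_primitive h.integrable s
    fun_prop
  have hepos : ∀ t, 0 < e t := fun t => Real.exp_pos _
  have he1 : ∀ t, 1 ≤ e t := fun t => Real.one_le_exp (by positivity)
  have hint : ∀ (Y : BoundedContinuousFunction ℝ Plane) (a b : ℝ),
      IntervalIntegrable (fun r => V r (e r • Y r)) volume a b := fun Y a b =>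
    h.integrable_comp (hec.smul Y.continuous).measurable a b
  let Φ : BoundedContinuousFunction ℝ Plane → BoundedContinuousFunction ℝ Plane := fun Y =>
    BoundedContinuousFunction.ofNormedAddCommGroup
      (fun t => (e t)⁻¹ • (x + ∫ r in s..t, V r (e r • Y r)))
      ((hec.inv₀ fun t => (hepos t).ne').smul
        (continuous_const.add (intervalIntegral.continuous_primitive (hint Y) s)))
      (‖x‖ + 1) (fun t => by
        rw [norm_smul, norm_inv, Real.norm_of_nonneg (hepos t).le, inv_mul_le_iff₀ (hepos t)]
        have h1 := norm_add_le x (∫ r in s..t, V r (e r • Y r))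
        have h2 := h.norm_integral_le (X := fun r => e r • Y r) s t
        have h3 : 2 * |∫ r in s..t, A r| + 1 ≤ e t := Real.add_one_le_exp _
        nlinarith [he1 t, norm_nonneg x, abs_nonneg (∫ r in s..t, A r)])
  have hΦ : ContractingWith (1 / 2) Φ := by
    refine ⟨by rw [← NNReal.coe_lt_coe]; norm_num, LipschitzWith.of_dist_le_mul fun Y Z => ?_⟩
    rw [BoundedContinuousFunction.dist_le (by positivity)]
    intro t
    rw [dist_eq_norm]
    change ‖(e t)⁻¹ • (x + ∫ r in s..t, V r (e r • Y r))
      - (e t)⁻¹ • (x + ∫ r in s..t, V r (e r • Z r))‖ ≤ _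
    rw [← smul_sub, norm_smul, norm_inv, Real.norm_of_nonneg (hepos t).le,
      inv_mul_le_iff₀ (hepos t), add_sub_add_left_eq_sub,
      ← intervalIntegral.integral_sub (hint Y s t) (hint Z s t)]
    have h1 : ‖∫ r in s..t, (V r (e r • Y r) - V r (e r • Z r))‖
        ≤ |∫ r in s..t, A r * e r * dist Y Z| := by
      refine norm_integral_le_abs_integral
        (((h.integrable s t).mul_continuousOn hec.continuousOn).mul_const _) fun r _ => ?_
      refine (h.lipschitz r _ _).trans ?_
      rw [← smul_sub, norm_smul, Real.norm_of_nonneg (hepos r).le, ← dist_eq_norm, mul_assoc]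
      have := BoundedContinuousFunction.dist_coe_le_dist (f := Y) (g := Z) r
      have := h.nonneg r
      have := (hepos r).le
      gcongr
    rw [intervalIntegral.integral_mul_const, abs_mul, abs_of_nonneg dist_nonneg,
      abs_integral_mul_exp_abs h.nonneg h.integrable] at h1
    refine h1.trans ?_
    have := dist_nonneg (x := Y) (y := Z)
    push_cast
    change (e t - 1) / 2 * _ ≤ _
    nlinarith
  set Y := hΦ.fixedPoint Φ
  have hY : ∀ t, Y t = (e t)⁻¹ • (x + ∫ r in s..t, V r (e r • Y r)) := fun t => by
    have : Φ Y = Y := hΦ.fixedPoint_isFixedPt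
    conv_lhs => rw [← this]
    rfl
  refine ⟨fun t => e t • Y t, hec.smul Y.continuous, fun t => ?_⟩
  simp only
  rw [hY t, smul_inv_smul₀ (hepos t).ne']

/-- Continuous dependence on the initial point; for `x = y` this is uniqueness. -/
theorem norm_sub_le_of_flowLine (h : LipField V A) {s : ℝ} {x y : Plane} {X Y : ℝ → Plane}
    (hX : Continuous X) (hY : Continuous Y)
    (eX : ∀ t, X t = x + ∫ r in s..t, V r (X r)) (eY : ∀ t, Y t = y + ∫ r in s..t, V r (Y r))
    (t : ℝ) : ‖X t - Y t‖ ≤ Real.exp (2 * |∫ r in s..t, A r|) * ‖x - y‖ := by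
  rw [mul_comm]
  refine le_mul_exp_of_le_add_abs_integral h.nonneg h.integrable (f := fun t => ‖X t - Y t‖)
    (hX.sub hY).norm.continuousOn (fun _ _ => norm_nonneg _) fun r _ => ?_
  rw [eX r, eY r, add_sub_add_comm, ← intervalIntegral.integral_sub
    (h.integrable_comp hX.measurable s r) (h.integrable_comp hY.measurable s r)]
  refine (norm_add_le _ _).trans (add_le_add le_rfl ?_)
  exact norm_integral_le_abs_integral
    ((h.integrable s r).mul_continuousOn (hX.sub hY).norm.continuousOn) fun τ _ =>
    h.lipschitz τ _ _

/-- The flow of `V`: the position at time `t` of the particle that is at `x` at time `s`. -/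
def flow (h : LipField V A) (t s : ℝ) (x : Plane) : Plane := (h.exists_flowLine s x).choose t

lemma continuous_flow (h : LipField V A) (s : ℝ) (x : Plane) : Continuous fun t => h.flow t s x :=
  (h.exists_flowLine s x).choose_spec.1

lemma flow_eq (h : LipField V A) (t s : ℝ) (x : Plane) :
    h.flow t s x = x + ∫ r in s..t, V r (h.flow r s x) :=
  (h.exists_flowLine s x).choose_spec.2 t

lemma eq_flow (h : LipField V A) {s : ℝ} {x : Plane} {X : ℝ → Plane} (hX : Continuous X)
    (eX : ∀ t, X t = x + ∫ r in s..t, V r (X r)) (t : ℝ) : X t = h.flow t s x := by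
  have := h.norm_sub_le_of_flowLine hX (h.continuous_flow s x) eX (fun t => h.flow_eq t s x) t
  rw [sub_self, norm_zero, mul_zero] at this
  exact sub_eq_zero.1 (norm_le_zero_iff.1 this)

@[simp]
lemma flow_self (h : LipField V A) (s : ℝ) (x : Plane) : h.flow s s x = x := by
  rw [h.flow_eq, intervalIntegral.integral_same, add_zero]

@[simp]
lemma flow_flow (h : LipField V A) (t r s : ℝ) (x : Plane) : h.flow t r (h.flow r s x) = h.flow t s x := by
  refine (h.eq_flow (h.continuous_flow s x) (fun τ => ?_) t).symm
  have hi := h.integrable_comp (h.continuous_flow s x).measurable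
  rw [h.flow_eq τ s x, h.flow_eq r s x, add_assoc,
    intervalIntegral.integral_add_adjacent_intervals (hi s r) (hi r τ)]

lemma norm_flow_sub_flow_le (h : LipField V A) (t s : ℝ) (x y : Plane) :
    ‖h.flow t s x - h.flow t s y‖ ≤ Real.exp (2 * |∫ r in s..t, A r|) * ‖x - y‖ :=
  h.norm_sub_le_of_flowLine (h.continuous_flow s x) (h.continuous_flow s y)
    (fun t => h.flow_eq t s x) (fun t => h.flow_eq t s y) t

lemma norm_flow_sub_le (h : LipField V A) (t s : ℝ) (x : Plane) : ‖h.flow t s x - x‖ ≤ |∫ r in s..t, A r| := by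
  rw [h.flow_eq t s x, add_sub_cancel_left]
  exact h.norm_integral_le s t

lemma norm_flow_sub_flow_time_le (h : LipField V A) (t r s : ℝ) (x : Plane) :
    ‖h.flow t s x - h.flow r s x‖ ≤ |∫ τ in r..t, A τ| := by
  rw [← h.flow_flow t r s x]
  exact h.norm_flow_sub_le t r _

lemma continuous_flow_uncurry (h : LipField V A) (s : ℝ) : Continuous fun p : ℝ × Plane => h.flow p.1 s p.2 := by
  rw [continuous_iff_continuousAt]
  rintro ⟨t, x⟩
  rw [ContinuousAt, tendsto_iff_norm_sub_tendsto_zero]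
  have hI := continuous_primitive h.integrable s
  have hI' := continuous_primitive h.integrable t
  have : Filter.Tendsto (fun p : ℝ × Plane => Real.exp (2 * |∫ r in s..p.1, A r|) * ‖p.2 - x‖
      + |∫ r in t..p.1, A r|) (𝓝 (t, x)) (𝓝 (Real.exp (2 * |∫ r in s..t, A r|) * ‖x - x‖
      + |∫ r in t..t, A r|)) := by
    refine Continuous.tendsto' ?_ _ _ rfl
    have h1 := hI.comp (continuous_fst (X := ℝ) (Y := Plane))
    have h2 := hI'.comp (continuous_fst (X := ℝ) (Y := Plane))
    simp only [Function.comp_def] at h1 h2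
    fun_prop
  simp only [sub_self, norm_zero, mul_zero, intervalIntegral.integral_same, abs_zero,
    add_zero] at this
  refine squeeze_zero (fun _ => norm_nonneg _) (fun p => ?_) this
  calc ‖h.flow p.1 s p.2 - h.flow t s x‖
      ≤ ‖h.flow p.1 s p.2 - h.flow p.1 s x‖ + ‖h.flow p.1 s x - h.flow t s x‖ :=
        norm_sub_le_norm_sub_add_norm_sub _ _ _
    _ ≤ _ := add_le_add (h.norm_flow_sub_flow_le _ _ _ _) (h.norm_flow_sub_flow_time_le _ _ _ _)

/-- The chain rule along a particle path. -/
theorem comp_flow_sub (h : LipField V A) {f : Plane → ℝ} (hf : ContDiff ℝ 1 f) (s a b : ℝ) (x : Plane) :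
    f (h.flow b s x) - f (h.flow a s x)
      = ∫ r in a..b, fderiv ℝ f (h.flow r s x) (V r (h.flow r s x)) := by
  wlog hab : a ≤ b generalizing a b
  · rw [intervalIntegral.integral_symm, ← this b a (le_of_not_ge hab)]; ring
  set X := fun t => h.flow t s x with hX
  have hXc : Continuous X := h.continuous_flow s x
  have hf' : Continuous (fderiv ℝ f) := hf.continuous_fderiv one_ne_zero
  have hmeas : Measurable fun r => fderiv ℝ f (X r) (V r (X r)) :=
    (isBoundedBilinearMap_apply.continuous).measurable.comp
      ((hf'.comp hXc).measurable.prodMk (h.measurable_comp hXc.measurable))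
  have hbd : ∀ r, ‖fderiv ℝ f (X r) (V r (X r))‖ ≤ A r * ‖fderiv ℝ f (X r)‖ := fun r => by
    rw [mul_comm]
    exact (ContinuousLinearMap.le_opNorm _ _).trans
      (mul_le_mul_of_nonneg_left (h.norm_le _ _) (norm_nonneg _))
  have hint : ∀ y z, IntervalIntegrable (fun r => fderiv ℝ f (X r) (V r (X r))) volume y z :=
    fun y z => ((h.integrable y z).mul_continuousOn
      (hf'.comp hXc).norm.continuousOn).mono_fun' hmeas.aestronglyMeasurable (ae_of_all _ hbd)
  have hIsub : ∀ y z, (∫ r in a..z, A r) - (∫ r in a..y, A r) = ∫ r in y..z, A r := fun y z =>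
    intervalIntegral.integral_interval_sub_left (h.integrable a z) (h.integrable a y)
  have key := eq_of_forall_norm_sub_le (D := fun t => f (X t)
    - ∫ r in a..t, fderiv ℝ f (X r) (V r (X r))) (I := fun t => ∫ r in a..t, A r) hab ?_
  · simp only [intervalIntegral.integral_same] at key
    change f (X b) - f (X a) = _
    linarith
  intro ε hε
  obtain ⟨R, hR⟩ := (isCompact_Icc (a := a) (b := b)).image hXc |>.isBounded.subset_closedBall 0
  have hu := (isCompact_closedBall (0 : Plane) R).uniformContinuousOn_of_continuous
    hf'.continuousOn
  obtain ⟨η, hη, Hη⟩ := Metric.uniformContinuousOn_iff.1 hu (ε / 2) (by positivity)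
  obtain ⟨δ, hδ, Hδ⟩ := Metric.uniformContinuousOn_iff.1
    (isCompact_Icc.uniformContinuousOn_of_continuous (hXc.continuousOn (s := Icc a b))) η hη
  refine ⟨δ, hδ, fun y z hy hyz hz hd => ?_⟩
  have hmem : ∀ r ∈ Icc y z, X r ∈ Metric.closedBall 0 R := fun r hr =>
    hR ⟨r, ⟨by linarith [hr.1], by linarith [hr.2]⟩, rfl⟩
  have hdist : ∀ r ∈ Icc y z, dist (X r) (X y) < η := fun r hr =>
    Hδ r ⟨by linarith [hr.1], by linarith [hr.2]⟩ y ⟨hy, by linarith⟩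
      (by rw [Real.dist_eq, abs_lt]; constructor <;> linarith [hr.1, hr.2])
  have hXsub : X z - X y = ∫ r in y..z, V r (X r) := by
    have hi := h.integrable_comp hXc.measurable
    rw [← intervalIntegral.integral_interval_sub_left (hi s z) (hi s y)]
    simp only [hX]
    rw [h.flow_eq z s x, h.flow_eq y s x, add_sub_add_left_eq_sub]
  have hI0 : 0 ≤ ∫ r in y..z, A r := intervalIntegral.integral_nonneg hyz fun r _ => h.nonneg r
  have t1 : ‖f (X z) - f (X y) - fderiv ℝ f (X y) (X z - X y)‖ ≤ ε / 2 * ‖X z - X y‖ := by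
    refine Convex.norm_image_sub_le_of_norm_hasFDerivWithin_le' (f' := fderiv ℝ f)
      (s := Metric.closedBall 0 R ∩ Metric.ball (X y) η)
      (fun w _ => (hf.differentiable one_ne_zero w).hasFDerivAt.hasFDerivWithinAt)
      (fun w hw => ?_) ((convex_closedBall _ _).inter (convex_ball _ _))
      ⟨hmem y (left_mem_Icc.2 hyz), by simpa using hη⟩
      ⟨hmem z (right_mem_Icc.2 hyz), hdist z (right_mem_Icc.2 hyz)⟩
    rw [← dist_eq_norm]
    exact (Hη w hw.1 _ (hmem y (left_mem_Icc.2 hyz)) hw.2).le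
  have t2 : ‖fderiv ℝ f (X y) (X z - X y) - ∫ r in y..z, fderiv ℝ f (X r) (V r (X r))‖
      ≤ ∫ r in y..z, ε / 2 * A r := by
    rw [hXsub, ← ContinuousLinearMap.intervalIntegral_comp_comm _
      (h.integrable_comp hXc.measurable y z), ← intervalIntegral.integral_sub
      ⟨ContinuousLinearMap.integrable_comp _ (h.integrable_comp hXc.measurable y z).1,
        ContinuousLinearMap.integrable_comp _ (h.integrable_comp hXc.measurable y z).2⟩ (hint y z)]
    refine intervalIntegral.norm_integral_le_of_norm_le hyz (ae_of_all _ fun r hr => ?_)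
      ((h.integrable y z).const_mul _)
    have hr' : r ∈ Icc y z := ⟨hr.1.le, hr.2⟩
    rw [← sub_apply]
    refine (ContinuousLinearMap.le_opNorm _ _).trans
      (mul_le_mul ?_ (h.norm_le _ _) (norm_nonneg _) (by positivity))
    rw [← dist_eq_norm, dist_comm]
    exact (Hη _ (hmem r hr') _ (hmem y (left_mem_Icc.2 hyz)) (hdist r hr')).le
  have t3 : ‖X z - X y‖ ≤ ∫ r in y..z, A r := by
    rw [hXsub, ← abs_of_nonneg hI0]; exact h.norm_integral_le y z
  rw [intervalIntegral.integral_const_mul] at t2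
  rw [hIsub]
  have e1 := intervalIntegral.integral_interval_sub_left (hint a z) (hint a y)
  calc _ = ‖(f (X z) - f (X y) - fderiv ℝ f (X y) (X z - X y))
      + (fderiv ℝ f (X y) (X z - X y) - ∫ r in y..z, fderiv ℝ f (X r) (V r (X r)))‖ := by
        congr 1; rw [← e1]; ring
    _ ≤ _ := norm_add_le _ _
    _ ≤ ε / 2 * (∫ r in y..z, A r) + ε / 2 * ∫ r in y..z, A r := by
        refine add_le_add (t1.trans ?_) t2
        gcongr
    _ = _ := by ring

end LipField

/-! ### Invariance of the domain under the flow of a tangential field -/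

/-- `w · n = 0` at every boundary point of `Ω`. -/
def IsTangent (Ω : Set Plane) (w : Plane → Plane) : Prop :=
  ∀ x ∈ frontier Ω, ∀ ν, IsOutwardUnitNormal Ω x ν → inner ℝ (w x) ν = 0

lemma gradient_ne_zero_of_fderiv_ne_zero {ρ : Plane → ℝ} {y n : Plane} (h : fderiv ℝ ρ y n ≠ 0) :
    gradient ρ y ≠ 0 := by
  intro h0
  apply h
  rw [← toDual_gradient, h0]
  simp

lemma IsLocalDefiningFunction.fderiv_gradient_pos {Ω : Set Plane} {x : Plane} {ρ : Plane → ℝ}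
    (hρ : IsLocalDefiningFunction Ω x ρ) : 0 < fderiv ℝ ρ x (gradient ρ x) := by
  rw [← toDual_gradient, InnerProductSpace.toDual_apply_apply, real_inner_self_eq_norm_sq]
  have := norm_pos_iff.2 hρ.gradient_ne_zero
  positivity

/-- Near a boundary point with local defining function `ρ`, the zeros of `ρ` are boundary points,
and the derivative of `ρ` along a tangential Lipschitz field `w` is bounded by `|ρ|`. -/
theorem IsLocalDefiningFunction.abs_fderiv_le {Ω : Set Plane} {x : Plane}
    {ρ : Plane → ℝ} (hρ : IsLocalDefiningFunction Ω x ρ) (hx : x ∈ frontier Ω)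
    (hΩ : IsOpen Ω) :
    ∃ R > 0, ∃ K ≥ 0, ρ x = 0 ∧ (∀ y ∈ Metric.ball x R, ρ y = 0 → y ∈ frontier Ω) ∧
      ∀ (w : Plane → Plane) (a : ℝ), (∀ y, ‖w y‖ ≤ a) → (∀ y z, ‖w y - w z‖ ≤ a * ‖y - z‖) →
        IsTangent Ω w → ∀ y ∈ Metric.ball x R, |fderiv ℝ ρ y (w y)| ≤ K * a * |ρ y| := by
  set n := gradient ρ x with hn
  have hsm : ContDiff ℝ 1 ρ := hρ.contDiff.of_le (by simp)
  have hdc : Continuous (fderiv ℝ ρ) := hsm.continuous_fderiv one_ne_zero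
  set c := fderiv ℝ ρ x n / 2 with hc
  have hcpos : 0 < c := half_pos hρ.fderiv_gradient_pos
  have hlip : ContDiffAt ℝ 1 (fderiv ℝ ρ) x :=
    (hρ.contDiff.fderiv_right (m := 1) (by norm_cast)).contDiffAt
  obtain ⟨L, s, hs, hL⟩ := hlip.exists_lipschitzOnWith
  have ev : ∀ᶠ y in 𝓝 x, (y ∈ Ω ↔ ρ y < 0) ∧ y ∈ s ∧ c < fderiv ℝ ρ y n ∧
      ‖fderiv ℝ ρ y‖ < ‖fderiv ℝ ρ x‖ + 1 := by
    refine hρ.mem_iff.and ((Filter.eventually_mem_set.2 hs).and (Filter.Eventually.and ?_ ?_))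
    · exact (hdc.clm_apply continuous_const).continuousAt.eventually_const_lt (half_lt_self hρ.fderiv_gradient_pos)
    · exact hdc.norm.continuousAt.eventually_lt_const (lt_add_one _)
  obtain ⟨R₁, hR₁, H⟩ := Metric.eventually_nhds_iff_ball.1 ev
  have hx0 : ρ x = 0 := by
    apply le_antisymm
    · by_contra! hpos
      have h1 : ∀ᶠ y in 𝓝 x, 0 < ρ y := hsm.continuous.continuousAt.eventually_const_lt hpos
      have h2 := mem_closure_iff_frequently.1 hx.1
      obtain ⟨y, hy, hy1, hy2⟩ := (h2.and_eventually (h1.and hρ.mem_iff)).exists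
      linarith [hy2.1 hy]
    · by_contra! hneg
      exact hx.2 (by rw [hΩ.interior_eq]; exact hρ.mem_iff.self_of_nhds.2 hneg)
  -- `ρ` grows at least linearly in the direction `n`
  have hgrow : ∀ (y : Plane) (τ τ' : ℝ), τ ≤ τ' →
      (∀ σ ∈ Icc τ τ', y + σ • n ∈ Metric.ball x R₁) →
      c * (τ' - τ) ≤ ρ (y + τ' • n) - ρ (y + τ • n) := by
    intro y τ τ' hτ hσ
    have hd : ∀ σ : ℝ, HasDerivAt (fun σ : ℝ => ρ (y + σ • n)) (fderiv ℝ ρ (y + σ • n) n) σ := by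
      intro σ
      have h1 : HasDerivAt (fun σ : ℝ => y + σ • n) n σ := by
        simpa using ((hasDerivAt_id σ).smul_const n).const_add y
      exact ((hsm.differentiable one_ne_zero _).hasFDerivAt).comp_hasDerivAt σ h1
    refine Convex.mul_sub_le_image_sub_of_le_deriv (convex_Icc τ τ')
      (fun σ _ => (hd σ).continuousAt.continuousWithinAt)
      (fun σ _ => (hd σ).differentiableAt.differentiableWithinAt) (fun σ hσ' => ?_)
      τ (left_mem_Icc.2 hτ) τ' (right_mem_Icc.2 hτ) hτ
    rw [(hd σ).deriv]
    exact (H _ (hσ σ (interior_subset hσ'))).2.2.1.le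
  have hfront : ∀ y ∈ Metric.ball x R₁, ρ y = 0 → y ∈ frontier Ω := by
    intro y hy hy0
    refine ⟨?_, ?_⟩
    · rw [mem_closure_iff_frequently]
      have hcont : Filter.Tendsto (fun σ : ℝ => y + (-σ) • n) (𝓝[>] 0) (𝓝 y) := by
        refine tendsto_nhdsWithin_of_tendsto_nhds ?_
        exact Continuous.tendsto' (by fun_prop) _ _ (by simp)
      refine hcont.frequently (Filter.Eventually.frequently ?_)
      obtain ⟨η, hη, Hη⟩ := Metric.eventually_nhds_iff_ball.1
        ((Continuous.tendsto' (f := fun σ : ℝ => y + σ • n) (by fun_prop) 0 y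
          (by simp)).eventually (Metric.isOpen_ball.mem_nhds hy))
      filter_upwards [Ioo_mem_nhdsGT hη] with σ hσ
      have hmem : ∀ σ' ∈ Icc (-σ) 0, y + σ' • n ∈ Metric.ball x R₁ := fun σ' hσ' =>
        Hη σ' (by rw [mem_ball_zero_iff, Real.norm_eq_abs, abs_lt]; constructor <;>
          linarith [hσ.1, hσ.2, hσ'.1, hσ'.2])
      have := hgrow y (-σ) 0 (by linarith [hσ.1]) hmem
      rw [zero_smul, add_zero, hy0] at this
      refine (H _ (hmem (-σ) (left_mem_Icc.2 (by linarith [hσ.1])))).1.2 ?_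
      nlinarith [hσ.1]
    · rw [hΩ.interior_eq]
      intro h
      linarith [(H y hy).1.1 h]
  have ev2 : ∀ᶠ y in 𝓝 x, |ρ y| / c * ‖n‖ < R₁ / 2 := by
    have : Continuous fun y => |ρ y| / c * ‖n‖ := by
      have := hsm.continuous
      fun_prop
    refine this.continuousAt.eventually_lt_const ?_
    simpa [hx0] using hR₁
  obtain ⟨R₂, hR₂, H₂⟩ := Metric.eventually_nhds_iff_ball.1 ev2
  refine ⟨min R₂ (R₁ / 2), lt_min hR₂ (half_pos hR₁),
    (L + (‖fderiv ℝ ρ x‖ + 1)) * (‖n‖ / c), by positivity, hx0, fun y hy => hfront y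
      (Metric.ball_subset_ball ((min_le_right _ _).trans (by linarith)) hy), ?_⟩
  intro w a hwa hwl hwt y hy
  have hyR₂ : y ∈ Metric.ball x R₂ := Metric.ball_subset_ball (min_le_left _ _) hy
  have hyR₁ : dist y x < R₁ / 2 := Metric.ball_subset_ball (min_le_right _ _) hy
  set τ₁ := |ρ y| / c with hτ₁
  have hτ₁0 : 0 ≤ τ₁ := by positivity
  have hball : ∀ σ ∈ Icc (-τ₁) τ₁, y + σ • n ∈ Metric.ball x R₁ := by
    intro σ hσ
    have h1 : |σ| ≤ τ₁ := abs_le.2 hσ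
    rw [Metric.mem_ball]
    calc dist (y + σ • n) x ≤ dist (y + σ • n) y + dist y x := dist_triangle _ _ _
      _ ≤ τ₁ * ‖n‖ + dist y x := by
          gcongr; rw [dist_eq_norm, add_sub_cancel_left, norm_smul, Real.norm_eq_abs]; gcongr
      _ < R₁ := by linarith [H₂ y hyR₂]
  have hcτ : c * τ₁ = |ρ y| := by rw [hτ₁]; field_simp
  obtain ⟨τ, hτ, hτ0⟩ : ∃ τ ∈ Icc (-τ₁) τ₁, ρ (y + τ • n) = 0 := by
    have g1 := hgrow y 0 τ₁ hτ₁0 fun σ hσ => hball σ ⟨by linarith [hσ.1], hσ.2⟩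
    have g2 := hgrow y (-τ₁) 0 (by linarith) fun σ hσ => hball σ ⟨hσ.1, by linarith [hσ.2]⟩
    simp only [zero_smul, add_zero] at g1 g2
    have hcont : ContinuousOn (fun τ : ℝ => ρ (y + τ • n)) (Icc (-τ₁) τ₁) := by
      have := hsm.continuous
      fun_prop
    refine intermediate_value_Icc (by linarith) hcont ⟨?_, ?_⟩
    · have := le_abs_self (ρ y); linarith
    · have := neg_abs_le (ρ y); linarith
  set p := y + τ • n with hp
  have hpb := hball τ hτ
  have hyb : y ∈ Metric.ball x R₁ := by rw [Metric.mem_ball]; linarith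
  have hyp : ‖y - p‖ ≤ ‖n‖ / c * |ρ y| := by
    rw [hp, sub_add_cancel_left, norm_neg, norm_smul, Real.norm_eq_abs]
    calc |τ| * ‖n‖ ≤ τ₁ * ‖n‖ := by gcongr; exact abs_le.2 hτ
      _ = _ := by rw [hτ₁]; ring
  have hzero : fderiv ℝ ρ p (w p) = 0 := by
    have hg : gradient ρ p ≠ 0 :=
      gradient_ne_zero_of_fderiv_ne_zero (n := n) (hcpos.trans (H p hpb).2.2.1).ne'
    have hdef : IsLocalDefiningFunction Ω p ρ := ⟨hρ.contDiff, hg, by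
      filter_upwards [Metric.isOpen_ball.mem_nhds hpb] with z hz using (H z hz).1⟩
    have := hwt p (hfront p hpb hτ0) _ ⟨ρ, hdef, rfl⟩
    rw [inner_smul_right, mul_eq_zero, inv_eq_zero, norm_eq_zero] at this
    rw [← toDual_gradient, InnerProductSpace.toDual_apply_apply, real_inner_comm]
    exact this.resolve_left hg
  have ha : 0 ≤ a := (norm_nonneg _).trans (hwa 0)
  have hdec : fderiv ℝ ρ y (w y)
      = (fderiv ℝ ρ y - fderiv ℝ ρ p) (w y) + fderiv ℝ ρ p (w y - w p) := by
    rw [map_sub, hzero, sub_apply]; ring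
  rw [hdec, ← Real.norm_eq_abs]
  have hLp : ‖fderiv ℝ ρ y - fderiv ℝ ρ p‖ ≤ L * ‖y - p‖ := by
    rw [← dist_eq_norm, ← dist_eq_norm]
    exact hL.dist_le_mul y (H y hyb).2.1 p (H p hpb).2.1
  calc _ ≤ ‖(fderiv ℝ ρ y - fderiv ℝ ρ p) (w y)‖ + ‖fderiv ℝ ρ p (w y - w p)‖ := norm_add_le _ _
    _ ≤ L * ‖y - p‖ * a + (‖fderiv ℝ ρ x‖ + 1) * (a * ‖y - p‖) := by
        refine add_le_add ((ContinuousLinearMap.le_opNorm _ _).trans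
          (mul_le_mul hLp (hwa y) (norm_nonneg _) (by positivity)))
          ((ContinuousLinearMap.le_opNorm _ _).trans
          (mul_le_mul (H p hpb).2.2.2.le (hwl y p) (norm_nonneg _) (by positivity)))
    _ = (L + (‖fderiv ℝ ρ x‖ + 1)) * a * ‖y - p‖ := by ring
    _ ≤ (L + (‖fderiv ℝ ρ x‖ + 1)) * a * (‖n‖ / c * |ρ y|) := by gcongr
    _ = _ := by ring

namespace LipField

variable {V : ℝ → Plane → Plane} {A : ℝ → ℝ} {Ω : Set Plane}

/-- The flow of a tangential field preserves `Ω`: by Grönwall's inequality for a local defining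
function, the times at which a particle is on the boundary form an open and closed set. -/
theorem flow_mem (h : LipField V A) (hΩ : IsSmoothBoundedDomain Ω) (ht : ∀ t, IsTangent Ω (V t))
    (t s : ℝ) {x : Plane} (hx : x ∈ Ω) : h.flow t s x ∈ Ω := by
  set X := fun t => h.flow t s x with hX
  have hXc : Continuous X := h.continuous_flow s x
  have hXs : X s = x := h.flow_self s x
  have hclosed : IsClosed (X ⁻¹' frontier Ω) := isClosed_frontier.preimage hXc
  have hopen : IsOpen (X ⁻¹' frontier Ω) := by
    rw [Metric.isOpen_iff]
    intro t₁ ht₁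
    obtain ⟨ρ, hρ⟩ := hΩ.exists_definingFunction _ ht₁
    obtain ⟨R, hR, K, hK, h0, hfr, hder⟩ := hρ.abs_fderiv_le ht₁ hΩ.isOpen
    obtain ⟨η, hη, Hη⟩ := Metric.eventually_nhds_iff_ball.1
      (hXc.continuousAt.eventually (Metric.isOpen_ball.mem_nhds (Metric.mem_ball_self hR)))
    refine ⟨η, hη, fun t ht' => hfr _ (Hη t ht') ?_⟩
    have hsm : ContDiff ℝ 1 ρ := hρ.contDiff.of_le (by simp)
    have hsub : ∀ r ∈ uIcc t₁ t, X r ∈ Metric.ball (X t₁) R := fun r hr => Hη r (by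
      have : |r - t₁| ≤ |t - t₁| := abs_sub_left_of_mem_uIcc hr
      rw [Metric.mem_ball, Real.dist_eq] at ht' ⊢
      linarith)
    have hcont : Continuous fun r => |ρ (X r)| := (hsm.continuous.comp hXc).abs
    have := le_mul_exp_of_le_add_abs_integral (A := fun r => K * A r) (f := fun r => |ρ (X r)|)
      (c := 0) (s := t₁) (t := t) (fun r => mul_nonneg hK (h.nonneg r))
      (fun a b => (h.integrable a b).const_mul K) hcont.continuousOn (fun _ _ => abs_nonneg _) ?_
    · rw [zero_mul] at this
      exact abs_nonpos_iff.1 this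
    · intro r hr
      have e := h.comp_flow_sub hsm s t₁ r x
      change ρ (X r) - ρ (X t₁) = _ at e
      rw [h0, sub_zero] at e
      rw [zero_add, e]
      refine norm_integral_le_abs_integral (E := ℝ)
        (((h.integrable t₁ r).const_mul K).mul_continuousOn hcont.continuousOn) fun τ hτ => ?_
      exact hder (V τ) (A τ) (h.norm_le τ) (h.lipschitz τ) (ht τ) _
        (hsub τ (uIcc_subset_uIcc_left hr hτ))
  have hempty : X ⁻¹' frontier Ω = ∅ := by
    rcases isClopen_iff.1 ⟨hclosed, hopen⟩ with h1 | h1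
    · exact h1
    · have : X s ∈ frontier Ω := by
        have : s ∈ X ⁻¹' frontier Ω := h1 ▸ mem_univ s
        exact this
      rw [hXs, hΩ.isOpen.frontier_eq] at this
      exact absurd hx this.2
  have heq : X ⁻¹' Ω = X ⁻¹' closure Ω := by
    rw [closure_eq_self_union_frontier, preimage_union, hempty, union_empty]
  have hclopen : IsClopen (X ⁻¹' Ω) :=
    ⟨heq ▸ isClosed_closure.preimage hXc, hΩ.isOpen.preimage hXc⟩
  have huniv : X ⁻¹' Ω = univ := by
    rcases isClopen_iff.1 hclopen with h1 | h1
    · have : s ∈ X ⁻¹' Ω := by rw [mem_preimage, hXs]; exact hx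
      rw [h1] at this
      exact absurd this (notMem_empty s)
    · exact h1
  have : t ∈ X ⁻¹' Ω := huniv ▸ mem_univ t
  exact this

end LipField

/-! ### First-order weak derivatives and Sobolev spaces -/

section WeakPartial

variable {F : Type*} [NormedAddCommGroup F] [NormedSpace ℝ F] {Ω : Set Plane}

/-- `g` is the weak partial derivative `∂ᵢ f` in `Ω`. -/
def HasWeakPartial (Ω : Set Plane) (i : Fin 2) (f g : Plane → F) : Prop :=
  ∀ φ : Plane → ℝ, IsTestFunction Ω φ →
    ∫ x in Ω, partialDeriv i φ x • f x = -∫ x in Ω, φ x • g x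

lemma IsTestFunction.partialDeriv {φ : Plane → ℝ} (hφ : IsTestFunction Ω φ) (i : Fin 2) :
    IsTestFunction Ω (partialDeriv i φ) :=
  ⟨contDiff_partialDeriv hφ.contDiff i, hasCompactSupport_partialDeriv hφ.hasCompactSupport i,
    (tsupport_fderiv_apply_subset ℝ _).trans hφ.tsupport_subset⟩

lemma hasWeakDeriv_unit_iff {k : ℕ} {i : Fin 2} {f g : Plane → F} :
    HasWeakDeriv Ω (fun j => ((MultiIndex.unit (k := k) i).1 j : ℕ)) f g ↔
      HasWeakPartial Ω i f g := by
  unfold HasWeakDeriv HasWeakPartial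
  refine forall₂_congr fun φ hφ => ?_
  fin_cases i <;> simp [MultiIndex.unit, multiDeriv]

lemma partialDeriv_comm {φ : Plane → ℝ} (hφ : ContDiff ℝ ∞ φ) (i j : Fin 2) :
    partialDeriv i (partialDeriv j φ) = partialDeriv j (partialDeriv i φ) := by
  have hd : Differentiable ℝ (fderiv ℝ φ) :=
    (hφ.fderiv_right (m := 1) (by norm_cast)).differentiable one_ne_zero
  have h2 : ∀ (a b : Fin 2) (x : Plane), partialDeriv a (partialDeriv b φ) x
      = fderiv ℝ (fderiv ℝ φ) x (EuclideanSpace.single a 1) (EuclideanSpace.single b 1) := by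
    intro a b x
    unfold partialDeriv
    rw [fderiv_clm_apply (hd x) (differentiableAt_const _)]
    simp
  funext x
  rw [h2, h2]
  have := (hφ.contDiffAt (x := x)).isSymmSndFDerivAt (by simp; norm_cast)
  exact this _ _

namespace Sobolev

variable {k : ℕ} {p : ℝ≥0∞} [Fact (1 ≤ p)]

lemma hasWeakPartial (f : Sobolev Ω F (k + 1) p) (i : Fin 2) :
    HasWeakPartial Ω i (toLp f) (weakPartial i f) :=
  hasWeakDeriv_unit_iff.1 (f.2 (MultiIndex.unit i))

lemma norm_toLp_le (f : Sobolev Ω F k p) : ‖toLp f‖ ≤ ‖f‖ :=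
  PiLp.norm_apply_le f.1 _

lemma norm_weakPartial_le (f : Sobolev Ω F (k + 1) p) (i : Fin 2) : ‖weakPartial i f‖ ≤ ‖f‖ :=
  PiLp.norm_apply_le f.1 _

/-- The weak second derivatives. -/
lemma exists_hasWeakPartial_weakPartial (f : Sobolev Ω F 2 p) (i j : Fin 2) :
    ∃ g : Lp F p (volume.restrict Ω), HasWeakPartial Ω j (weakPartial i f) g ∧ ‖g‖ ≤ ‖f‖ := by
  let α : MultiIndex 2 := ⟨fun l => (if l = i then 1 else 0) + (if l = j then 1 else 0), by
    fin_cases i <;> fin_cases j <;> decide⟩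
  refine ⟨f.1 α, fun φ hφ => ?_, PiLp.norm_apply_le f.1 _⟩
  have h1 := f.hasWeakPartial i _ (hφ.partialDeriv j)
  have h2 := f.2 α φ hφ
  have h3 : multiDeriv (fun l => (α.1 l : ℕ)) φ = partialDeriv i (partialDeriv j φ) := by
    fin_cases i <;> fin_cases j <;>
      first
      | rfl
      | exact partialDeriv_comm hφ.contDiff _ _
  have h4 : ∑ l, (α.1 l : ℕ) = 2 := by fin_cases i <;> fin_cases j <;> rfl
  rw [h3, h4] at h2
  change ∫ x in Ω, _ • (toLp f) x = _ at h2
  rw [h1] at h2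
  rw [← neg_eq_iff_eq_neg, h2]
  simp

lemma multiIndex_one_cases (α : MultiIndex 1) : α = MultiIndex.zero 1 ∨ ∃ i, α = MultiIndex.unit i := by
  revert α
  decide

/-- The element of `W^{1,p}(Ω; F)` given by a function and its weak partial derivatives. -/
def ofWeakPartial (f : Lp F p (volume.restrict Ω)) (g : Fin 2 → Lp F p (volume.restrict Ω))
    (h : ∀ i, HasWeakPartial Ω i f (g i)) : Sobolev Ω F 1 p :=
  ⟨WithLp.toLp p fun α => if α = MultiIndex.zero 1 then f else
      if α = MultiIndex.unit 0 then g 0 else g 1, by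
    intro α
    rcases multiIndex_one_cases α with rfl | ⟨i, rfl⟩
    · intro φ _
      simp [MultiIndex.zero, multiDeriv]
    · rw [hasWeakDeriv_unit_iff]
      fin_cases i
      · exact h 0
      · exact h 1⟩

@[simp]
lemma weakPartial_ofWeakPartial (f : Lp F p (volume.restrict Ω))
    (g : Fin 2 → Lp F p (volume.restrict Ω)) (h : ∀ i, HasWeakPartial Ω i f (g i)) (i : Fin 2) :
    weakPartial i (ofWeakPartial f g h) = g i := by
  fin_cases i <;> rfl

/-- `toLp` as a continuous linear map. -/
def toLpCLM (Ω : Set Plane) (F : Type*) [NormedAddCommGroup F] [NormedSpace ℝ F] (k : ℕ)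
    (p : ℝ≥0∞) [Fact (1 ≤ p)] : Sobolev Ω F k p →L[ℝ] Lp F p (volume.restrict Ω) :=
  LinearMap.mkContinuous ⟨⟨toLp, fun _ _ => rfl⟩, fun _ _ => rfl⟩ 1
    fun f => by rw [one_mul]; exact norm_toLp_le f

@[simp]
lemma toLpCLM_apply (f : Sobolev Ω F k p) : toLpCLM Ω F k p f = toLp f := rfl

/-- `∂ᵢ` as a continuous linear map. -/
def weakPartialCLM (Ω : Set Plane) (F : Type*) [NormedAddCommGroup F] [NormedSpace ℝ F] (k : ℕ)
    (p : ℝ≥0∞) [Fact (1 ≤ p)] (i : Fin 2) :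
    Sobolev Ω F (k + 1) p →L[ℝ] Lp F p (volume.restrict Ω) :=
  LinearMap.mkContinuous ⟨⟨weakPartial i, fun _ _ => rfl⟩, fun _ _ => rfl⟩ 1
    fun f => by rw [one_mul]; exact norm_weakPartial_le f i

/-- Weak derivatives are unique. -/
lemma toLp_injective [CompleteSpace F] (hΩ : IsOpen Ω) :
    Function.Injective (toLp : Sobolev Ω F k p → Lp F p (volume.restrict Ω)) := by
  intro f g hfg
  have hz : toLp (f - g) = 0 := by
    have : toLp (f - g) = toLp f - toLp g := rfl
    rw [this, hfg, sub_self]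
  rw [← sub_eq_zero]
  refine Subtype.ext (PiLp.ext fun α => ?_)
  change (f - g).1 α = 0
  rw [Lp.eq_zero_iff_ae_eq_zero]
  have hloc : LocallyIntegrable ((f - g).1 α) (volume.restrict Ω) :=
    (Lp.memLp _).locallyIntegrable Fact.out
  rw [Filter.EventuallyEq, ae_restrict_iff' hΩ.measurableSet]
  refine hΩ.ae_eq_zero_of_integral_contDiff_smul_eq_zero ?_ fun φ hφ hc hs => ?_
  · intro x hx
    obtain ⟨U, hU, hU'⟩ := hloc x
    refine ⟨U ∩ Ω, ?_, ?_⟩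
    · exact Filter.inter_mem (nhdsWithin_le_nhds hU) self_mem_nhdsWithin
    · rw [IntegrableOn, ← Measure.restrict_restrict₀' hΩ.measurableSet.nullMeasurableSet]
      exact hU'
  · have h2 := (f - g).2 α φ ⟨hφ, hc, hs⟩
    change ∫ x in Ω, _ • (toLp (f - g)) x = _ at h2
    have h3 : ∫ x in Ω, multiDeriv (fun i => (α.1 i : ℕ)) φ x • (toLp (f - g)) x = 0 := by
      rw [← integral_zero Plane F (μ := volume.restrict Ω)]
      refine integral_congr_ae ?_
      rw [hz]
      filter_upwards [Lp.coeFn_zero F p (volume.restrict Ω)] with x hx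
      rw [hx, Pi.zero_apply, smul_zero]
    rw [h3, eq_comm, smul_eq_zero] at h2
    have h4 : ∫ x in Ω, φ x • (f - g).1 α x = 0 := h2.resolve_left (pow_ne_zero _ (by norm_num))
    rw [← h4]
    refine (setIntegral_eq_integral_of_forall_compl_eq_zero fun x hx => ?_).symm
    rw [image_eq_zero_of_notMem_tsupport (fun h => hx (hs h)), zero_smul]

/-- Integration of an `L^p` function against a continuous function with compact support. -/
lemma continuous_integral_smul [CompleteSpace F] {ψ : Plane → ℝ} (hc : Continuous ψ) (hs : HasCompactSupport ψ) :
    Continuous fun f : Lp F p (volume.restrict Ω) => ∫ x in Ω, ψ x • f x := by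
  have hψ : MemLp ψ (ENNReal.conjExponent p) (volume.restrict Ω) :=
    hc.memLp_of_hasCompactSupport hs
  have : ENNReal.HolderConjugate (ENNReal.conjExponent p) p := .symm
  have : Fact (1 ≤ ENNReal.conjExponent p) := ⟨self_le_add_right 1 _⟩
  refine ((ContinuousLinearMap.lsmul ℝ ℝ : ℝ →L[ℝ] F →L[ℝ] F).lpPairing (volume.restrict Ω)
    (ENNReal.conjExponent p) p hψ.toLp).continuous.congr fun f => ?_
  rw [ContinuousLinearMap.lpPairing_eq_integral]
  refine integral_congr_ae ?_
  filter_upwards [hψ.coeFn_toLp] with x hx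
  rw [hx, ContinuousLinearMap.lsmul_apply]

instance [CompleteSpace F] : CompleteSpace (Sobolev Ω F k p) := by
  refine IsClosed.completeSpace_coe (hs := ?_)
  have : ((sobolevSubmodule Ω F k p : Submodule ℝ _) : Set (PiLp p fun _ : MultiIndex k =>
      Lp F p (volume.restrict Ω))) = ⋂ (α : MultiIndex k) (φ : Plane → ℝ) (_ : IsTestFunction Ω φ),
      {f | ∫ x in Ω, multiDeriv (fun i => (α.1 i : ℕ)) φ x • f (MultiIndex.zero k) x
        = (-1 : ℝ) ^ (∑ i, (α.1 i : ℕ)) • ∫ x in Ω, φ x • f α x} := by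
    ext f
    simp only [mem_iInter]
    rfl
  rw [this]
  refine isClosed_iInter fun α => isClosed_iInter fun φ => isClosed_iInter fun hφ => ?_
  have hd := smooth_multiDeriv hφ.contDiff hφ.hasCompactSupport (fun i => (α.1 i : ℕ))
  exact isClosed_eq
    ((continuous_integral_smul hd.1.continuous hd.2).comp (PiLp.continuous_apply p _ _))
    (((continuous_integral_smul hφ.contDiff.continuous hφ.hasCompactSupport).comp
      (PiLp.continuous_apply p _ _)).const_smul _)

end Sobolev

end WeakPartial

/-! ### Mollification -/

section Mollify

open scoped Convolution

variable {F : Type*} [NormedAddCommGroup F] [NormedSpace ℝ F]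

/-- Bump functions supported in the ball of radius `1 / (n + 1)`. -/
def bump (n : ℕ) : ContDiffBump (0 : Plane) where
  rIn := 1 / (n + 1) / 2
  rOut := 1 / (n + 1)
  rIn_pos := by positivity
  rIn_lt_rOut := half_lt_self (by positivity)

lemma tendsto_bump_rOut : Filter.Tendsto (fun n => (bump n).rOut) Filter.atTop (𝓝 0) :=
  tendsto_one_div_add_atTop_nhds_zero_nat

/-- The mollification of `f` at scale `1 / (n + 1)`. -/
def mollify (n : ℕ) (f : Plane → F) : Plane → F :=
  (bump n).normed volume ⋆[ContinuousLinearMap.lsmul ℝ ℝ, volume] f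

/-- The probability measure with density the `n`-th bump function. -/
def bumpMeasure (n : ℕ) : Measure Plane :=
  volume.withDensity fun t => ENNReal.ofReal ((bump n).normed volume t)

instance (n : ℕ) : IsProbabilityMeasure (bumpMeasure n) := by
  constructor
  rw [bumpMeasure, withDensity_apply _ MeasurableSet.univ, Measure.restrict_univ,
    ← ofReal_integral_eq_lintegral_ofReal (bump n).integrable_normed
      (ae_of_all _ fun x => (bump n).nonneg_normed x), (bump n).integral_normed, ENNReal.ofReal_one]

lemma lintegral_bumpMeasure (n : ℕ) {g : Plane → ℝ≥0∞} (hg : Measurable g) :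
    ∫⁻ t, g t ∂bumpMeasure n = ∫⁻ t, ENNReal.ofReal ((bump n).normed volume t) * g t := by
  rw [bumpMeasure, lintegral_withDensity_eq_lintegral_mul _ _ hg]
  · rfl
  · exact (bump n).continuous_normed.measurable.ennreal_ofReal

lemma mollify_apply (n : ℕ) (f : Plane → F) (x : Plane) :
    mollify n f x = ∫ t, (bump n).normed volume t • f (x - t) := rfl

lemma mollify_apply_swap (n : ℕ) (f : Plane → F) (x : Plane) :
    mollify n f x = ∫ y, (bump n).normed volume (x - y) • f y := by
  rw [mollify, convolution_eq_swap]; rfl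

lemma enorm_mollify_le (n : ℕ) {f : Plane → F} (hf : StronglyMeasurable f) (x : Plane) :
    ‖mollify n f x‖ₑ ≤ ∫⁻ t, ‖f (x - t)‖ₑ ∂bumpMeasure n := by
  rw [lintegral_bumpMeasure]
  · refine (enorm_integral_le_lintegral_enorm _).trans (lintegral_mono fun t => ?_)
    rw [ContinuousLinearMap.lsmul_apply, enorm_smul, Real.enorm_of_nonneg ((bump n).nonneg_normed t)]
  · exact (hf.comp_measurable (measurable_const.sub measurable_id)).enorm

lemma contDiff_mollify [CompleteSpace F] (n : ℕ) {f : Plane → F} (hf : LocallyIntegrable f) :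
    ContDiff ℝ ∞ (mollify n f) :=
  (bump n).hasCompactSupport_normed.contDiff_convolution_left _ (bump n).contDiff_normed hf

lemma hasCompactSupport_mollify (n : ℕ) {f : Plane → F} (hf : HasCompactSupport f) :
    HasCompactSupport (mollify n f) :=
  HasCompactSupport.convolution _ (bump n).hasCompactSupport_normed hf

/-- Young's inequality for mollification, from Jensen's inequality and Tonelli's theorem. -/
theorem eLpNorm_mollify_le (n : ℕ) {f : Plane → F} (hf : StronglyMeasurable f) {p : ℝ≥0∞}
    (hp : 1 ≤ p) (hp' : p ≠ ⊤) : eLpNorm (mollify n f) p volume ≤ eLpNorm f p volume := by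
  have hp0 : p ≠ 0 := (zero_lt_one.trans_le hp).ne'
  have hr : 1 ≤ p.toReal := by
    rw [← ENNReal.toReal_one]; exact ENNReal.toReal_mono hp' hp
  rw [eLpNorm_eq_lintegral_rpow_enorm_toReal hp0 hp', eLpNorm_eq_lintegral_rpow_enorm_toReal hp0 hp']
  refine ENNReal.rpow_le_rpow ?_ (by positivity)
  have hm : Measurable fun q : Plane × Plane => ‖f (q.1 - q.2)‖ₑ ^ p.toReal :=
    ((hf.comp_measurable (measurable_fst.sub measurable_snd)).enorm).pow_const _
  calc ∫⁻ x, ‖mollify n f x‖ₑ ^ p.toReal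
      ≤ ∫⁻ x, ∫⁻ t, ‖f (x - t)‖ₑ ^ p.toReal ∂bumpMeasure n := by
        refine lintegral_mono fun x => ?_
        have h1 := eLpNorm'_le_eLpNorm'_of_exponent_le one_pos hr (bumpMeasure n)
          (f := fun t => f (x - t))
          (hf.comp_measurable (measurable_const.sub measurable_id)).aestronglyMeasurable
        simp only [eLpNorm', ENNReal.rpow_one, div_one] at h1
        have h2 := ENNReal.rpow_le_rpow ((enorm_mollify_le n hf x).trans h1)
          (by positivity : 0 ≤ p.toReal)
        rwa [← ENNReal.rpow_mul, one_div_mul_cancel (by positivity), ENNReal.rpow_one] at h2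
    _ = ∫⁻ t, (∫⁻ x, ‖f (x - t)‖ₑ ^ p.toReal) ∂bumpMeasure n :=
        lintegral_lintegral_swap hm.aemeasurable
    _ = ∫⁻ _, (∫⁻ x, ‖f x‖ₑ ^ p.toReal) ∂bumpMeasure n := by
        refine lintegral_congr fun t => ?_
        exact lintegral_sub_right_eq_self (fun x => ‖f x‖ₑ ^ p.toReal) t
    _ = ∫⁻ x, ‖f x‖ₑ ^ p.toReal := by simp

lemma mollify_sub [CompleteSpace F] (n : ℕ) {f g : Plane → F} (hf : LocallyIntegrable f) (hg : LocallyIntegrable g) :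
    mollify n (f - g) = mollify n f - mollify n g := by
  have key : ∀ {f : Plane → F}, LocallyIntegrable f → ConvolutionExists ((bump n).normed volume) f
      (ContinuousLinearMap.lsmul ℝ ℝ) volume := fun hf =>
    (bump n).hasCompactSupport_normed.convolutionExists_left _ (bump n).continuous_normed hf
  funext x
  simp only [mollify_apply, Pi.sub_apply, smul_sub]
  exact integral_sub (key hf x) (key hg x)

/-- Mollifications converge in `L^p`. -/
theorem tendsto_eLpNorm_mollify_sub [CompleteSpace F] {f : Plane → F} (hf : StronglyMeasurable f) {p : ℝ≥0∞}
    (hp : 1 ≤ p) (hp' : p ≠ ⊤) (hfp : MemLp f p volume) :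
    Filter.Tendsto (fun n => eLpNorm (mollify n f - f) p volume) Filter.atTop (𝓝 0) := by
  rw [ENNReal.tendsto_nhds_zero]
  intro ε hε
  rcases eq_or_ne ε ⊤ with rfl | hε'
  · simp
  obtain ⟨g, hgs, hfg, hgc, hgp⟩ := hfp.exists_hasCompactSupport_eLpNorm_sub_le hp'
    (ENNReal.div_ne_zero.2 ⟨hε.ne', by norm_num⟩ : ε / 3 ≠ 0)
  set K := Metric.cthickening 1 (tsupport g) with hK
  have hKc : IsCompact K := hgs.isCompact.cthickening
  obtain ⟨η, hη, hη'⟩ : ∃ η : ℝ, 0 < η ∧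
      volume K ^ p.toReal⁻¹ * ENNReal.ofReal η ≤ ε / 3 := by
    have hv : volume K ^ p.toReal⁻¹ ≠ ⊤ :=
      ENNReal.rpow_ne_top_of_nonneg (by positivity) hKc.measure_lt_top.ne
    have hε3 : ε / 3 ≠ 0 := ENNReal.div_ne_zero.2 ⟨hε.ne', by norm_num⟩
    have hlim : Filter.Tendsto (fun η : ℝ => volume K ^ p.toReal⁻¹ * ENNReal.ofReal η) (𝓝[>] 0)
        (𝓝 0) := by
      have : Filter.Tendsto (fun η : ℝ => ENNReal.ofReal η) (𝓝[>] 0) (𝓝 0) := by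
        refine tendsto_nhdsWithin_of_tendsto_nhds ?_
        exact ENNReal.continuous_ofReal.tendsto' _ _ (by simp)
      simpa using ENNReal.Tendsto.const_mul this (Or.inr hv)
    obtain ⟨η, h1, h2⟩ := ((hlim.eventually_le_const (pos_iff_ne_zero.2 hε3)).and
      self_mem_nhdsWithin).exists
    exact ⟨η, h2, h1⟩
  obtain ⟨δ, hδ, Hδ⟩ := Metric.uniformContinuous_iff.1
    (hgs.uniformContinuous_of_continuous hgc) η hη
  filter_upwards [tendsto_bump_rOut.eventually_lt_const hδ] with n hn
  have hgm : StronglyMeasurable g := hgc.stronglyMeasurable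
  have hgd : eLpNorm (mollify n g - g) p volume ≤ ε / 3 := by
    have hzero : ∀ x ∉ K, mollify n g x - g x = 0 := by
      intro x hx
      have h1 : g x = 0 := image_eq_zero_of_notMem_tsupport fun h =>
        hx (Metric.self_subset_cthickening _ h)
      rw [h1, sub_zero, mollify_apply]
      rw [← integral_zero Plane F (μ := volume)]
      congr 1
      funext t
      by_cases ht : t ∈ Metric.ball 0 (bump n).rOut
      · have : g (x - t) = 0 := image_eq_zero_of_notMem_tsupport fun h => hx (by
          refine Metric.mem_cthickening_of_dist_le _ _ _ _ h ?_
          rw [dist_eq_norm, sub_sub_cancel]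
          rw [mem_ball_zero_iff] at ht
          refine ht.le.trans ?_
          change 1 / ((n : ℝ) + 1) ≤ 1
          rw [div_le_one (by positivity)]
          linarith [(Nat.cast_nonneg n : (0 : ℝ) ≤ n)])
        rw [this, smul_zero]
      · rw [← (bump n).support_normed_eq (μ := volume), Function.notMem_support] at ht
        rw [ht, zero_smul]
    have hsm : ∀ x, ‖mollify n g x - g x‖ ≤ η := fun x => by
      rw [← dist_eq_norm]
      refine (bump n).dist_normed_convolution_le hgc.aestronglyMeasurable fun y hy => ?_
      exact (Hδ (lt_trans hy hn)).le
    have : mollify n g - g = K.indicator (mollify n g - g) := by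
      funext x
      by_cases hx : x ∈ K
      · rw [indicator_of_mem hx]
      · rw [indicator_of_notMem hx]; exact hzero x hx
    rw [this, eLpNorm_indicator_eq_eLpNorm_restrict hKc.measurableSet]
    refine (eLpNorm_le_of_ae_bound (ae_of_all _ hsm)).trans ?_
    rwa [Measure.restrict_apply_univ]
  have hfl := hfp.locallyIntegrable hp
  have hgl := hgp.locallyIntegrable hp
  have e : mollify n f - f = (mollify n (f - g) + (mollify n g - g)) - (f - g) := by
    rw [mollify_sub n hfl hgl]; abel
  have hcm : ∀ {h : Plane → F}, LocallyIntegrable h → AEStronglyMeasurable (mollify n h) volume :=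
    fun hh => (contDiff_mollify n hh).continuous.aestronglyMeasurable
  rw [e]
  calc _ ≤ eLpNorm (mollify n (f - g) + (mollify n g - g)) p volume + eLpNorm (f - g) p volume :=
        eLpNorm_sub_le ((hcm (hfl.sub hgl)).add ((hcm hgl).sub hgm.aestronglyMeasurable))
          (hf.sub hgm).aestronglyMeasurable hp
    _ ≤ (eLpNorm (mollify n (f - g)) p volume + eLpNorm (mollify n g - g) p volume)
        + eLpNorm (f - g) p volume := by
        gcongr
        exact eLpNorm_add_le (hcm (hfl.sub hgl)) ((hcm hgl).sub hgm.aestronglyMeasurable) hp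
    _ ≤ (ε / 3 + ε / 3) + ε / 3 := by
        gcongr
        exact (eLpNorm_mollify_le n (hf.sub hgm) hp hp').trans hfg
    _ = ε := ENNReal.add_thirds ε

/-- In the points of `Ω` at distance more than `1 / (n + 1)` from the boundary, the derivative of
the mollification is the mollification of the weak derivative. -/
theorem partialDeriv_mollify [CompleteSpace F] {Ω : Set Plane} (hΩ : IsOpen Ω) {i : Fin 2} {f g : Plane → F}
    (hfg : HasWeakPartial Ω i f g) (hf : LocallyIntegrable (Ω.indicator f)) (n : ℕ) {x : Plane}
    (hx : Metric.closedBall x (bump n).rOut ⊆ Ω) :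
    fderiv ℝ (mollify n (Ω.indicator f)) x (EuclideanSpace.single i 1)
      = mollify n (Ω.indicator g) x := by
  set η := (bump n).normed volume with hη
  have hηs : ContDiff ℝ ∞ η := (bump n).contDiff_normed
  have hηc : HasCompactSupport η := (bump n).hasCompactSupport_normed
  have hder := hηc.hasFDerivAt_convolution_left (ContinuousLinearMap.lsmul ℝ ℝ : ℝ →L[ℝ] F →L[ℝ] F)
    (hηs.of_le (by simp)) hf x
  have hder' : fderiv ℝ (mollify n (Ω.indicator f)) x = _ := hder.fderiv
  have hex : ConvolutionExistsAt (fderiv ℝ η) (Ω.indicator f) x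
      ((ContinuousLinearMap.lsmul ℝ ℝ : ℝ →L[ℝ] F →L[ℝ] F).precompL Plane) volume :=
    (hηc.fderiv ℝ).convolutionExists_left _ (hηs.continuous_fderiv (by simp)) hf x
  set φ : Plane → ℝ := fun y => η (x - y) with hφ
  have hφt : IsTestFunction Ω φ := by
    refine ⟨hηs.comp (contDiff_const.sub contDiff_id), ?_, ?_⟩
    · exact hηc.comp_homeomorph (Homeomorph.subLeft x)
    · refine closure_minimal (fun y hy => ?_) Metric.isClosed_closedBall |>.trans hx
      have : x - y ∈ Function.support η := hy
      rw [(bump n).support_normed_eq, mem_ball_zero_iff, ← dist_eq_norm, dist_comm] at this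
      exact this.le
  have hpd : ∀ y, partialDeriv i φ y = -fderiv ℝ η (x - y) (EuclideanSpace.single i 1) := by
    intro y
    have h1 : HasFDerivAt φ ((fderiv ℝ η (x - y)).comp (-ContinuousLinearMap.id ℝ Plane)) y := by
      have h2 : HasFDerivAt (fun y : Plane => x - y) (-ContinuousLinearMap.id ℝ Plane) y :=
        (hasFDerivAt_id y).const_sub x
      exact ((hηs.differentiable (by simp)) (x - y)).hasFDerivAt.comp y h2
    rw [partialDeriv, h1.fderiv]
    simp
  rw [hder', convolution, ContinuousLinearMap.integral_apply hex]
  have e1 : ∫ t, (((ContinuousLinearMap.lsmul ℝ ℝ : ℝ →L[ℝ] F →L[ℝ] F).precompL Plane)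
      (fderiv ℝ η t) (Ω.indicator f (x - t))) (EuclideanSpace.single i 1)
      = ∫ y, -(partialDeriv i φ y • Ω.indicator f y) := by
    rw [← integral_sub_left_eq_self _ volume x]
    refine integral_congr_ae (ae_of_all _ fun y => ?_)
    simp [hpd]
  have e2 : ∀ (ψ : Plane → ℝ) (w : Plane → F),
      ∫ y, ψ y • Ω.indicator w y = ∫ y in Ω, ψ y • w y := fun ψ w => by
    rw [← integral_indicator hΩ.measurableSet]
    congr 1
    funext y
    by_cases hy : y ∈ Ω <;> simp [hy]
  rw [e1, integral_neg, e2, hfg φ hφt, neg_neg, mollify_apply_swap, e2]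

/-- `H¹` functions are approximated by smooth functions, with convergence of the gradients on the
compact subsets of `Ω`. -/
theorem exists_smooth_approx {Ω : Set Plane} (hΩ : IsOpen Ω) (hb : Bornology.IsBounded Ω)
    {f : Lp ℝ 2 (volume.restrict Ω)} {g : Fin 2 → Lp ℝ 2 (volume.restrict Ω)}
    (hfg : ∀ i, HasWeakPartial Ω i f (g i)) :
    ∃ G : ℕ → Plane → ℝ, (∀ n, ContDiff ℝ ∞ (G n) ∧ HasCompactSupport (G n)) ∧
      Filter.Tendsto (fun n => eLpNorm (fun x => G n x - f x) 2 (volume.restrict Ω)) Filter.atTop (𝓝 0) ∧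
      ∀ K, IsCompact K → K ⊆ Ω → ∀ i, Filter.Tendsto
        (fun n => eLpNorm (fun x => partialDeriv i (G n) x - g i x) 2 (volume.restrict K)) Filter.atTop (𝓝 0) := by
  have hm : ∀ w : Lp ℝ 2 (volume.restrict Ω), StronglyMeasurable (Ω.indicator w) := fun w =>
    (Lp.stronglyMeasurable w).indicator hΩ.measurableSet
  have hL : ∀ w : Lp ℝ 2 (volume.restrict Ω), MemLp (Ω.indicator w) 2 volume := fun w =>
    (memLp_indicator_iff_restrict hΩ.measurableSet).2 (Lp.memLp w)
  have hconv : ∀ (w : Lp ℝ 2 (volume.restrict Ω)), Filter.Tendsto (fun n =>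
      eLpNorm (fun x => mollify n (Ω.indicator w) x - w x) 2 (volume.restrict Ω)) Filter.atTop (𝓝 0) := by
    intro w
    refine tendsto_of_tendsto_of_tendsto_of_le_of_le tendsto_const_nhds
      (tendsto_eLpNorm_mollify_sub (hm w) (by norm_num) (by norm_num) (hL w))
      (fun _ => zero_le) fun n => ?_
    refine le_trans (le_of_eq (eLpNorm_congr_ae ?_))
      (eLpNorm_mono_measure _ Measure.restrict_le_self)
    filter_upwards [ae_restrict_mem hΩ.measurableSet] with x hx
    simp [hx]
  refine ⟨fun n => mollify n (Ω.indicator f), fun n =>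
    ⟨contDiff_mollify n ((hL f).locallyIntegrable (by norm_num)),
      hasCompactSupport_mollify n (HasCompactSupport.of_support_subset_isCompact hb.isCompact_closure
        (support_indicator_subset.trans subset_closure))⟩,
    hconv f, fun K hK hKΩ i => ?_⟩
  obtain ⟨δ, hδ, hδ'⟩ := hK.exists_cthickening_subset_open hΩ hKΩ
  refine tendsto_of_tendsto_of_tendsto_of_le_of_le' tendsto_const_nhds (hconv (g i))
    (Filter.Eventually.of_forall fun _ => zero_le) ?_
  filter_upwards [tendsto_bump_rOut.eventually_lt_const hδ] with n hn
  refine le_trans (le_of_eq (eLpNorm_congr_ae ?_))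
    (eLpNorm_mono_measure _ (Measure.restrict_mono hKΩ le_rfl))
  filter_upwards [ae_restrict_mem hK.measurableSet] with x hx
  rw [← partialDeriv_mollify hΩ (hfg i) ((hL f).locallyIntegrable (by norm_num)) n]
  · rfl
  · exact (Metric.closedBall_subset_closedBall hn.le).trans
      ((Metric.closedBall_subset_cthickening hx δ).trans hδ')

end Mollify

/-! ### The interior cone condition and its consequences -/

lemma map_eq_sum_coord {F : Type*} [NormedAddCommGroup F] [NormedSpace ℝ F] (L : Plane →L[ℝ] F)
    (v : Plane) : L v = ∑ i, v i • L (EuclideanSpace.single i 1) := by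
  conv_lhs => rw [← (EuclideanSpace.basisFun (Fin 2) ℝ).sum_repr v]
  simp

lemma norm_map_le_sum {F : Type*} [NormedAddCommGroup F] [NormedSpace ℝ F] (L : Plane →L[ℝ] F)
    (v : Plane) : ‖L v‖ ≤ ∑ i, ‖v‖ * ‖L (EuclideanSpace.single i 1)‖ := by
  rw [map_eq_sum_coord]
  refine norm_sum_le_of_le _ fun i _ => ?_
  rw [norm_smul]
  gcongr
  exact PiLp.norm_apply_le v i

/-- A uniform version of the interior cone condition: near every point `x ∈ Ω` one can move from any
point of `Ω` in the directions of a fixed ball and stay in `Ω`. -/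
theorem IsSmoothBoundedDomain.exists_cone {Ω : Set Plane} (hΩ : IsSmoothBoundedDomain Ω) :
    ∃ δ > 0, ∃ R > 0, ∀ x ∈ Ω, ∃ z₀ : Plane, ∀ y ∈ Ω ∩ Metric.ball x R,
      ∀ z ∈ Metric.closedBall z₀ δ, ∀ r ∈ Icc (0 : ℝ) 1, y + r • z ∈ Ω := by
  let P : Set Plane → Prop := fun s => ∃ δ > 0, ∃ R > 0, ∀ x ∈ s, ∃ z₀ : Plane,
    ∀ y ∈ Ω ∩ Metric.ball x R, ∀ z ∈ Metric.closedBall z₀ δ, ∀ r ∈ Icc (0 : ℝ) 1, y + r • z ∈ Ω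
  suffices h : P (closure Ω) by
    obtain ⟨δ, hδ, R, hR, H⟩ := h
    exact ⟨δ, hδ, R, hR, fun x hx => H x (subset_closure hx)⟩
  refine hΩ.isBounded.isCompact_closure.induction_on (p := P)
    ⟨1, one_pos, 1, one_pos, fun x hx => absurd hx (notMem_empty x)⟩
    (fun s t hst ⟨δ, hδ, R, hR, H⟩ => ⟨δ, hδ, R, hR, fun x hx => H x (hst hx)⟩) ?_ ?_
  · rintro s t ⟨δ, hδ, R, hR, H⟩ ⟨δ', hδ', R', hR', H'⟩
    refine ⟨min δ δ', lt_min hδ hδ', min R R', lt_min hR hR', fun x hx => ?_⟩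
    rcases hx with hx | hx
    · obtain ⟨z₀, h⟩ := H x hx
      exact ⟨z₀, fun y hy z hz => h y ⟨hy.1, Metric.ball_subset_ball (min_le_left _ _) hy.2⟩ z
        (Metric.closedBall_subset_closedBall (min_le_left _ _) hz)⟩
    · obtain ⟨z₀, h⟩ := H' x hx
      exact ⟨z₀, fun y hy z hz => h y ⟨hy.1, Metric.ball_subset_ball (min_le_right _ _) hy.2⟩ z
        (Metric.closedBall_subset_closedBall (min_le_right _ _) hz)⟩
  · intro x hx
    by_cases hxΩ : x ∈ Ω
    · obtain ⟨ε, hε, Hε⟩ := Metric.isOpen_iff.1 hΩ.isOpen x hxΩ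
      refine ⟨_, mem_nhdsWithin_of_mem_nhds (Metric.ball_mem_nhds x (by positivity : 0 < ε / 4)),
        ε / 4, by positivity, ε / 4, by positivity, fun x' hx' => ⟨0, fun y hy z hz r hr => Hε ?_⟩⟩
      rw [Metric.mem_ball] at hx' ⊢
      have h1 := hy.2
      rw [Metric.mem_ball] at h1
      rw [mem_closedBall_zero_iff] at hz
      have h2 : dist (y + r • z) y ≤ 1 * (ε / 4) := by
        rw [dist_eq_norm, add_sub_cancel_left, norm_smul, Real.norm_of_nonneg hr.1]
        exact mul_le_mul hr.2 hz (norm_nonneg _) zero_le_one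
      linarith [dist_triangle (y + r • z) y x, dist_triangle y x' x]
    · have hxf : x ∈ frontier Ω := ⟨hx, fun h => hxΩ (interior_subset h)⟩
      obtain ⟨ρ, hρ⟩ := hΩ.exists_definingFunction x hxf
      set n := gradient ρ x
      have hsm : ContDiff ℝ 1 ρ := hρ.contDiff.of_le (by simp)
      have hdc : Continuous fun p : Plane × Plane => fderiv ℝ ρ p.1 p.2 :=
        ((hsm.continuous_fderiv one_ne_zero).comp continuous_fst).clm_apply continuous_snd
      have ev : ∀ᶠ p : Plane × Plane in 𝓝 (x, -n),
          (p.1 ∈ Ω ↔ ρ p.1 < 0) ∧ fderiv ℝ ρ p.1 p.2 < 0 := by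
        refine ((continuous_fst.tendsto (x, -n)).eventually hρ.mem_iff).and
          (hdc.continuousAt.eventually_lt_const ?_)
        simp only [map_neg]
        exact neg_neg_of_pos hρ.fderiv_gradient_pos
      obtain ⟨ε, hε, Hε⟩ := Metric.eventually_nhds_iff_ball.1 ev
      have Hε' : ∀ y z, dist y x < ε → dist z (-n) < ε →
          (y ∈ Ω ↔ ρ y < 0) ∧ fderiv ℝ ρ y z < 0 := fun y z hy hz =>
        Hε (y, z) (by rw [Metric.mem_ball, Prod.dist_eq]; exact max_lt hy hz)
      set c := ε / (2 * (‖n‖ + ε + 1)) with hc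
      have hcpos : 0 < c := by positivity
      have hcn : c * (‖n‖ + ε) < ε / 2 := by
        rw [hc, div_mul_eq_mul_div, div_lt_iff₀ (by positivity)]
        nlinarith [norm_nonneg n]
      refine ⟨_, mem_nhdsWithin_of_mem_nhds (Metric.ball_mem_nhds x (by positivity : 0 < ε / 4)),
        c * (ε / 2), by positivity, ε / 4, by positivity,
        fun x' hx' => ⟨c • (-n), fun y hy z hz r hr => ?_⟩⟩
      rw [Metric.mem_ball] at hx'
      have h1 := hy.2
      rw [Metric.mem_ball] at h1
      have hyx : dist y x < ε / 2 := by linarith [dist_triangle y x' x]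
      have hz' : dist (c⁻¹ • z) (-n) < ε := by
        rw [Metric.mem_closedBall] at hz
        have : c⁻¹ • z - -n = c⁻¹ • (z - c • (-n)) := by
          rw [smul_sub, inv_smul_smul₀ hcpos.ne']
        rw [dist_eq_norm, this, norm_smul, norm_inv, Real.norm_of_nonneg hcpos.le,
          inv_mul_lt_iff₀ hcpos, ← dist_eq_norm]
        refine hz.trans_lt ?_
        gcongr
        linarith
      have hzn : ‖z‖ < ε / 2 := by
        rw [Metric.mem_closedBall, dist_eq_norm] at hz
        have h2 : ‖z‖ ≤ ‖z - c • (-n)‖ + ‖c • (-n)‖ := by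
          simpa using norm_add_le (z - c • (-n)) (c • (-n))
        rw [norm_smul c, norm_neg, Real.norm_of_nonneg hcpos.le] at h2
        nlinarith
      have hball : ∀ r ∈ Icc (0 : ℝ) 1, dist (y + r • z) x < ε := fun r hr => by
        have h2 : dist (y + r • z) y ≤ 1 * ‖z‖ := by
          rw [dist_eq_norm, add_sub_cancel_left, norm_smul, Real.norm_of_nonneg hr.1]
          exact mul_le_mul_of_nonneg_right hr.2 (norm_nonneg _)
        linarith [dist_triangle (y + r • z) y x]
      have hd : ∀ σ : ℝ, HasDerivAt (fun σ : ℝ => ρ (y + σ • z)) (fderiv ℝ ρ (y + σ • z) z) σ := by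
        intro σ
        have h1 : HasDerivAt (fun σ : ℝ => y + σ • z) z σ := by
          simpa using ((hasDerivAt_id σ).smul_const z).const_add y
        exact ((hsm.differentiable one_ne_zero _).hasFDerivAt).comp_hasDerivAt σ h1
      have hanti : AntitoneOn (fun σ : ℝ => ρ (y + σ • z)) (Icc 0 1) := by
        refine antitoneOn_of_deriv_nonpos (convex_Icc 0 1)
          (fun σ _ => (hd σ).continuousAt.continuousWithinAt)
          (fun σ _ => (hd σ).differentiableAt.differentiableWithinAt) fun σ hσ => ?_
        rw [(hd σ).deriv]
        have h3 := (Hε' _ _ (hball σ (interior_subset hσ)) hz').2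
        rw [map_smul, smul_eq_mul] at h3
        by_contra! hpos
        have : 0 < c⁻¹ * fderiv ℝ ρ (y + σ • z) z := by positivity
        linarith
      have h4 := hanti (left_mem_Icc.2 zero_le_one) hr hr.1
      simp only [zero_smul, add_zero] at h4
      have h5 := (Hε' y _ (hyx.trans (by linarith)) hz').1.1 hy.1
      exact (Hε' _ _ (hball r hr) hz').1.2 (by linarith)

section Morrey

variable {F : Type*} [NormedAddCommGroup F] {Ω : Set Plane} {p : ℝ≥0∞}

lemma memLp_indicator (hΩ : IsOpen Ω) (w : Lp F p (volume.restrict Ω)) :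
    MemLp (Ω.indicator w) p volume :=
  (memLp_indicator_iff_restrict hΩ.measurableSet).2 (Lp.memLp w)

lemma stronglyMeasurable_indicator (hΩ : IsOpen Ω) (w : Lp F p (volume.restrict Ω)) :
    StronglyMeasurable (Ω.indicator w) :=
  (Lp.stronglyMeasurable w).indicator hΩ.measurableSet

lemma locallyIntegrable_indicator [Fact (1 ≤ p)] (hΩ : IsOpen Ω) (w : Lp F p (volume.restrict Ω)) :
    LocallyIntegrable (Ω.indicator w) volume :=
  (memLp_indicator hΩ w).locallyIntegrable Fact.out

variable [NormedSpace ℝ F]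

lemma norm_mollify_le (hΩ : IsOpen Ω) {g : Plane → F} {N : ℝ} (hN : 0 ≤ N)
    (hg : ∀ᵐ y ∂volume.restrict Ω, ‖g y‖ ≤ N) (n : ℕ) (x : Plane) :
    ‖mollify n (Ω.indicator g) x‖ ≤ N := by
  rw [mollify_apply_swap]
  have hi : Integrable (fun y => (bump n).normed volume (x - y)) volume :=
    (bump n).integrable_normed.comp_sub_left x
  have h1 : ∫ y, (bump n).normed volume (x - y) * N = N := by
    rw [integral_mul_const, integral_sub_left_eq_self (fun t => (bump n).normed volume t),
      (bump n).integral_normed, one_mul]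
  rw [← h1]
  refine norm_integral_le_of_norm_le (hi.mul_const N) ?_
  filter_upwards [(ae_restrict_iff' hΩ.measurableSet).1 hg] with y hy
  rw [norm_smul, Real.norm_of_nonneg ((bump n).nonneg_normed _)]
  refine mul_le_mul_of_nonneg_left ?_ ((bump n).nonneg_normed _)
  by_cases hyΩ : y ∈ Ω
  · rw [indicator_of_mem hyΩ]; exact hy hyΩ
  · rw [indicator_of_notMem hyΩ, norm_zero]; exact hN

variable [CompleteSpace F]

/-- Mollifications converge at the points of continuity. -/
lemma tendsto_mollify (hΩ : IsOpen Ω) (f : Lp F p (volume.restrict Ω)) {W : Plane → F}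
    (hW : ContinuousOn W Ω) (hWf : W =ᵐ[volume.restrict Ω] f) {x : Plane} (hx : x ∈ Ω) :
    Filter.Tendsto (fun n => mollify n (Ω.indicator f) x) Filter.atTop (𝓝 (W x)) := by
  have hae : Ω.indicator W =ᵐ[volume] Ω.indicator f := by
    filter_upwards [(ae_restrict_iff' hΩ.measurableSet).1 hWf] with y hy
    by_cases hyΩ : y ∈ Ω
    · rw [indicator_of_mem hyΩ, indicator_of_mem hyΩ, hy hyΩ]
    · rw [indicator_of_notMem hyΩ, indicator_of_notMem hyΩ]
  have h1 : ∀ n, mollify n (Ω.indicator f) x = mollify n (Ω.indicator W) x := fun n => by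
    rw [mollify_apply_swap, mollify_apply_swap]
    refine integral_congr_ae ?_
    filter_upwards [hae] with y hy
    rw [hy]
  simp_rw [h1]
  refine ContDiffBump.convolution_tendsto_right tendsto_bump_rOut (Filter.Eventually.of_forall
    fun _ => (stronglyMeasurable_indicator hΩ f).aestronglyMeasurable.congr hae.symm) ?_
    tendsto_const_nhds
  have h2 : Filter.Tendsto (Ω.indicator W) (𝓝 x) (𝓝 (W x)) := by
    refine ((hW.continuousAt (hΩ.mem_nhds hx)).tendsto).congr' ?_
    filter_upwards [hΩ.mem_nhds hx] with y hy
    rw [indicator_of_mem hy]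
  exact h2.comp Filter.tendsto_snd

variable [Fact (1 ≤ p)]

/-- The mean value inequality on a segment in `Ω`, in terms of weak derivatives. -/
lemma norm_sub_le_of_segment (hΩ : IsOpen Ω) {f : Lp F p (volume.restrict Ω)}
    {g : Fin 2 → Lp F p (volume.restrict Ω)} (hfg : ∀ i, HasWeakPartial Ω i f (g i))
    {W : Plane → F} (hW : ContinuousOn W Ω) (hWf : W =ᵐ[volume.restrict Ω] f) {N : ℝ} (hN : 0 ≤ N)
    (hg : ∀ i, ∀ᵐ y ∂volume.restrict Ω, ‖g i y‖ ≤ N) {x y : Plane} (hxy : segment ℝ x y ⊆ Ω) :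
    ‖W x - W y‖ ≤ 2 * N * ‖x - y‖ := by
  have hK : IsCompact (segment ℝ x y) := by
    rw [segment_eq_image_lineMap]
    exact isCompact_Icc.image AffineMap.lineMap_continuous
  obtain ⟨δ, hδ, hδ'⟩ := hK.exists_cthickening_subset_open hΩ hxy
  refine le_of_tendsto ((tendsto_mollify hΩ f hW hWf (hxy (left_mem_segment ℝ x y))).sub
    (tendsto_mollify hΩ f hW hWf (hxy (right_mem_segment ℝ x y)))).norm ?_
  filter_upwards [tendsto_bump_rOut.eventually_lt_const hδ] with n hn
  have hd : Differentiable ℝ (mollify n (Ω.indicator f)) :=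
    (contDiff_mollify n (locallyIntegrable_indicator hΩ f)).differentiable (by simp)
  rw [norm_sub_rev, norm_sub_rev x]
  refine Convex.norm_image_sub_le_of_norm_fderiv_le (𝕜 := ℝ) (s := segment ℝ x y)
    (fun z _ => hd z) (fun z hz => ?_) (convex_segment x y) (left_mem_segment ℝ x y)
    (right_mem_segment ℝ x y)
  refine ContinuousLinearMap.opNorm_le_bound _ (by positivity) fun v => ?_
  refine (norm_map_le_sum _ v).trans ?_
  have hb : ∀ i, ‖fderiv ℝ (mollify n (Ω.indicator f)) z (EuclideanSpace.single i 1)‖ ≤ N := by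
    intro i
    rw [partialDeriv_mollify hΩ (hfg i) (locallyIntegrable_indicator hΩ f) n]
    · exact norm_mollify_le hΩ hN (hg i) n z
    · exact (Metric.closedBall_subset_closedBall hn.le).trans
        ((Metric.closedBall_subset_cthickening hz δ).trans hδ')
  calc _ ≤ ∑ _i : Fin 2, ‖v‖ * N := Finset.sum_le_sum fun i _ => by gcongr; exact hb i
    _ = _ := by simp; ring

/-- In a smooth bounded domain the continuous representative of a `W^{1,∞}` function is bounded and
Lipschitz: two nearby points are joined by a short path that first moves into the cone. -/
theorem IsSmoothBoundedDomain.exists_lipschitz (hΩ : IsSmoothBoundedDomain Ω) (F : Type*)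
    [NormedAddCommGroup F] [NormedSpace ℝ F] [CompleteSpace F] (p : ℝ≥0∞) [Fact (1 ≤ p)] :
    ∃ C ≥ 1, ∀ (f : Lp F p (volume.restrict Ω)) (g : Fin 2 → Lp F p (volume.restrict Ω)),
      (∀ i, HasWeakPartial Ω i f (g i)) → ∀ W : Plane → F, ContinuousOn W Ω →
      W =ᵐ[volume.restrict Ω] f → ∀ N ≥ 0, (∀ᵐ y ∂volume.restrict Ω, ‖f y‖ ≤ N) →
      (∀ i, ∀ᵐ y ∂volume.restrict Ω, ‖g i y‖ ≤ N) →
      (∀ x ∈ Ω, ‖W x‖ ≤ N) ∧ ∀ x ∈ Ω, ∀ y ∈ Ω, ‖W x - W y‖ ≤ C * N * ‖x - y‖ := by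
  obtain ⟨δ, hδ, R, hR, H⟩ := hΩ.exists_cone
  obtain ⟨M, hM⟩ := hΩ.isBounded.subset_closedBall 0
  set m := min R δ with hm
  have hmpos : 0 < m := lt_min hR hδ
  refine ⟨max 1 (max (2 / m) (4 * (2 * M / δ) + 2)), le_max_left _ _, ?_⟩
  intro f g hfg W hW hWf N hN hf hg
  have hbd : ∀ x ∈ Ω, ‖W x‖ ≤ N := fun x hx =>
    le_of_tendsto (tendsto_mollify hΩ.isOpen f hW hWf hx).norm
      (Filter.Eventually.of_forall fun n => norm_mollify_le hΩ.isOpen hN hf n x)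
  refine ⟨hbd, fun x hx y hy => ?_⟩
  by_cases hd : m ≤ ‖x - y‖
  · calc ‖W x - W y‖ ≤ ‖W x‖ + ‖W y‖ := norm_sub_le _ _
      _ ≤ N + N := add_le_add (hbd x hx) (hbd y hy)
      _ = 2 / m * N * m := by field_simp; ring
      _ ≤ _ := by
          gcongr
          exact (le_max_left _ _).trans (le_max_right _ _)
  · push Not at hd
    rcases eq_or_ne x y with rfl | hne
    · simp
    set d := ‖x - y‖ with hd'
    have hdpos : 0 < d := norm_pos_iff.2 (sub_ne_zero.2 hne)
    have hdR : d < R := hd.trans_le (min_le_left _ _)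
    have hdδ : d / δ ≤ 1 := (div_le_one hδ).2 (hd.trans_le (min_le_right _ _)).le
    obtain ⟨z₀, hz⟩ := H x hx
    have hz₀ : ‖z₀‖ ≤ 2 * M := by
      have h1 := hM (hz x ⟨hx, Metric.mem_ball_self hR⟩ z₀ (Metric.mem_closedBall_self hδ.le) 1
        (right_mem_Icc.2 zero_le_one))
      have h2 := hM hx
      rw [mem_closedBall_zero_iff] at h1 h2
      calc ‖z₀‖ = ‖x + (1 : ℝ) • z₀ - x‖ := by simp
        _ ≤ _ := norm_sub_le _ _
        _ ≤ 2 * M := by linarith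
    have hyR : y ∈ Ω ∩ Metric.ball x R := ⟨hy, by rw [Metric.mem_ball, dist_comm, dist_eq_norm]; exact hdR⟩
    have seg1 : ∀ w ∈ Ω ∩ Metric.ball x R, segment ℝ w (w + (d / δ) • z₀) ⊆ Ω := by
      intro w hw
      rw [segment_eq_image']
      rintro _ ⟨r, hr, rfl⟩
      simp only [add_sub_cancel_left, smul_smul]
      exact hz w hw z₀ (Metric.mem_closedBall_self hδ.le) _
        ⟨mul_nonneg hr.1 (by positivity), mul_le_one₀ hr.2 (by positivity) hdδ⟩
    have seg2 : segment ℝ (x + (d / δ) • z₀) (y + (d / δ) • z₀) ⊆ Ω := by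
      rw [segment_symm, segment_eq_image']
      rintro _ ⟨r, hr, rfl⟩
      have e : y + (d / δ) • z₀ + r • (x + (d / δ) • z₀ - (y + (d / δ) • z₀))
          = y + (d / δ) • (z₀ + (δ / d * r) • (x - y)) := by
        rw [smul_add, smul_smul, show d / δ * (δ / d * r) = r by field_simp, add_sub_add_right_eq_sub,
          add_assoc]
      simp only [e]
      refine hz y hyR _ ?_ _ ⟨by positivity, hdδ⟩
      rw [Metric.mem_closedBall, dist_eq_norm, add_sub_cancel_left, norm_smul, ← hd',
        Real.norm_of_nonneg (mul_nonneg (by positivity) hr.1),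
        show δ / d * r * d = δ * r by field_simp]
      nlinarith [hr.2]
    have key : ∀ {a b : Plane}, segment ℝ a b ⊆ Ω → ‖W a - W b‖ ≤ 2 * N * ‖a - b‖ := fun hab =>
      norm_sub_le_of_segment hΩ.isOpen hfg hW hWf hN hg hab
    have k1 := key (seg1 x ⟨hx, Metric.mem_ball_self hR⟩)
    have k2 := key (seg1 y hyR)
    have k3 := key seg2
    rw [sub_add_cancel_left, norm_neg, norm_smul, Real.norm_of_nonneg (by positivity)] at k1 k2
    rw [add_sub_add_right_eq_sub, ← hd'] at k3
    calc ‖W x - W y‖ = ‖(W x - W (x + (d / δ) • z₀))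
          + (W (x + (d / δ) • z₀) - W (y + (d / δ) • z₀)) - (W y - W (y + (d / δ) • z₀))‖ := by
          congr 1; abel
      _ ≤ ‖W x - W (x + (d / δ) • z₀)‖ + ‖W (x + (d / δ) • z₀) - W (y + (d / δ) • z₀)‖
          + ‖W y - W (y + (d / δ) • z₀)‖ := (norm_sub_le _ _).trans (by gcongr; exact norm_add_le _ _)
      _ ≤ 2 * N * (d / δ * ‖z₀‖) + 2 * N * d + 2 * N * (d / δ * ‖z₀‖) := by gcongr
      _ ≤ 2 * N * (d / δ * (2 * M)) + 2 * N * d + 2 * N * (d / δ * (2 * M)) := by gcongr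
      _ = (4 * (2 * M / δ) + 2) * N * d := by ring
      _ ≤ _ := by
          gcongr
          exact (le_max_right _ _).trans (le_max_right _ _)

end Morrey

/-! ### Morrey's inequality -/

section Morrey

variable {F : Type*} [NormedAddCommGroup F] {Ω : Set Plane}

/-- Hölder's inequality and a dilation: averages of `L³` functions over the balls `x + r B` of the
plane are of order `r ^ (-2/3)`, which is integrable at `0`. -/
lemma setLIntegral_comp_dilation_le {u : Plane → F} (hu : StronglyMeasurable u) (B : Set Plane)
    (x : Plane) {r : ℝ} (hr : 0 < r) :
    ∫⁻ z in B, ‖u (x + r • z)‖ₑ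
      ≤ volume B ^ (2 / 3 : ℝ) * (ENNReal.ofReal (r ^ (-(2 / 3) : ℝ)) * eLpNorm u 3 volume) := by
  have hm : Measurable fun z : Plane => x + r • z := by fun_prop
  have hsm : StronglyMeasurable fun z : Plane => u (x + r • z) := hu.comp_measurable hm
  have h1 := eLpNorm_le_eLpNorm_mul_rpow_measure_univ (p := 1) (q := 3) (by norm_num)
    (hsm.aestronglyMeasurable (μ := volume.restrict B))
  rw [eLpNorm_one_eq_lintegral_enorm, Measure.restrict_apply_univ] at h1
  have e1 : (1 / (1 : ℝ≥0∞).toReal - 1 / (3 : ℝ≥0∞).toReal) = 2 / 3 := by norm_num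
  rw [e1, mul_comm] at h1
  refine h1.trans (mul_le_mul_right ?_ _)
  refine (eLpNorm_mono_measure _ Measure.restrict_le_self).trans (le_of_eq ?_)
  rw [eLpNorm_eq_lintegral_rpow_enorm_toReal (by norm_num) (by norm_num),
    eLpNorm_eq_lintegral_rpow_enorm_toReal (by norm_num) (by norm_num)]
  have e2 : ∫⁻ z, ‖u (x + r • z)‖ₑ ^ (3 : ℝ≥0∞).toReal
      = ENNReal.ofReal (r ^ (-2 : ℝ)) * ∫⁻ z, ‖u z‖ₑ ^ (3 : ℝ≥0∞).toReal := by
    rw [← lintegral_add_left_eq_self (fun z => ‖u z‖ₑ ^ (3 : ℝ≥0∞).toReal) x]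
    have hmeas : Measurable fun z : Plane => ‖u (x + z)‖ₑ ^ (3 : ℝ≥0∞).toReal :=
      ((hu.comp_measurable (measurable_const.add measurable_id)).enorm).pow_const _
    have h2 := lintegral_map (μ := volume) hmeas (measurable_const_smul r : Measurable fun z : Plane => r • z)
    rw [Measure.map_addHaar_smul _ hr.ne', lintegral_smul_measure] at h2
    rw [← h2]
    congr 2
    rw [finrank_euclideanSpace, Fintype.card_fin, abs_of_pos (by positivity), Real.rpow_neg hr.le]
    norm_cast
  rw [e2, ENNReal.mul_rpow_of_nonneg _ _ (by norm_num)]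
  congr 1
  rw [ENNReal.ofReal_rpow_of_nonneg (by positivity) (by norm_num), ← Real.rpow_mul hr.le]
  norm_num

lemma setLIntegral_rpow_lt_top :
    ∫⁻ r in Ioc (0 : ℝ) 1, ENNReal.ofReal (r ^ (-(2 / 3) : ℝ)) < ⊤ := by
  have h := (intervalIntegral.intervalIntegrable_rpow' (a := 0) (b := 1)
    (by norm_num : (-1 : ℝ) < -(2 / 3))).1
  refine lt_of_le_of_lt (lintegral_mono fun r => ?_) h.2
  exact Real.ofReal_le_enorm _

variable [NormedSpace ℝ F] [CompleteSpace F]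

lemma enorm_le_add_lintegral_segment {w : Plane → F} (hw : ContDiff ℝ 1 w) {γ : Fin 2 → Plane → F}
    (hγ : ∀ i, Continuous (γ i)) {x z : Plane} {M : ℝ} (hz : ‖z‖ ≤ M)
    (h : ∀ r ∈ Icc (0 : ℝ) 1, ∀ i,
      fderiv ℝ w (x + r • z) (EuclideanSpace.single i 1) = γ i (x + r • z)) :
    ‖w x‖ₑ ≤ ‖w (x + z)‖ₑ
      + ENNReal.ofReal M * ∑ i, ∫⁻ r in Ioc (0 : ℝ) 1, ‖γ i (x + r • z)‖ₑ := by
  have hd : ∀ r : ℝ, HasDerivAt (fun r : ℝ => w (x + r • z)) (fderiv ℝ w (x + r • z) z) r := by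
    intro r
    have h1 : HasDerivAt (fun r : ℝ => x + r • z) z r := by
      simpa using ((hasDerivAt_id r).smul_const z).const_add x
    exact ((hw.differentiable one_ne_zero _).hasFDerivAt).comp_hasDerivAt r h1
  have hcont : Continuous fun r : ℝ => fderiv ℝ w (x + r • z) z :=
    ((hw.continuous_fderiv one_ne_zero).comp (by fun_prop)).clm_apply continuous_const
  have hftc := intervalIntegral.integral_eq_sub_of_hasDerivAt (a := 0) (b := 1) (fun r _ => hd r)
    (hcont.intervalIntegrable _ _)
  rw [intervalIntegral.integral_of_le zero_le_one] at hftc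
  simp only [one_smul, zero_smul, add_zero] at hftc
  have h2 : w x = w (x + z) - ∫ r in Ioc (0 : ℝ) 1, fderiv ℝ w (x + r • z) z := by
    rw [hftc]; abel
  rw [h2]
  refine enorm_sub_le.trans (add_le_add le_rfl ((enorm_integral_le_lintegral_enorm _).trans ?_))
  have hγr : ∀ i, Measurable fun r : ℝ => ‖γ i (x + r • z)‖ₑ := fun i =>
    ((hγ i).comp (by fun_prop : Continuous fun r : ℝ => x + r • z)).enorm.measurable
  rw [← lintegral_finsetSum _ fun i _ => hγr i,
    ← lintegral_const_mul _ (Finset.measurable_fun_sum _ fun i _ => hγr i)]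
  refine setLIntegral_mono' measurableSet_Ioc fun r hr => ?_
  have h3 := norm_map_le_sum (fderiv ℝ w (x + r • z)) z
  simp_rw [h r ⟨hr.1.le, hr.2⟩, ← Finset.mul_sum] at h3
  rw [← ofReal_norm]
  refine (ENNReal.ofReal_le_ofReal (h3.trans
    (mul_le_mul_of_nonneg_right hz (Finset.sum_nonneg fun _ _ => norm_nonneg _)))).trans ?_
  rw [ENNReal.ofReal_mul ((norm_nonneg _).trans hz),
    ENNReal.ofReal_sum_of_nonneg fun _ _ => norm_nonneg _]
  simp_rw [ofReal_norm]
  exact le_rfl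

/-- **Morrey's inequality**: `W^{1,3}(Ω) ⊆ L^∞(Ω)`. The value at `x` is compared with the average over
a cone with vertex `x`. -/
theorem IsSmoothBoundedDomain.exists_morrey (hΩ : IsSmoothBoundedDomain Ω) (F : Type*)
    [NormedAddCommGroup F] [NormedSpace ℝ F] [CompleteSpace F] :
    ∃ C : ℝ≥0∞, C ≠ ⊤ ∧ ∀ (f : Lp F 3 (volume.restrict Ω)) (g : Fin 2 → Lp F 3 (volume.restrict Ω)),
      (∀ i, HasWeakPartial Ω i f (g i)) →
      eLpNorm f ⊤ (volume.restrict Ω) ≤ C * (eLpNorm f 3 (volume.restrict Ω)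
        + ∑ i, eLpNorm (g i) 3 (volume.restrict Ω)) := by
  obtain ⟨δ, hδ, R, hR, H⟩ := hΩ.exists_cone
  obtain ⟨M, hM⟩ := hΩ.isBounded.subset_closedBall 0
  set β := volume (Metric.closedBall (0 : Plane) δ) with hβ
  have hβ0 : β ≠ 0 := (Metric.measure_closedBall_pos volume _ hδ).ne'
  have hβt : β ≠ ⊤ := measure_closedBall_lt_top.ne
  set c := ∫⁻ r in Ioc (0 : ℝ) 1, ENNReal.ofReal (r ^ (-(2 / 3) : ℝ)) with hc
  have hct : c ≠ ⊤ := setLIntegral_rpow_lt_top.ne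
  set D := ENNReal.ofReal (2 * M) with hD
  have hβp : β ^ (2 / 3 : ℝ) ≠ ⊤ := ENNReal.rpow_ne_top_of_nonneg (by norm_num) hβt
  refine ⟨β⁻¹ * (β ^ (2 / 3 : ℝ) * (1 + D * c)), ENNReal.mul_ne_top (ENNReal.inv_ne_top.2 hβ0)
    (ENNReal.mul_ne_top hβp (ENNReal.add_ne_top.2 ⟨by simp, ENNReal.mul_ne_top ENNReal.ofReal_ne_top hct⟩)),
    fun f g hfg => ?_⟩
  have e3 : ∀ w : Lp F 3 (volume.restrict Ω), eLpNorm (Ω.indicator w) 3 volume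
      = eLpNorm w 3 (volume.restrict Ω) := fun w =>
    eLpNorm_indicator_eq_eLpNorm_restrict hΩ.isOpen.measurableSet
  have hae := (ContDiffBump.ae_convolution_tendsto_right_of_locallyIntegrable (K := 2)
    tendsto_bump_rOut (Filter.Eventually.of_forall fun n => by
      change 1 / ((n : ℝ) + 1) ≤ 2 * (1 / (n + 1) / 2)
      linarith) (locallyIntegrable_indicator hΩ.isOpen f))
  rw [eLpNorm_exponent_top]
  refine eLpNormEssSup_le_of_ae_enorm_bound ?_
  filter_upwards [ae_restrict_of_ae hae, ae_restrict_mem hΩ.isOpen.measurableSet] with x hx hxΩ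
  rw [indicator_of_mem hxΩ] at hx
  refine le_of_tendsto hx.enorm ?_
  obtain ⟨z₀, hz⟩ := H x hxΩ
  have hz' := hz x ⟨hxΩ, Metric.mem_ball_self hR⟩
  set B := Metric.closedBall z₀ δ with hB
  have hBβ : volume B = β := by rw [hB, hβ, Measure.addHaar_closedBall_center]
  have hnorm : ∀ z ∈ B, ‖z‖ ≤ 2 * M := fun z hzB => by
    have h1 := hM (hz' z hzB 1 (right_mem_Icc.2 zero_le_one))
    have h2 := hM hxΩ
    rw [mem_closedBall_zero_iff] at h1 h2
    calc ‖z‖ = ‖x + (1 : ℝ) • z - x‖ := by simp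
      _ ≤ _ := norm_sub_le _ _
      _ ≤ 2 * M := by linarith
  have hK : IsCompact ((fun q : ℝ × Plane => x + q.1 • q.2) '' (Icc 0 1 ×ˢ B)) :=
    (isCompact_Icc.prod (isCompact_closedBall _ _)).image (by fun_prop)
  obtain ⟨ε, hε, hε'⟩ := hK.exists_cthickening_subset_open hΩ.isOpen (by
    rintro _ ⟨⟨r, z⟩, ⟨hr, hzB⟩, rfl⟩
    exact hz' z hzB r hr)
  filter_upwards [tendsto_bump_rOut.eventually_lt_const hε] with n hn
  change ‖mollify n (Ω.indicator f) x‖ₑ ≤ _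
  set w := mollify n (Ω.indicator f) with hw
  set γ : Fin 2 → Plane → F := fun i => mollify n (Ω.indicator (g i)) with hγ
  have hwc : ContDiff ℝ ∞ w := contDiff_mollify n (locallyIntegrable_indicator hΩ.isOpen f)
  have hγc : ∀ i, Continuous (γ i) := fun i =>
    (contDiff_mollify n (locallyIntegrable_indicator hΩ.isOpen (g i))).continuous
  have hγn : ∀ i, eLpNorm (γ i) 3 volume ≤ eLpNorm (g i) 3 (volume.restrict Ω) := fun i =>
    (eLpNorm_mollify_le n (stronglyMeasurable_indicator hΩ.isOpen (g i)) (by norm_num)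
      (by norm_num)).trans (e3 _).le
  have hwn : eLpNorm w 3 volume ≤ eLpNorm f 3 (volume.restrict Ω) :=
    (eLpNorm_mollify_le n (stronglyMeasurable_indicator hΩ.isOpen f) (by norm_num)
      (by norm_num)).trans (e3 _).le
  have hpt : ∀ z ∈ B, ‖w x‖ₑ ≤ ‖w (x + z)‖ₑ
      + D * ∑ i, ∫⁻ r in Ioc (0 : ℝ) 1, ‖γ i (x + r • z)‖ₑ := by
    intro z hzB
    refine enorm_le_add_lintegral_segment (hwc.of_le (by simp)) hγc (hnorm z hzB) fun r hr i => ?_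
    refine partialDeriv_mollify hΩ.isOpen (hfg i) (locallyIntegrable_indicator hΩ.isOpen f) n ?_
    refine (Metric.closedBall_subset_closedBall hn.le).trans
      ((Metric.closedBall_subset_cthickening ?_ ε).trans hε')
    exact ⟨(r, z), ⟨hr, hzB⟩, rfl⟩
  have hint : β * ‖w x‖ₑ ≤ β ^ (2 / 3 : ℝ) * (1 + D * c) * (eLpNorm f 3 (volume.restrict Ω)
      + ∑ i, eLpNorm (g i) 3 (volume.restrict Ω)) := by
    have hmeas2 : ∀ i, Measurable fun q : Plane × ℝ => ‖γ i (x + q.2 • q.1)‖ₑ := fun i =>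
      ((hγc i).comp (by fun_prop : Continuous fun q : Plane × ℝ => x + q.2 • q.1)).enorm.measurable
    have hswap : ∀ i, ∫⁻ z in B, ∫⁻ r in Ioc (0 : ℝ) 1, ‖γ i (x + r • z)‖ₑ
        ≤ β ^ (2 / 3 : ℝ) * (c * eLpNorm (g i) 3 (volume.restrict Ω)) := by
      intro i
      rw [lintegral_lintegral_swap (hmeas2 i).aemeasurable, hc, ← lintegral_mul_const'',
        ← lintegral_const_mul'']
      · refine setLIntegral_mono' measurableSet_Ioc fun r hr => ?_
        rw [← hBβ]
        refine (setLIntegral_comp_dilation_le (hγc i).stronglyMeasurable B x hr.1).trans ?_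
        gcongr
        exact hγn i
      · fun_prop
      · fun_prop
    have hfirst : ∫⁻ z in B, ‖w (x + z)‖ₑ
        ≤ β ^ (2 / 3 : ℝ) * eLpNorm f 3 (volume.restrict Ω) := by
      have := setLIntegral_comp_dilation_le hwc.continuous.stronglyMeasurable B x one_pos
      simp only [one_smul, Real.one_rpow, ENNReal.ofReal_one, one_mul, hBβ] at this
      exact this.trans (by gcongr)
    calc β * ‖w x‖ₑ = ∫⁻ _ in B, ‖w x‖ₑ := by rw [setLIntegral_const, hBβ, mul_comm]
      _ ≤ ∫⁻ z in B, (‖w (x + z)‖ₑ + D * ∑ i, ∫⁻ r in Ioc (0 : ℝ) 1, ‖γ i (x + r • z)‖ₑ) :=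
          setLIntegral_mono' Metric.isClosed_closedBall.measurableSet hpt
      _ = (∫⁻ z in B, ‖w (x + z)‖ₑ)
          + D * ∑ i, ∫⁻ z in B, ∫⁻ r in Ioc (0 : ℝ) 1, ‖γ i (x + r • z)‖ₑ := by
          rw [lintegral_add_left, lintegral_const_mul, lintegral_finsetSum]
          · exact fun i _ => (hmeas2 i).lintegral_prod_right'
          · exact Finset.measurable_fun_sum _ fun i _ => (hmeas2 i).lintegral_prod_right'
          · exact (hwc.continuous.comp (by fun_prop : Continuous fun z : Plane => x + z)).enorm.measurable
      _ ≤ β ^ (2 / 3 : ℝ) * eLpNorm f 3 (volume.restrict Ω)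
          + D * ∑ i, β ^ (2 / 3 : ℝ) * (c * eLpNorm (g i) 3 (volume.restrict Ω)) := by
          gcongr with i
          exact hswap i
      _ = β ^ (2 / 3 : ℝ) * (1 * eLpNorm f 3 (volume.restrict Ω)
          + D * c * ∑ i, eLpNorm (g i) 3 (volume.restrict Ω)) := by
          rw [← Finset.mul_sum, ← Finset.mul_sum]; ring
      _ ≤ β ^ (2 / 3 : ℝ) * ((1 + D * c) * eLpNorm f 3 (volume.restrict Ω)
          + (1 + D * c) * ∑ i, eLpNorm (g i) 3 (volume.restrict Ω)) := by
          gcongr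
          · exact self_le_add_right _ _
          · exact self_le_add_left _ _
      _ = _ := by ring
  rw [mul_assoc]
  rw [← ENNReal.mul_le_mul_iff_right hβ0 hβt, ← mul_assoc β, ENNReal.mul_inv_cancel hβ0 hβt, one_mul]
  exact hint

end Morrey

/-! ### Composition with bi-Lipschitz maps -/

/-- `Φ` and `Ψ` are inverse `K`-Lipschitz maps of the plane that preserve `Ω`. -/
structure IsBiLip (Ω : Set Plane) (K : ℝ) (Φ Ψ : Plane → Plane) : Prop where
  one_le : 1 ≤ K
  lipschitz : ∀ x y, ‖Φ x - Φ y‖ ≤ K * ‖x - y‖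
  lipschitz_inv : ∀ x y, ‖Ψ x - Ψ y‖ ≤ K * ‖x - y‖
  left_inv : ∀ x, Ψ (Φ x) = x
  right_inv : ∀ x, Φ (Ψ x) = x
  mapsTo : ∀ x ∈ Ω, Φ x ∈ Ω
  mapsTo_inv : ∀ x ∈ Ω, Ψ x ∈ Ω

/-- Lipschitz maps of the plane increase areas at most by the square of the Lipschitz constant. -/
lemma volume_image_le {Φ : Plane → Plane} {K : ℝ} (hK : 0 ≤ K)
    (h : ∀ x y, ‖Φ x - Φ y‖ ≤ K * ‖x - y‖) (s : Set Plane) :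
    volume (Φ '' s) ≤ ENNReal.ofReal (K ^ 2) * volume s := by
  have hl : LipschitzWith ⟨K, hK⟩ Φ := LipschitzWith.of_dist_le_mul fun x y => by
    rw [dist_eq_norm, dist_eq_norm]; exact h x y
  have := isAddHaarMeasure_hausdorffMeasure (E := Plane)
  obtain ⟨c, hc⟩ : ∃ c : NNReal, (volume : Measure Plane)
      = c • Measure.hausdorffMeasure (Module.finrank ℝ Plane : ℝ) :=
    ⟨_, Measure.isAddLeftInvariant_eq_smul _ _⟩
  have h1 := hl.hausdorffMeasure_image_le (d := (Module.finrank ℝ Plane : ℝ)) (by positivity) s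
  rw [hc, Measure.smul_apply, Measure.smul_apply, ENNReal.smul_def, ENNReal.smul_def, smul_eq_mul,
    smul_eq_mul]
  calc _ ≤ (c : ℝ≥0∞) * _ := mul_le_mul_right h1 _
    _ = _ := by
      have e : ENNReal.ofNNReal ⟨K, hK⟩ = ENNReal.ofReal K := (ENNReal.ofReal_eq_coe_nnreal hK).symm
      rw [e, finrank_euclideanSpace, Fintype.card_fin, ENNReal.ofReal_pow hK]
      norm_cast
      ring

namespace IsBiLip

variable {Ω : Set Plane} {K : ℝ} {Φ Ψ : Plane → Plane}

lemma symm (h : IsBiLip Ω K Φ Ψ) : IsBiLip Ω K Ψ Φ :=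
  ⟨h.one_le, h.lipschitz_inv, h.lipschitz, h.right_inv, h.left_inv, h.mapsTo_inv, h.mapsTo⟩

lemma nonneg (h : IsBiLip Ω K Φ Ψ) : 0 ≤ K := zero_le_one.trans h.one_le

lemma lipschitzWith (h : IsBiLip Ω K Φ Ψ) : LipschitzWith ⟨K, h.nonneg⟩ Φ :=
  LipschitzWith.of_dist_le_mul fun x y => by
    rw [dist_eq_norm, dist_eq_norm]; exact h.lipschitz x y

lemma continuous (h : IsBiLip Ω K Φ Ψ) : Continuous Φ := h.lipschitzWith.continuous

lemma measurable (h : IsBiLip Ω K Φ Ψ) : Measurable Φ := h.continuous.measurable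

lemma map_restrict_le (h : IsBiLip Ω K Φ Ψ) {S T : Set Plane} (hST : MapsTo Φ S T) :
    Measure.map Φ (volume.restrict S) ≤ ENNReal.ofReal (K ^ 2) • volume.restrict T := by
  refine Measure.le_iff.2 fun s hs => ?_
  rw [Measure.map_apply h.measurable hs, Measure.restrict_apply (h.measurable hs),
    Measure.smul_apply, smul_eq_mul, Measure.restrict_apply hs]
  refine (measure_mono fun x hx => ?_).trans (volume_image_le h.nonneg h.lipschitz_inv (s ∩ T))
  exact ⟨Φ x, ⟨hx.1, hST hx.2⟩, h.left_inv x⟩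

lemma quasiMeasurePreserving (h : IsBiLip Ω K Φ Ψ) {S T : Set Plane} (hST : MapsTo Φ S T) :
    Measure.QuasiMeasurePreserving Φ (volume.restrict S) (volume.restrict T) :=
  ⟨h.measurable, Measure.absolutelyContinuous_of_le_smul (h.map_restrict_le hST)⟩

lemma eLpNorm_comp_le {F : Type*} [NormedAddCommGroup F] (h : IsBiLip Ω K Φ Ψ) {S T : Set Plane}
    (hST : MapsTo Φ S T) {f : Plane → F} (hf : AEStronglyMeasurable f (volume.restrict T)) :
    eLpNorm (fun x => f (Φ x)) 2 (volume.restrict S)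
      ≤ ENNReal.ofReal K * eLpNorm f 2 (volume.restrict T) := by
  have h1 := eLpNorm_map_measure (p := 2) (hf.mono_ac (h.quasiMeasurePreserving hST).absolutelyContinuous)
    h.measurable.aemeasurable
  change _ = eLpNorm (fun x => f (Φ x)) 2 (volume.restrict S) at h1
  rw [← h1]
  refine (eLpNorm_mono_measure _ (h.map_restrict_le hST)).trans ?_
  rw [eLpNorm_smul_measure_of_ne_top (by norm_num), smul_eq_mul]
  refine mul_le_mul_left (le_of_eq ?_) _
  rw [ENNReal.ofReal_rpow_of_nonneg (by positivity) (by norm_num)]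
  congr 1
  rw [← Real.rpow_natCast, ← Real.rpow_mul h.nonneg]
  norm_num

lemma memLp_comp (h : IsBiLip Ω K Φ Ψ) (f : L2 Ω) :
    MemLp (fun x => f (Φ x)) 2 (volume.restrict Ω) :=
  ⟨(Lp.aestronglyMeasurable f).comp_quasiMeasurePreserving (h.quasiMeasurePreserving h.mapsTo),
    (h.eLpNorm_comp_le h.mapsTo (Lp.aestronglyMeasurable f)).trans_lt
      (ENNReal.mul_lt_top ENNReal.ofReal_lt_top (Lp.eLpNorm_lt_top f))⟩

lemma ae_comp (h : IsBiLip Ω K Φ Ψ) {P : Plane → Prop} (hP : ∀ᵐ x ∂volume.restrict Ω, P x) :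
    ∀ᵐ x ∂volume.restrict Ω, P (Φ x) :=
  (h.quasiMeasurePreserving h.mapsTo).ae hP

/-- `f ↦ f ∘ Φ` as a bounded operator on `L²(Ω)`. -/
def comp (h : IsBiLip Ω K Φ Ψ) : L2 Ω →L[ℝ] L2 Ω :=
  LinearMap.mkContinuous
    { toFun := fun f => (h.memLp_comp f).toLp
      map_add' := fun f g => by
        rw [← MemLp.toLp_add]
        refine MemLp.toLp_congr _ _ ?_
        filter_upwards [h.ae_comp (Lp.coeFn_add f g)] with x hx using hx
      map_smul' := fun c f => by
        rw [RingHom.id_apply, ← MemLp.toLp_const_smul]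
        refine MemLp.toLp_congr _ _ ?_
        filter_upwards [h.ae_comp (Lp.coeFn_smul c f)] with x hx using hx }
    K fun f => by
      change ‖(h.memLp_comp f).toLp‖ ≤ _
      rw [Lp.norm_toLp, Lp.norm_def, ← ENNReal.toReal_ofReal h.nonneg, ← ENNReal.toReal_mul]
      exact ENNReal.toReal_mono (ENNReal.mul_ne_top ENNReal.ofReal_ne_top (Lp.eLpNorm_ne_top f))
        (h.eLpNorm_comp_le h.mapsTo (Lp.aestronglyMeasurable f))

lemma coeFn_comp (h : IsBiLip Ω K Φ Ψ) (f : L2 Ω) :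
    h.comp f =ᵐ[volume.restrict Ω] fun x => f (Φ x) :=
  (h.memLp_comp f).coeFn_toLp

lemma norm_comp_le (h : IsBiLip Ω K Φ Ψ) (f : L2 Ω) : ‖h.comp f‖ ≤ K * ‖f‖ :=
  ContinuousLinearMap.le_of_opNorm_le _ (LinearMap.mkContinuous_norm_le _ h.nonneg _) f

lemma integrable_comp (h : IsBiLip Ω K Φ Ψ) {f : Plane → ℝ} (hf : Integrable f (volume.restrict Ω)) :
    Integrable (fun x => f (Φ x)) (volume.restrict Ω) := by
  refine Integrable.comp_measurable (g := f) ?_ h.measurable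
  exact (hf.smul_measure ENNReal.ofReal_ne_top).mono_measure (h.map_restrict_le h.mapsTo)

lemma integral_comp_le (h : IsBiLip Ω K Φ Ψ) {f : Plane → ℝ} (hf : Integrable f (volume.restrict Ω))
    (h0 : ∀ x, 0 ≤ f x) : ∫ x in Ω, f (Φ x) ≤ K ^ 2 * ∫ x in Ω, f x := by
  rw [← integral_map h.measurable.aemeasurable (f := f) (hf.aestronglyMeasurable.mono_ac
    (h.quasiMeasurePreserving h.mapsTo).absolutelyContinuous)]
  refine (integral_mono_measure (h.map_restrict_le h.mapsTo) (ae_of_all _ h0)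
    (hf.smul_measure ENNReal.ofReal_ne_top)).trans (le_of_eq ?_)
  rw [integral_smul_measure, ENNReal.toReal_ofReal (by positivity), smul_eq_mul]

lemma le_integral_comp (h : IsBiLip Ω K Φ Ψ) {f : Plane → ℝ} (hf : Integrable f (volume.restrict Ω))
    (h0 : ∀ x, 0 ≤ f x) : ∫ x in Ω, f x ≤ K ^ 2 * ∫ x in Ω, f (Φ x) := by
  have := h.symm.integral_comp_le (h.integrable_comp hf) fun x => h0 _
  simpa only [h.right_inv] using this

/-- A map with bi-Lipschitz constant close to `1` almost preserves integrals. -/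
lemma abs_integral_comp_sub_le (h : IsBiLip Ω K Φ Ψ) {f : Plane → ℝ}
    (hf : Integrable f (volume.restrict Ω)) :
    |(∫ x in Ω, f (Φ x)) - ∫ x in Ω, f x| ≤ (K ^ 2 - 1) * ∫ x in Ω, |f x| := by
  have key : ∀ g : Plane → ℝ, Integrable g (volume.restrict Ω) → (∀ x, 0 ≤ g x) →
      |(∫ x in Ω, g (Φ x)) - ∫ x in Ω, g x| ≤ (K ^ 2 - 1) * ∫ x in Ω, g x := by
    intro g hg hg0
    have h1 := h.integral_comp_le hg hg0
    have h2 := h.le_integral_comp hg hg0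
    have h3 : 0 ≤ ∫ x in Ω, g x := integral_nonneg hg0
    have hk : 1 ≤ K ^ 2 := one_le_pow₀ h.one_le
    set a := ∫ x in Ω, g (Φ x)
    set b := ∫ x in Ω, g x
    set k := K ^ 2
    rw [abs_le]
    constructor
    · by_contra! hc
      nlinarith [mul_nonneg h3 (sq_nonneg (k - 1))]
    · linarith
  have e1 : ∀ y, f y = max (f y) 0 - max (-f y) 0 := fun y => by
    rcases le_total 0 (f y) with hy | hy <;> simp [hy]
  have e2 : ∀ y, |f y| = max (f y) 0 + max (-f y) 0 := fun y => by
    rcases le_total 0 (f y) with hy | hy <;> simp [hy, abs_of_nonneg, abs_of_nonpos]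
  have hp : Integrable (fun x => max (f x) 0) (volume.restrict Ω) := hf.pos_part
  have hn : Integrable (fun x => max (-f x) 0) (volume.restrict Ω) := hf.neg_part
  have k1 := key _ hp fun x => le_max_right _ _
  have k2 := key _ hn fun x => le_max_right _ _
  simp_rw [e2]
  rw [integral_add hp hn, integral_congr_ae (ae_of_all _ fun x => e1 (Φ x)),
    integral_congr_ae (ae_of_all _ e1), integral_sub hp hn,
    integral_sub (h.integrable_comp hp) (h.integrable_comp hn)]
  rw [abs_le] at k1 k2 ⊢
  constructor <;> linarith [k1.1, k1.2, k2.1, k2.2]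

/-- In the weak sense, `q ∘ Φ` is close to `q` if `Φ` is close to the identity and almost preserves
integrals. -/
theorem abs_integral_mul_comp_sub_le (h : IsBiLip Ω K Φ Ψ) {q ψ : Plane → ℝ} {B L d : ℝ}
    (hq : Integrable q (volume.restrict Ω)) (hψm : Measurable ψ) (hB : ∀ x, |ψ x| ≤ B)
    (hL0 : 0 ≤ L) (hL : ∀ x y, |ψ x - ψ y| ≤ L * ‖x - y‖) (hd : ∀ x, ‖Φ x - x‖ ≤ d) :
    |(∫ x in Ω, ψ x * q (Φ x)) - ∫ x in Ω, ψ x * q x|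
      ≤ (L * d * K ^ 2 + (K ^ 2 - 1) * B) * ∫ x in Ω, |q x| := by
  have hd0 : 0 ≤ d := (norm_nonneg _).trans (hd 0)
  have hk : 0 ≤ K ^ 2 - 1 := by linarith [one_le_pow₀ (n := 2) h.one_le]
  have hψq : Integrable (fun x => ψ x * q x) (volume.restrict Ω) :=
    hq.bdd_mul hψm.aestronglyMeasurable (ae_of_all _ hB)
  have hqΦ := h.integrable_comp hq
  have i1 : Integrable (fun x => ψ x * q (Φ x)) (volume.restrict Ω) :=
    hqΦ.bdd_mul hψm.aestronglyMeasurable (ae_of_all _ hB)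
  have i2 := h.integrable_comp hψq
  have h1 := h.abs_integral_comp_sub_le hψq
  have h2 : |(∫ x in Ω, ψ x * q (Φ x)) - ∫ x in Ω, ψ (Φ x) * q (Φ x)|
      ≤ L * d * (K ^ 2 * ∫ x in Ω, |q x|) := by
    rw [← integral_sub i1 i2]
    calc _ ≤ ∫ x in Ω, L * d * |q (Φ x)| := by
          refine norm_integral_le_of_norm_le (G := ℝ) (hqΦ.abs.const_mul _) (ae_of_all _ fun x => ?_)
          rw [← sub_mul, norm_mul]
          refine mul_le_mul_of_nonneg_right ?_ (norm_nonneg _)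
          refine (hL _ _).trans (mul_le_mul_of_nonneg_left ?_ hL0)
          rw [norm_sub_rev]; exact hd x
      _ = L * d * ∫ x in Ω, |q (Φ x)| := integral_const_mul _ _
      _ ≤ _ := by
          gcongr
          exact h.integral_comp_le hq.abs fun x => abs_nonneg _
  have h3 : ∫ x in Ω, |ψ x * q x| ≤ B * ∫ x in Ω, |q x| := by
    rw [← integral_const_mul]
    refine integral_mono hψq.abs (hq.abs.const_mul _) fun x => ?_
    simp only [abs_mul]
    exact mul_le_mul_of_nonneg_right (hB x) (abs_nonneg _)
  have h4 := mul_le_mul_of_nonneg_left h3 hk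
  calc _ = |((∫ x in Ω, ψ x * q (Φ x)) - ∫ x in Ω, ψ (Φ x) * q (Φ x))
        + ((∫ x in Ω, ψ (Φ x) * q (Φ x)) - ∫ x in Ω, ψ x * q x)| := by congr 1; ring
    _ ≤ _ := abs_add_le _ _
    _ ≤ L * d * (K ^ 2 * ∫ x in Ω, |q x|) + (K ^ 2 - 1) * (B * ∫ x in Ω, |q x|) := by linarith
    _ = _ := by ring

end IsBiLip

/-! ### Multiplication by bounded functions -/

section Mul

variable {Ω : Set Plane} {b : Plane → ℝ} {N : ℝ}

lemma memLp_mul (hb : Measurable b) (hN : ∀ x, |b x| ≤ N) (f : L2 Ω) :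
    MemLp (fun x => b x * f x) 2 (volume.restrict Ω) :=
  MemLp.of_le_mul (c := N) (Lp.memLp f) (hb.aestronglyMeasurable.mul (Lp.aestronglyMeasurable f))
    (ae_of_all _ fun x => by
      rw [norm_mul]; exact mul_le_mul_of_nonneg_right (hN x) (norm_nonneg _))

/-- Multiplication by a bounded measurable function as a bounded operator on `L²(Ω)`. -/
def mulL2 (Ω : Set Plane) (hb : Measurable b) (hN : ∀ x, |b x| ≤ N) : L2 Ω →L[ℝ] L2 Ω :=
  LinearMap.mkContinuous
    { toFun := fun f => (memLp_mul hb hN f).toLp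
      map_add' := fun f g => by
        rw [← MemLp.toLp_add]
        refine MemLp.toLp_congr _ _ ?_
        filter_upwards [Lp.coeFn_add f g] with x hx
        rw [hx, Pi.add_apply, Pi.add_apply, mul_add]
      map_smul' := fun c f => by
        rw [RingHom.id_apply, ← MemLp.toLp_const_smul]
        refine MemLp.toLp_congr _ _ ?_
        filter_upwards [Lp.coeFn_smul c f] with x hx
        rw [hx, Pi.smul_apply, Pi.smul_apply, smul_eq_mul, smul_eq_mul]
        ring }
    N fun f => by
      change ‖(memLp_mul hb hN f).toLp‖ ≤ _
      refine Lp.norm_le_mul_norm_of_ae_le_mul ?_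
      filter_upwards [(memLp_mul hb hN f).coeFn_toLp] with x hx
      rw [hx, norm_mul]
      exact mul_le_mul_of_nonneg_right (hN x) (norm_nonneg _)

lemma coeFn_mulL2 (hb : Measurable b) (hN : ∀ x, |b x| ≤ N) (f : L2 Ω) :
    mulL2 Ω hb hN f =ᵐ[volume.restrict Ω] fun x => b x * f x :=
  (memLp_mul hb hN f).coeFn_toLp

lemma norm_mulL2_le (hb : Measurable b) (hN : ∀ x, |b x| ≤ N) (f : L2 Ω) :
    ‖mulL2 Ω hb hN f‖ ≤ N * ‖f‖ :=
  ContinuousLinearMap.le_of_opNorm_le _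
    (LinearMap.mkContinuous_norm_le _ ((abs_nonneg _).trans (hN 0)) _) f

end Mul

section

/-! ### The chain rule for `H¹` functions and bi-Lipschitz maps -/

/-- Integrals against a fixed `L²` function are continuous for `L²` convergence. -/
lemma tendsto_integral_mul {μ : Measure Plane} {b a : Plane → ℝ} {s : ℕ → Plane → ℝ}
    (hb : MemLp b 2 μ) (ha : MemLp a 2 μ) (hs : ∀ n, MemLp (s n) 2 μ)
    (h : Filter.Tendsto (fun n => eLpNorm (fun x => s n x - a x) 2 μ) Filter.atTop (𝓝 0)) :
    Filter.Tendsto (fun n => ∫ x, b x * s n x ∂μ) Filter.atTop (𝓝 (∫ x, b x * a x ∂μ)) := by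
  have key : ∀ {c : Plane → ℝ} (hc : MemLp c 2 μ),
      ∫ x, b x * c x ∂μ = inner ℝ hc.toLp hb.toLp := fun {c} hc => by
    rw [L2.inner_def]
    refine integral_congr_ae ?_
    filter_upwards [hc.coeFn_toLp, hb.coeFn_toLp] with x h1 h2
    rw [h1, h2]; rfl
  have h1 : Filter.Tendsto (fun n => (hs n).toLp) Filter.atTop (𝓝 ha.toLp) :=
    (Lp.tendsto_Lp_iff_tendsto_eLpNorm'' _ hs _ ha).2 h
  rw [key ha]
  simp_rw [fun n => key (hs n)]
  exact h1.inner tendsto_const_nhds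

lemma integral_mul_eq_setIntegral {Ω : Set Plane} {φ w : Plane → ℝ} (h : ∀ x ∉ Ω, φ x = 0) :
    ∫ x, φ x * w x = ∫ x in Ω, φ x * w x :=
  (setIntegral_eq_integral_of_forall_compl_eq_zero fun x hx => by rw [h x hx, zero_mul]).symm

/-- Integration by parts for Lipschitz functions of the plane. -/
lemma integral_partialDeriv_mul_eq {f φ : Plane → ℝ} {L : NNReal} (hf : LipschitzWith L f)
    (hφ : ContDiff ℝ ∞ φ) (hφc : HasCompactSupport φ) (i : Fin 2) :
    ∫ x, partialDeriv i φ x * f x = -∫ x, φ x * fderiv ℝ f x (EuclideanSpace.single i 1) := by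
  obtain ⟨C, hC⟩ := (hφ.of_le (m := 1) (by simp)).lipschitzWith_of_hasCompactSupport hφc
    one_ne_zero
  have h := LipschitzWith.integral_lineDeriv_mul_eq (μ := (volume : Measure Plane)) hf hC hφc
    (EuclideanSpace.single i 1)
  have e1 : ∫ x, lineDeriv ℝ f x (EuclideanSpace.single i 1) * φ x
      = ∫ x, φ x * fderiv ℝ f x (EuclideanSpace.single i 1) := by
    refine integral_congr_ae ?_
    filter_upwards [hf.ae_differentiableAt] with x hx
    rw [hx.lineDeriv_eq_fderiv, mul_comm]
  have e2 : ∫ x, lineDeriv ℝ φ x (-EuclideanSpace.single i 1) * f x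
      = -∫ x, partialDeriv i φ x * f x := by
    rw [← integral_neg]
    refine integral_congr_ae (ae_of_all _ fun x => ?_)
    simp only
    rw [(hφ.differentiable (by simp) x).lineDeriv_eq_fderiv, map_neg]
    simp [partialDeriv]
  rw [e1, e2] at h
  linarith

lemma abs_fderiv_apply_le {Φ : Plane → Plane} {L : NNReal} (h : LipschitzWith L Φ) (i j : Fin 2)
    (x : Plane) : |fderiv ℝ Φ x (EuclideanSpace.single i 1) j| ≤ L := by
  refine (PiLp.norm_apply_le (fderiv ℝ Φ x (EuclideanSpace.single i 1)) j).trans ?_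
  refine (ContinuousLinearMap.le_opNorm _ _).trans ?_
  have e : ‖(EuclideanSpace.single i 1 : Plane)‖ = 1 := by simp
  rw [e, mul_one]
  exact norm_fderiv_le_of_lipschitz ℝ h

lemma measurable_fderiv_apply (Φ : Plane → Plane) (i j : Fin 2) :
    Measurable fun x => fderiv ℝ Φ x (EuclideanSpace.single i 1) j :=
  (EuclideanSpace.proj (𝕜 := ℝ) j).measurable.comp (measurable_fderiv_apply_const ℝ Φ _)

lemma IsTestFunction.memLp {Ω : Set Plane} {φ : Plane → ℝ} (hφ : IsTestFunction Ω φ) (p : ℝ≥0∞)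
    (μ : Measure Plane) [IsFiniteMeasureOnCompacts μ] : MemLp φ p μ :=
  hφ.contDiff.continuous.memLp_of_hasCompactSupport hφ.hasCompactSupport

lemma IsTestFunction.eq_zero {Ω : Set Plane} {φ : Plane → ℝ} (hφ : IsTestFunction Ω φ) :
    ∀ x ∉ Ω, φ x = 0 :=
  fun _ hx => image_eq_zero_of_notMem_tsupport fun h => hx (hφ.tsupport_subset h)

variable {Ω : Set Plane} {K : ℝ} {Φ Ψ : Plane → Plane}

lemma IsBiLip.abs_fderiv_apply_le (h : IsBiLip Ω K Φ Ψ) (i j : Fin 2) (x : Plane) :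
    |fderiv ℝ Φ x (EuclideanSpace.single i 1) j| ≤ K :=
  TransportH1.abs_fderiv_apply_le h.lipschitzWith i j x

/-- The formula `∂ᵢ(f ∘ Φ) = ∑ⱼ (∂ⱼ f ∘ Φ) ∂ᵢΦⱼ`, where `∂ᵢΦⱼ` is given by Rademacher's theorem. -/
theorem IsBiLip.hasWeakPartial_comp (h : IsBiLip Ω K Φ Ψ) (hΩ : IsOpen Ω)
    (hb : Bornology.IsBounded Ω) {f : L2 Ω} {g : Fin 2 → L2 Ω}
    (hfg : ∀ i, HasWeakPartial Ω i f (g i)) (i : Fin 2) :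
    HasWeakPartial Ω i (h.comp f) (∑ j, mulL2 Ω (measurable_fderiv_apply Φ i j)
      (h.abs_fderiv_apply_le i j) (h.comp (g j)) : L2 Ω) := by
  intro φ hφ
  obtain ⟨G, hG, hG0, hG1⟩ := exists_smooth_approx hΩ hb hfg
  set S := tsupport φ with hS
  have hSc : IsCompact S := hφ.hasCompactSupport.isCompact
  have hSΩ : S ⊆ Ω := hφ.tsupport_subset
  have hφi := hφ.partialDeriv i
  have hGL : ∀ n, MemLp (G n) 2 (volume.restrict Ω) := fun n =>
    (hG n).1.continuous.memLp_of_hasCompactSupport (hG n).2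
  have hφD : ∀ j (μ : Measure Plane) [IsFiniteMeasureOnCompacts μ],
      MemLp (fun x => φ x * fderiv ℝ Φ x (EuclideanSpace.single i 1) j) 2 μ := fun j μ _ => by
    refine MemLp.of_le_mul (c := K) (hφ.memLp 2 μ) (hφ.contDiff.continuous.aestronglyMeasurable.mul
      (measurable_fderiv_apply Φ i j).aestronglyMeasurable) (ae_of_all _ fun x => ?_)
    rw [norm_mul, mul_comm]
    exact mul_le_mul_of_nonneg_right (h.abs_fderiv_apply_le i j x) (norm_nonneg _)
  -- both sides are limits of the corresponding expressions for the smooth approximations `G n`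
  have lim1 : Filter.Tendsto (fun n => ∫ x in Ω, partialDeriv i φ x * G n (Φ x)) Filter.atTop
      (𝓝 (∫ x in Ω, partialDeriv i φ x * f (Φ x))) := by
    refine tendsto_integral_mul (hφi.memLp 2 _) (h.memLp_comp f) (fun n => ?_) ?_
    · refine ⟨((hG n).1.continuous.comp h.continuous).aestronglyMeasurable,
        (h.eLpNorm_comp_le h.mapsTo (hGL n).1).trans_lt
          (ENNReal.mul_lt_top ENNReal.ofReal_lt_top (hGL n).2)⟩
    · refine tendsto_of_tendsto_of_tendsto_of_le_of_le tendsto_const_nhds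
        (by simpa using ENNReal.Tendsto.const_mul hG0 (Or.inr (ENNReal.ofReal_ne_top (r := K))))
        (fun _ => zero_le) fun n => ?_
      exact h.eLpNorm_comp_le (f := fun x => G n x - f x) h.mapsTo
        ((hGL n).1.sub (Lp.aestronglyMeasurable f))
  have lim2 : ∀ j, Filter.Tendsto (fun n => ∫ x in S,
      (φ x * fderiv ℝ Φ x (EuclideanSpace.single i 1) j) * partialDeriv j (G n) (Φ x)) Filter.atTop
      (𝓝 (∫ x in S, (φ x * fderiv ℝ Φ x (EuclideanSpace.single i 1) j) * g j (Φ x))) := by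
    intro j
    have hST : MapsTo Φ S (Φ '' S) := mapsTo_image _ _
    have hΦS : IsCompact (Φ '' S) := hSc.image h.continuous
    have hΦSΩ : Φ '' S ⊆ Ω := by rintro _ ⟨x, hx, rfl⟩; exact h.mapsTo x (hSΩ hx)
    have hgL : MemLp (g j) 2 (volume.restrict (Φ '' S)) :=
      (Lp.memLp (g j)).mono_measure (Measure.restrict_mono hΦSΩ le_rfl)
    have hlim := ENNReal.Tendsto.const_mul (hG1 _ hΦS hΦSΩ j)
      (Or.inr (ENNReal.ofReal_ne_top (r := K)))
    rw [mul_zero] at hlim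
    refine tendsto_integral_mul ?_ ?_ (fun n => ?_) ?_
    · exact hφD j _
    · exact (h.memLp_comp (g j)).mono_measure (Measure.restrict_mono hSΩ le_rfl)
    · have hc := (contDiff_partialDeriv (hG n).1 j).continuous
      have hm : MemLp (partialDeriv j (G n)) 2 (volume.restrict (Φ '' S)) :=
        hc.memLp_of_hasCompactSupport (hasCompactSupport_partialDeriv (hG n).2 j)
      exact ⟨(hc.comp h.continuous).aestronglyMeasurable, (h.eLpNorm_comp_le hST hm.1).trans_lt
          (ENNReal.mul_lt_top ENNReal.ofReal_lt_top hm.2)⟩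
    · refine tendsto_of_tendsto_of_tendsto_of_le_of_le tendsto_const_nhds hlim
        (fun _ => zero_le) fun n => ?_
      exact h.eLpNorm_comp_le (f := fun x => partialDeriv j (G n) x - g j x) hST
        ((contDiff_partialDeriv (hG n).1 j).continuous.aestronglyMeasurable.sub hgL.1)
  have hstep : ∀ n, ∫ x in Ω, partialDeriv i φ x * G n (Φ x) = -∑ j, ∫ x in S,
      (φ x * fderiv ℝ Φ x (EuclideanSpace.single i 1) j) * partialDeriv j (G n) (Φ x) := by
    intro n
    obtain ⟨C, hC⟩ := ((hG n).1.of_le (m := 1) (by simp)).lipschitzWith_of_hasCompactSupport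
      (hG n).2 one_ne_zero
    rw [← integral_mul_eq_setIntegral hφi.eq_zero, integral_partialDeriv_mul_eq
      (f := fun x => G n (Φ x)) (hC.comp h.lipschitzWith) hφ.contDiff hφ.hasCompactSupport,
      integral_mul_eq_setIntegral (Ω := S) fun x hx => image_eq_zero_of_notMem_tsupport hx,
      ← integral_finsetSum]
    · congr 1
      refine integral_congr_ae (ae_restrict_of_ae ?_)
      filter_upwards [h.lipschitzWith.ae_differentiableAt] with x hx
      have e : fderiv ℝ (fun x => G n (Φ x)) x = (fderiv ℝ (G n) (Φ x)).comp (fderiv ℝ Φ x) :=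
        fderiv_comp x ((hG n).1.differentiable (by simp) _) hx
      rw [e, ContinuousLinearMap.comp_apply, map_eq_sum_coord, Finset.mul_sum]
      refine Finset.sum_congr rfl fun j _ => ?_
      rw [partialDeriv, smul_eq_mul, mul_assoc]
    · intro j _
      have hc := (contDiff_partialDeriv (hG n).1 j).continuous
      obtain ⟨B, hB⟩ := hc.bounded_above_of_compact_support (hasCompactSupport_partialDeriv (hG n).2 j)
      have i1 : Integrable φ (volume.restrict S) := memLp_one_iff_integrable.1 (hφ.memLp 1 _)
      exact ((i1.mul_bdd (c := K) (measurable_fderiv_apply Φ i j).aestronglyMeasurable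
        (ae_of_all _ fun x => h.abs_fderiv_apply_le i j x))).mul_bdd (c := B)
        (hc.comp h.continuous).aestronglyMeasurable (ae_of_all _ fun x => hB _)
  have hlim := tendsto_nhds_unique (lim1.congr hstep)
    ((tendsto_finsetSum _ fun j _ => lim2 j).neg)
  have e1 : ∫ x in Ω, partialDeriv i φ x • h.comp f x = ∫ x in Ω, partialDeriv i φ x * f (Φ x) := by
    refine integral_congr_ae ?_
    filter_upwards [h.coeFn_comp f] with x hx
    rw [hx, smul_eq_mul]
  rw [e1, hlim]
  have e2 : ∀ j, ∫ x in S, (φ x * fderiv ℝ Φ x (EuclideanSpace.single i 1) j) * g j (Φ x)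
      = ∫ x in Ω, (φ x * fderiv ℝ Φ x (EuclideanSpace.single i 1) j) * g j (Φ x) := fun j => by
    rw [← integral_mul_eq_setIntegral (Ω := S)
        (φ := fun x => φ x * fderiv ℝ Φ x (EuclideanSpace.single i 1) j) fun x hx => by
        rw [image_eq_zero_of_notMem_tsupport hx, zero_mul],
      ← integral_mul_eq_setIntegral (Ω := Ω)
        (φ := fun x => φ x * fderiv ℝ Φ x (EuclideanSpace.single i 1) j) fun x hx => by
        rw [hφ.eq_zero x hx, zero_mul]]
  have hint : ∀ j, Integrable (fun x => (φ x * fderiv ℝ Φ x (EuclideanSpace.single i 1) j)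
      * g j (Φ x)) (volume.restrict Ω) := fun j =>
    MemLp.integrable_mul (hφD j _) (h.memLp_comp (g j))
  rw [Finset.sum_congr rfl fun j _ => e2 j, ← integral_finsetSum _ fun j _ => hint j]
  congr 1
  refine integral_congr_ae ?_
  rw [Fin.sum_univ_two]
  filter_upwards [Lp.coeFn_add (mulL2 Ω (measurable_fderiv_apply Φ i 0)
      (h.abs_fderiv_apply_le i 0) (h.comp (g 0))) (mulL2 Ω (measurable_fderiv_apply Φ i 1)
      (h.abs_fderiv_apply_le i 1) (h.comp (g 1))),
    coeFn_mulL2 (Ω := Ω) (measurable_fderiv_apply Φ i 0) (h.abs_fderiv_apply_le i 0)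
      (h.comp (g 0)),
    coeFn_mulL2 (Ω := Ω) (measurable_fderiv_apply Φ i 1) (h.abs_fderiv_apply_le i 1)
      (h.comp (g 1)), h.coeFn_comp (g 0), h.coeFn_comp (g 1)] with x h1 h2 h3 h4 h5
  rw [h1, Pi.add_apply, h2, h3, h4, h5, Fin.sum_univ_two, smul_eq_mul]
  ring

/-- `H¹` functions composed with bi-Lipschitz maps are in `H¹`. -/
theorem IsBiLip.exists_comp_sobolev (h : IsBiLip Ω K Φ Ψ) (hΩ : IsOpen Ω)
    (hb : Bornology.IsBounded Ω) (f : Sobolev Ω ℝ 1 2) :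
    ∃ G : Sobolev Ω ℝ 1 2, G.toLp = h.comp f.toLp ∧
      ∀ i, ‖G.weakPartial i‖ ≤ K ^ 2 * ∑ j, ‖f.weakPartial j‖ := by
  refine ⟨Sobolev.ofWeakPartial _ _ fun i => h.hasWeakPartial_comp hΩ hb f.hasWeakPartial i, rfl,
    fun i => ?_⟩
  rw [Sobolev.weakPartial_ofWeakPartial, Finset.mul_sum]
  refine norm_sum_le_of_le _ fun j _ => (norm_mulL2_le _ _ _).trans ?_
  refine (mul_le_mul_of_nonneg_left (h.norm_comp_le _) h.nonneg).trans (le_of_eq ?_)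
  ring

end

/-! ### Measurability of functions with values in separable spaces -/

/-- An injective continuous map into a second countable space from a separable complete one
detects measurability, by the Lusin–Souslin theorem. -/
lemma aestronglyMeasurable_of_continuous_injective {α X Y : Type*} [MeasurableSpace α]
    {μ : Measure α} [TopologicalSpace X] [PolishSpace X] [TopologicalSpace Y]
    [TopologicalSpace.MetrizableSpace Y] [SecondCountableTopology Y] {J : X → Y}
    (hJ : Continuous J) (hi : Function.Injective J) {f : α → X}
    (hf : AEStronglyMeasurable (fun a => J (f a)) μ) : AEStronglyMeasurable f μ := by
  borelize X Y
  have hJ' : MeasurableEmbedding J := hJ.measurableEmbedding hi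
  exact (hJ'.aemeasurable_comp_iff.1 hf.aemeasurable).aestronglyMeasurable

/-- A weakly measurable function with values in a separable Hilbert space is measurable. -/
lemma aestronglyMeasurable_of_inner {α X : Type*} [MeasurableSpace α] {μ : Measure α}
    [NormedAddCommGroup X] [InnerProductSpace ℝ X] [CompleteSpace X] [SecondCountableTopology X]
    {q : α → X} (hq : ∀ y, AEMeasurable (fun a => inner ℝ (q a) y) μ) :
    AEStronglyMeasurable q μ := by
  refine aestronglyMeasurable_of_continuous_injective
    (J := fun x (n : ℕ) => inner ℝ x (TopologicalSpace.denseSeq X n)) (by fun_prop) ?_ ?_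
  · intro x y hxy
    have hd := TopologicalSpace.denseRange_denseSeq X
    refine ext_inner_right ℝ fun z => ?_
    have h1 : Continuous fun z : X => (inner ℝ x z : ℝ) := by fun_prop
    have h2 : Continuous fun z : X => (inner ℝ y z : ℝ) := by fun_prop
    exact congrFun (hd.equalizer h1 h2 hxy) z
  · exact (aemeasurable_pi_lambda _ fun n => hq _).aestronglyMeasurable

instance {Ω : Set Plane} : SecondCountableTopology (L2 Ω) := by
  have : Fact ((2 : ℝ≥0∞) ≠ ⊤) := ⟨by simp⟩
  infer_instance

instance {Ω : Set Plane} : SecondCountableTopology (Sobolev Ω ℝ 1 2) := by infer_instance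

lemma Sobolev.aestronglyMeasurable_of_toLp {Ω : Set Plane} (hΩ : IsOpen Ω) {α : Type*}
    [MeasurableSpace α] {μ : Measure α} {f : α → Sobolev Ω ℝ 1 2}
    (hf : AEStronglyMeasurable (fun a => (f a).toLp) μ) : AEStronglyMeasurable f μ :=
  aestronglyMeasurable_of_continuous_injective (toLpCLM Ω ℝ 1 2).continuous
    (toLp_injective hΩ) hf

/-! ### The evolution operators of a vector field on `L²` -/

lemma IsSmoothBoundedDomain.isFiniteMeasure {Ω : Set Plane} (hΩ : IsSmoothBoundedDomain Ω) :
    IsFiniteMeasure (volume.restrict Ω) :=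
  ⟨by simpa using hΩ.isBounded.measure_lt_top⟩

/-- Test functions detect the zero element of `L²(Ω)`. -/
lemma L2.eq_zero_of_inner {Ω : Set Plane} (hΩ : IsOpen Ω) {f : L2 Ω}
    (h : ∀ ψ : Plane → ℝ, IsTestFunction Ω ψ → ∫ x in Ω, ψ x * f x = 0) : f = 0 := by
  rw [Lp.eq_zero_iff_ae_eq_zero]
  have hloc : LocallyIntegrable f (volume.restrict Ω) :=
    (Lp.memLp f).locallyIntegrable Fact.out
  rw [Filter.EventuallyEq, ae_restrict_iff' hΩ.measurableSet]
  refine hΩ.ae_eq_zero_of_integral_contDiff_smul_eq_zero ?_ fun φ hφ hc hs => ?_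
  · intro x hx
    obtain ⟨U, hU, hU'⟩ := hloc x
    refine ⟨U ∩ Ω, ?_, ?_⟩
    · exact Filter.inter_mem (nhdsWithin_le_nhds hU) self_mem_nhdsWithin
    · rw [IntegrableOn, ← Measure.restrict_restrict₀' hΩ.measurableSet.nullMeasurableSet]
      exact hU'
  · rw [← h φ ⟨hφ, hc, hs⟩, ← integral_mul_eq_setIntegral
      (IsTestFunction.eq_zero ⟨hφ, hc, hs⟩)]
    rfl

/-- A Lipschitz vector field tangent to the boundary of a smooth bounded domain `Ω`. -/
structure TangentField (Ω : Set Plane) (V : ℝ → Plane → Plane) (A : ℝ → ℝ) : Prop where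
  lip : LipField V A
  dom : IsSmoothBoundedDomain Ω
  tangent : ∀ t, IsTangent Ω (V t)

namespace TangentField

variable {Ω : Set Plane} {V : ℝ → Plane → Plane} {A : ℝ → ℝ}

/-- The Lipschitz constant of the flow between the times `s` and `t`. -/
def flowLip (A : ℝ → ℝ) (t s : ℝ) : ℝ := Real.exp (2 * |∫ r in s..t, A r|)

lemma flowLip_symm (A : ℝ → ℝ) (t s : ℝ) : flowLip A t s = flowLip A s t := by
  rw [flowLip, flowLip, intervalIntegral.integral_symm, abs_neg]

lemma one_le_flowLip (A : ℝ → ℝ) (t s : ℝ) : 1 ≤ flowLip A t s :=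
  Real.one_le_exp (by positivity)

lemma isBiLip (h : TangentField Ω V A) (t s : ℝ) :
    IsBiLip Ω (flowLip A t s) (h.lip.flow s t) (h.lip.flow t s) where
  one_le := one_le_flowLip A t s
  lipschitz := fun x y => by rw [flowLip_symm]; exact h.lip.norm_flow_sub_flow_le s t x y
  lipschitz_inv := h.lip.norm_flow_sub_flow_le t s
  left_inv := fun x => by rw [h.lip.flow_flow, h.lip.flow_self]
  right_inv := fun x => by rw [h.lip.flow_flow, h.lip.flow_self]
  mapsTo := fun _ hx => h.lip.flow_mem h.dom h.tangent s t hx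
  mapsTo_inv := fun _ hx => h.lip.flow_mem h.dom h.tangent t s hx

/-- The solution operator from time `s` to time `t` of the transport equation with velocity `V`:
the function `f` is composed with the flow from time `t` back to time `s`. -/
def evol (h : TangentField Ω V A) (t s : ℝ) : L2 Ω →L[ℝ] L2 Ω := (h.isBiLip t s).comp

lemma coeFn_evol (h : TangentField Ω V A) (t s : ℝ) (f : L2 Ω) :
    h.evol t s f =ᵐ[volume.restrict Ω] fun x => f (h.lip.flow s t x) := (h.isBiLip t s).coeFn_comp f

lemma norm_evol_le (h : TangentField Ω V A) (t s : ℝ) (f : L2 Ω) :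
    ‖h.evol t s f‖ ≤ flowLip A t s * ‖f‖ := (h.isBiLip t s).norm_comp_le f

lemma evol_self (h : TangentField Ω V A) (t : ℝ) (f : L2 Ω) : h.evol t t f = f := by
  refine Lp.ext ?_
  filter_upwards [h.coeFn_evol t t f] with x hx
  rw [hx, h.lip.flow_self]

lemma evol_evol (h : TangentField Ω V A) (t r s : ℝ) (f : L2 Ω) :
    h.evol t r (h.evol r s f) = h.evol t s f := by
  refine Lp.ext ?_
  filter_upwards [h.coeFn_evol t r (h.evol r s f), h.coeFn_evol t s f,
    (h.isBiLip t r).ae_comp (h.coeFn_evol r s f)] with x h1 h2 h3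
  rw [h1, h2, h3, h.lip.flow_flow]

lemma exists_evol_sobolev (h : TangentField Ω V A) (t s : ℝ) (f : Sobolev Ω ℝ 1 2) :
    ∃ G : Sobolev Ω ℝ 1 2, G.toLp = h.evol t s f.toLp ∧
      ∀ i, ‖G.weakPartial i‖ ≤ flowLip A t s ^ 2 * ∑ j, ‖f.weakPartial j‖ :=
  (h.isBiLip t s).exists_comp_sobolev h.dom.isOpen h.dom.isBounded f

lemma norm_flow_sub_flow_le (h : TangentField Ω V A) (t s t₀ s₀ : ℝ) (x : Plane) :
    ‖h.lip.flow s t x - h.lip.flow s₀ t₀ x‖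
      ≤ |∫ r in s₀..s, A r| + flowLip A s₀ t₀ * |∫ r in t..t₀, A r| := by
  have h1 := h.lip.norm_flow_sub_flow_time_le s s₀ t x
  have h2 := h.lip.norm_flow_sub_flow_le s₀ t₀ (h.lip.flow t₀ t x) x
  have h3 := h.lip.norm_flow_sub_le t₀ t x
  rw [h.lip.flow_flow] at h2
  have h4 : ‖h.lip.flow s t x - h.lip.flow s₀ t₀ x‖ ≤ ‖h.lip.flow s t x - h.lip.flow s₀ t x‖
      + ‖h.lip.flow s₀ t x - h.lip.flow s₀ t₀ x‖ := norm_sub_le_norm_sub_add_norm_sub _ _ _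
  have h5 := h2.trans (mul_le_mul_of_nonneg_left h3 (Real.exp_pos _).le)
  exact h4.trans (add_le_add h1 h5)

lemma continuous_flowLip (h : TangentField Ω V A) : Continuous fun p : ℝ × ℝ => flowLip A p.1 p.2 := by
  have h1 := continuous_primitive h.lip.integrable 0
  have h2 : (fun p : ℝ × ℝ => flowLip A p.1 p.2) = fun p : ℝ × ℝ =>
      Real.exp (2 * |(∫ r in (0 : ℝ)..p.1, A r) - ∫ r in (0 : ℝ)..p.2, A r|) := by
    funext p
    rw [flowLip, intervalIntegral.integral_interval_sub_left (h.lip.integrable _ _)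
      (h.lip.integrable _ _)]
  rw [h2]
  have h3 := h1.comp continuous_fst (X := ℝ × ℝ)
  have h4 := h1.comp continuous_snd (X := ℝ × ℝ)
  exact Real.continuous_exp.comp (continuous_const.mul (h3.sub h4).abs)

/-- The evolution operators are jointly continuous in the two times and the function. -/
theorem continuous_evol (h : TangentField Ω V A) :
    Continuous fun p : (ℝ × ℝ) × L2 Ω => h.evol p.1.1 p.1.2 p.2 := by
  have hfin := h.dom.isFiniteMeasure
  rw [continuous_iff_continuousAt]
  rintro ⟨⟨t₀, s₀⟩, f₀⟩
  rw [ContinuousAt, Metric.tendsto_nhds]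
  intro ε hε
  set K := flowLip A t₀ s₀ + 1 with hK
  have hK0 : 0 < K := by have := one_le_flowLip A t₀ s₀; linarith
  set η := ε / (4 * K) with hη
  have hη0 : 0 < η := by positivity
  obtain ⟨g, hgc, hg, hgcont, hgm⟩ := (Lp.memLp f₀).exists_hasCompactSupport_eLpNorm_sub_le
    (by simp) (ε := ENNReal.ofReal η) (by simpa using hη0)
  set G : L2 Ω := hgm.toLp with hG
  have hfG : ‖f₀ - G‖ ≤ η := by
    rw [Lp.norm_def]
    refine ENNReal.toReal_le_of_le_ofReal hη0.le (le_trans (le_of_eq (eLpNorm_congr_ae ?_)) hg)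
    filter_upwards [Lp.coeFn_sub f₀ G, hgm.coeFn_toLp] with x h1 h2
    rw [h1, Pi.sub_apply, h2, Pi.sub_apply]
  set m : ℝ := measureUnivNNReal (volume.restrict Ω) ^ ((2 : ℝ≥0∞).toReal)⁻¹ with hm
  have hm0 : 0 ≤ m := by positivity
  have huc : UniformContinuous g := hgc.uniformContinuous_of_continuous hgcont
  obtain ⟨δ, hδ, hgδ⟩ := Metric.uniformContinuous_iff.1 huc (ε / (8 * (m + 1))) (by positivity)
  have c1 : ∀ᶠ p : (ℝ × ℝ) × L2 Ω in 𝓝 ((t₀, s₀), f₀), flowLip A p.1.1 p.1.2 < K := by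
    have := (h.continuous_flowLip.comp (continuous_fst (X := ℝ × ℝ) (Y := L2 Ω))).tendsto ((t₀, s₀), f₀)
    exact this.eventually_lt_const (by simp [hK])
  have c2 : ∀ᶠ p : (ℝ × ℝ) × L2 Ω in 𝓝 ((t₀, s₀), f₀),
      |∫ r in s₀..p.1.2, A r| + flowLip A s₀ t₀ * |∫ r in p.1.1..t₀, A r| < δ := by
    have h1 := continuous_primitive h.lip.integrable s₀
    have h2 := continuous_primitive h.lip.integrable t₀
    have h3 : Continuous fun p : (ℝ × ℝ) × L2 Ω =>
        |∫ r in s₀..p.1.2, A r| + flowLip A s₀ t₀ * |∫ r in p.1.1..t₀, A r| := by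
      have e : ∀ p : (ℝ × ℝ) × L2 Ω, |∫ r in p.1.1..t₀, A r| = |∫ r in t₀..p.1.1, A r| :=
        fun p => by rw [intervalIntegral.integral_symm, abs_neg]
      simp_rw [e]
      exact ((h1.comp (continuous_snd.comp continuous_fst)).abs).add
        (continuous_const.mul ((h2.comp (continuous_fst.comp continuous_fst)).abs))
    exact (h3.tendsto ((t₀, s₀), f₀)).eventually_lt_const (by simpa using hδ)
  have c3 : ∀ᶠ p : (ℝ × ℝ) × L2 Ω in 𝓝 ((t₀, s₀), f₀), ‖p.2 - f₀‖ < η := by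
    have h3 : Continuous fun p : (ℝ × ℝ) × L2 Ω => ‖p.2 - f₀‖ := by fun_prop
    exact (h3.tendsto ((t₀, s₀), f₀)).eventually_lt_const (by simpa using hη0)
  filter_upwards [c1, c2, c3] with ⟨⟨t, s⟩, f⟩ h1 h2 h3
  simp only at h1 h2 h3 ⊢
  rw [dist_eq_norm]
  have d1 : ‖h.evol t s (f - f₀)‖ ≤ K * η := (h.norm_evol_le t s _).trans
    (mul_le_mul h1.le h3.le (norm_nonneg _) hK0.le)
  have d2 : ‖h.evol t s (f₀ - G)‖ ≤ K * η := (h.norm_evol_le t s _).trans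
    (mul_le_mul h1.le hfG (norm_nonneg _) hK0.le)
  have d3 : ‖h.evol t₀ s₀ (f₀ - G)‖ ≤ K * η := (h.norm_evol_le t₀ s₀ _).trans
    (mul_le_mul (by rw [hK]; linarith) hfG (norm_nonneg _) hK0.le)
  have d4 : ‖h.evol t s G - h.evol t₀ s₀ G‖ ≤ m * (ε / (8 * (m + 1))) := by
    refine Lp.norm_le_of_ae_bound (by positivity) ?_
    filter_upwards [Lp.coeFn_sub (h.evol t s G) (h.evol t₀ s₀ G), h.coeFn_evol t s G,
      h.coeFn_evol t₀ s₀ G, (h.isBiLip t s).ae_comp hgm.coeFn_toLp,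
      (h.isBiLip t₀ s₀).ae_comp hgm.coeFn_toLp] with x e1 e2 e3 e4 e5
    rw [e1, Pi.sub_apply, e2, e3, e4, e5, ← dist_eq_norm]
    refine (hgδ ?_).le
    rw [dist_eq_norm]
    exact (h.norm_flow_sub_flow_le t s t₀ s₀ x).trans_lt h2
  have d5 : m * (ε / (8 * (m + 1))) < ε / 4 := by
    rw [← mul_div_assoc, div_lt_div_iff₀ (by positivity) (by norm_num)]
    nlinarith
  have d6 : K * η = ε / 4 := by rw [hη]; field_simp
  have e : h.evol t s f - h.evol t₀ s₀ f₀ = h.evol t s (f - f₀) + h.evol t s (f₀ - G)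
      + (h.evol t s G - h.evol t₀ s₀ G) - h.evol t₀ s₀ (f₀ - G) := by
    simp only [map_sub]; abel
  rw [e]
  refine (norm_sub_le _ _).trans_lt ?_
  have := norm_add_le (h.evol t s (f - f₀) + h.evol t s (f₀ - G)) (h.evol t s G - h.evol t₀ s₀ G)
  have := norm_add_le (h.evol t s (f - f₀)) (h.evol t s (f₀ - G))
  linarith

/-! ### The advection term -/

lemma abs_coord_le (h : TangentField Ω V A) (r : ℝ) (i : Fin 2) (x : Plane) :
    |V r x i| ≤ A r := (PiLp.norm_apply_le (V r x) i).trans (h.lip.norm_le r x)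

lemma measurable_coord (h : TangentField Ω V A) (r : ℝ) (i : Fin 2) :
    Measurable fun x => V r x i :=
  (EuclideanSpace.proj (𝕜 := ℝ) i).measurable.comp (h.lip.continuous r).measurable

/-- Multiplication of functions by the `i`-th component of the field at time `r`. -/
def mulV (h : TangentField Ω V A) (r : ℝ) (i : Fin 2) : L2 Ω →L[ℝ] L2 Ω :=
  mulL2 Ω (h.measurable_coord r i) (h.abs_coord_le r i)

lemma coeFn_mulV (h : TangentField Ω V A) (r : ℝ) (i : Fin 2) (f : L2 Ω) :
    h.mulV r i f =ᵐ[volume.restrict Ω] fun x => V r x i * f x := coeFn_mulL2 _ _ f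

lemma norm_mulV_le (h : TangentField Ω V A) (r : ℝ) (i : Fin 2) (f : L2 Ω) :
    ‖h.mulV r i f‖ ≤ A r * ‖f‖ := norm_mulL2_le _ _ f

lemma inner_mulV (h : TangentField Ω V A) (r : ℝ) (i : Fin 2) (f g : L2 Ω) :
    (inner ℝ (h.mulV r i f) g : ℝ) = inner ℝ f (h.mulV r i g) := by
  rw [L2.inner_def, L2.inner_def]
  refine integral_congr_ae ?_
  filter_upwards [h.coeFn_mulV r i f, h.coeFn_mulV r i g] with x h1 h2
  simp only [h1, h2, RCLike.inner_apply, conj_trivial]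
  ring

lemma aestronglyMeasurable_mulV (h : TangentField Ω V A) (i : Fin 2) {μ : Measure ℝ} [SFinite μ]
    {q : ℝ → L2 Ω} (hq : AEStronglyMeasurable q μ) :
    AEStronglyMeasurable (fun r => h.mulV r i (q r)) μ := by
  have hconst : ∀ f : L2 Ω, AEStronglyMeasurable (fun r => h.mulV r i f) μ := fun f => by
    refine aestronglyMeasurable_of_inner fun g => ?_
    have e : (fun r => (inner ℝ (h.mulV r i f) g : ℝ))
        = fun r => ∫ x in Ω, V r x i * f x * g x := by
      funext r
      rw [L2.inner_def]
      refine integral_congr_ae ?_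
      filter_upwards [h.coeFn_mulV r i f] with x h1
      simp only [h1, RCLike.inner_apply, conj_trivial]
      ring
    rw [e]
    refine StronglyMeasurable.aemeasurable (StronglyMeasurable.integral_prod_right ?_)
    have h1 : Measurable fun p : ℝ × Plane => V p.1 p.2 i :=
      (EuclideanSpace.proj (𝕜 := ℝ) i).measurable.comp h.lip.measurable_uncurry
    have h2 := (Lp.stronglyMeasurable f).measurable
    have h3 := (Lp.stronglyMeasurable g).measurable
    exact ((h1.mul (h2.comp measurable_snd)).mul (h3.comp measurable_snd)).stronglyMeasurable
  refine aestronglyMeasurable_of_inner fun g => ?_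
  simp_rw [h.inner_mulV]
  exact (hq.inner (hconst g)).aemeasurable

/-- The function `V(r) · ∇f`. -/
def advect (h : TangentField Ω V A) (r : ℝ) (f : Sobolev Ω ℝ 1 2) : L2 Ω :=
  ∑ i, h.mulV r i (f.weakPartial i)

lemma coeFn_advect (h : TangentField Ω V A) (r : ℝ) (f : Sobolev Ω ℝ 1 2) :
    h.advect r f =ᵐ[volume.restrict Ω] fun x => ∑ i, V r x i * f.weakPartial i x := by
  rw [advect, Fin.sum_univ_two]
  filter_upwards [Lp.coeFn_add (h.mulV r 0 (f.weakPartial 0)) (h.mulV r 1 (f.weakPartial 1)),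
    h.coeFn_mulV r 0 (f.weakPartial 0), h.coeFn_mulV r 1 (f.weakPartial 1)] with x h1 h2 h3
  rw [h1, Pi.add_apply, h2, h3, Fin.sum_univ_two]

lemma norm_advect_le (h : TangentField Ω V A) (r : ℝ) (f : Sobolev Ω ℝ 1 2) :
    ‖h.advect r f‖ ≤ A r * ∑ i, ‖f.weakPartial i‖ := by
  rw [Finset.mul_sum]
  exact norm_sum_le_of_le _ fun i _ => h.norm_mulV_le r i _

lemma advect_sub (h : TangentField Ω V A) (r : ℝ) (f g : Sobolev Ω ℝ 1 2) :
    h.advect r (f - g) = h.advect r f - h.advect r g := by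
  rw [advect, advect, advect, ← Finset.sum_sub_distrib]
  refine Finset.sum_congr rfl fun i _ => ?_
  rw [← map_sub]
  rfl

lemma aestronglyMeasurable_advect (h : TangentField Ω V A) {μ : Measure ℝ} [SFinite μ]
    {f : ℝ → Sobolev Ω ℝ 1 2} (hf : AEStronglyMeasurable f μ) :
    AEStronglyMeasurable (fun r => h.advect r (f r)) μ := by
  refine Finset.aestronglyMeasurable_fun_sum _ fun i _ => h.aestronglyMeasurable_mulV i ?_
  exact (Sobolev.weakPartialCLM Ω ℝ 0 2 i).continuous.comp_aestronglyMeasurable hf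

end TangentField

/-! ### The evolution of `H¹` functions -/

lemma integral_mul_eq_inner {Ω : Set Plane} {ψ : Plane → ℝ} (hψ : MemLp ψ 2 (volume.restrict Ω))
    (f : L2 Ω) : ∫ x in Ω, ψ x * f x = inner ℝ hψ.toLp f := by
  rw [L2.inner_def]
  refine integral_congr_ae ?_
  filter_upwards [hψ.coeFn_toLp] with x h1
  simp only [h1, RCLike.inner_apply, conj_trivial]
  ring

namespace TangentField

variable {Ω : Set Plane} {V : ℝ → Plane → Plane} {A : ℝ → ℝ}

lemma flowLip_mono (h : TangentField Ω V A) {s r t : ℝ} (hsr : s ≤ r) (hrt : r ≤ t) :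
    flowLip A t r ≤ flowLip A t s := by
  refine Real.exp_le_exp.2 (mul_le_mul_of_nonneg_left ?_ zero_le_two)
  have h0 : ∀ {a b : ℝ}, a ≤ b → 0 ≤ ∫ τ in a..b, A τ := fun hab =>
    intervalIntegral.integral_nonneg hab fun τ _ => h.lip.nonneg τ
  have h1 := intervalIntegral.integral_add_adjacent_intervals (h.lip.integrable s r)
    (h.lip.integrable r t)
  rw [abs_of_nonneg (h0 hrt), abs_of_nonneg (h0 (hsr.trans hrt))]
  linarith [h0 hsr]

lemma aestronglyMeasurable_evol (h : TangentField Ω V A) (t : ℝ) {q : ℝ → L2 Ω} {μ : Measure ℝ}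
    (hq : AEStronglyMeasurable q μ) : AEStronglyMeasurable (fun r => h.evol t r (q r)) μ := by
  have h1 : Continuous fun r : ℝ => (t, r) := continuous_const.prodMk continuous_id
  have h2 := h1.aestronglyMeasurable (μ := μ)
  have h3 := h2.prodMk hq
  have h4 := h.continuous_evol.comp_aestronglyMeasurable h3
  exact h4

lemma intervalIntegrable_evol (h : TangentField Ω V A) (t : ℝ) {q : ℝ → L2 Ω} {a b : ℝ}
    (hq : IntervalIntegrable q volume a b) :
    IntervalIntegrable (fun r => h.evol t r (q r)) volume a b := by
  have hc : Continuous fun r => flowLip A t r :=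
    h.continuous_flowLip.comp (continuous_const.prodMk continuous_id)
  have h1 : IntervalIntegrable (fun r => flowLip A t r * ‖q r‖) volume a b :=
    hq.norm.continuousOn_mul hc.continuousOn
  exact h1.mono_fun' (h.aestronglyMeasurable_evol t hq.aestronglyMeasurable_restrict_uIoc)
    (ae_of_all _ fun r => h.norm_evol_le t r _)

lemma intervalIntegrable_advect (h : TangentField Ω V A) {f : ℝ → Sobolev Ω ℝ 1 2} {M a b : ℝ}
    (hf : AEStronglyMeasurable f (volume.restrict (uIoc a b)))
    (hM : ∀ r ∈ uIoc a b, ∑ i, ‖(f r).weakPartial i‖ ≤ M) :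
    IntervalIntegrable (fun r => h.advect r (f r)) volume a b := by
  refine ((h.lip.integrable a b).mul_const M).mono_fun' (h.aestronglyMeasurable_advect hf) ?_
  filter_upwards [ae_restrict_mem measurableSet_uIoc] with r hr
  exact (h.norm_advect_le r _).trans (mul_le_mul_of_nonneg_left (hM r hr) (h.lip.nonneg r))

/-- The formula of `evol_sub_self` for smooth functions, tested against `ψ`. -/
lemma integral_mul_flow_sub (h : TangentField Ω V A) {s t : ℝ} (hst : s ≤ t) {G : Plane → ℝ}
    (hG : ContDiff ℝ ∞ G) (hGc : HasCompactSupport G) {ψ : Plane → ℝ} (hψ : IsTestFunction Ω ψ) :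
    IntervalIntegrable (fun r => ∫ x in Ω, ψ x *
        fderiv ℝ G (h.lip.flow r t x) (V r (h.lip.flow r t x))) volume s t ∧
      ∫ x in Ω, ψ x * (G (h.lip.flow s t x) - G x) = -∫ r in s..t, ∫ x in Ω, ψ x *
        fderiv ℝ G (h.lip.flow r t x) (V r (h.lip.flow r t x)) := by
  have hdc : Continuous (fderiv ℝ G) := hG.continuous_fderiv (by simp)
  obtain ⟨C, hC⟩ := hdc.bounded_above_of_compact_support (hGc.fderiv ℝ)
  have hX : Continuous fun p : Plane × ℝ => h.lip.flow p.2 t p.1 :=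
    (h.lip.continuous_flow_uncurry t).comp continuous_swap
  have hVm : Measurable fun p : Plane × ℝ => V p.2 (h.lip.flow p.2 t p.1) :=
    h.lip.measurable_uncurry.comp (measurable_snd.prodMk hX.measurable)
  have hm : Measurable fun p : Plane × ℝ => ψ p.1 *
      fderiv ℝ G (h.lip.flow p.2 t p.1) (V p.2 (h.lip.flow p.2 t p.1)) := by
    have h1 : Continuous fun q : (Plane →L[ℝ] ℝ) × Plane => q.1 q.2 := by fun_prop
    refine (hψ.contDiff.continuous.measurable.comp measurable_fst).mul ?_
    exact h1.measurable.comp ((hdc.comp hX).measurable.prodMk hVm)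
  have hint : Integrable (Function.uncurry fun (x : Plane) (r : ℝ) => ψ x *
      fderiv ℝ G (h.lip.flow r t x) (V r (h.lip.flow r t x)))
      ((volume.restrict Ω).prod (volume.restrict (Ioc s t))) := by
    have i1 : Integrable (fun x => ‖ψ x‖) (volume.restrict Ω) :=
      (memLp_one_iff_integrable.1 (hψ.memLp 1 _)).norm
    have i2 : Integrable (fun r => C * A r) (volume.restrict (Ioc s t)) :=
      ((h.lip.integrable s t).1).const_mul C
    refine (i1.mul_prod i2).mono' hm.aestronglyMeasurable (ae_of_all _ fun p => ?_)
    rw [Function.uncurry, norm_mul]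
    refine mul_le_mul_of_nonneg_left ?_ (norm_nonneg _)
    exact (ContinuousLinearMap.le_opNorm _ _).trans (mul_le_mul (hC _) (h.lip.norm_le _ _)
      (norm_nonneg _) ((norm_nonneg _).trans (hC 0)))
  constructor
  · rw [intervalIntegrable_iff_integrableOn_Ioc_of_le hst]
    exact hint.integral_prod_right
  · rw [intervalIntegral.integral_of_le hst, ← integral_integral_swap hint, ← integral_neg]
    refine integral_congr_ae (ae_of_all _ fun x => ?_)
    have e := h.lip.comp_flow_sub (hG.of_le (by simp)) t t s x
    rw [h.lip.flow_self] at e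
    simp only
    rw [e, intervalIntegral.integral_symm, intervalIntegral.integral_of_le hst, mul_neg,
      integral_const_mul]

set_option maxHeartbeats 1000000 in
/-- Along the evolution, `∂ₛ E(t,s) f = E(t,s) (V(s) · ∇f)`, in integrated form. -/
theorem evol_sub_self (h : TangentField Ω V A) {s t : ℝ} (hst : s ≤ t) (f : Sobolev Ω ℝ 1 2) :
    h.evol t s f.toLp - f.toLp = -∫ r in s..t, h.evol t r (h.advect r f) := by
  have hint := h.intervalIntegrable_evol t (h.intervalIntegrable_advect (f := fun _ => f)
    (a := s) (b := t) aestronglyMeasurable_const fun _ _ => le_rfl)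
  rw [← sub_eq_zero, sub_neg_eq_add]
  refine L2.eq_zero_of_inner h.dom.isOpen fun ψ hψ => ?_
  have hψL := hψ.memLp 2 (volume.restrict Ω)
  have hiI := (innerSL ℝ hψL.toLp).intervalIntegral_comp_comm hint
  simp only [innerSL_apply_apply] at hiI
  have hiint : IntervalIntegrable (fun r => (inner ℝ hψL.toLp (h.evol t r (h.advect r f)) : ℝ))
      volume s t := ⟨hint.1.const_inner _, hint.2.const_inner _⟩
  rw [integral_mul_eq_inner hψL, inner_add_right, ← hiI, inner_sub_right, ← integral_mul_eq_inner,
    ← integral_mul_eq_inner]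
  -- the formula for smooth approximations of `f`
  obtain ⟨G, hG, hG0, hG1⟩ := exists_smooth_approx h.dom.isOpen h.dom.isBounded f.hasWeakPartial
  have hGL : ∀ n, MemLp (G n) 2 (volume.restrict Ω) := fun n =>
    (hG n).1.continuous.memLp_of_hasCompactSupport (hG n).2
  have hb := h.isBiLip t s
  have lim1 : Filter.Tendsto (fun n => ∫ x in Ω, ψ x * G n (h.lip.flow s t x)) Filter.atTop
      (𝓝 (∫ x in Ω, ψ x * f.toLp (h.lip.flow s t x))) := by
    refine tendsto_integral_mul hψL (hb.memLp_comp f.toLp) (fun n => ?_) ?_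
    · refine ⟨((hG n).1.continuous.comp hb.continuous).aestronglyMeasurable,
        (hb.eLpNorm_comp_le hb.mapsTo (hGL n).1).trans_lt
          (ENNReal.mul_lt_top ENNReal.ofReal_lt_top (hGL n).2)⟩
    · have hlim := ENNReal.Tendsto.const_mul hG0
        (Or.inr (ENNReal.ofReal_ne_top (r := flowLip A t s)))
      rw [mul_zero] at hlim
      refine tendsto_of_tendsto_of_tendsto_of_le_of_le tendsto_const_nhds hlim (fun _ => zero_le) fun n => ?_
      exact hb.eLpNorm_comp_le (f := fun x => G n x - f.toLp x) hb.mapsTo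
        ((hGL n).1.sub (Lp.aestronglyMeasurable f.toLp))
  have lim2 := tendsto_integral_mul hψL (Lp.memLp f.toLp) hGL hG0
  -- on the support of `ψ` the trajectories stay in a compact subset of `Ω`
  set S := tsupport ψ with hS
  have hSc : IsCompact S := hψ.hasCompactSupport.isCompact
  set S' := (fun p : ℝ × Plane => h.lip.flow p.1 t p.2) '' (Icc s t ×ˢ S) with hS'
  have hS'c : IsCompact S' := (isCompact_Icc.prod hSc).image (h.lip.continuous_flow_uncurry t)
  have hS'Ω : S' ⊆ Ω := by
    rintro _ ⟨⟨r, x⟩, ⟨-, hx⟩, rfl⟩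
    exact h.lip.flow_mem h.dom h.tangent r t (hψ.tsupport_subset hx)
  have hfin : IsFiniteMeasure (volume.restrict S') := ⟨by simpa using hS'c.measure_lt_top⟩
  obtain ⟨B, hB⟩ := hψ.contDiff.continuous.bounded_above_of_compact_support hψ.hasCompactSupport
  have hB0 : 0 ≤ B := (norm_nonneg _).trans (hB 0)
  set d : ℕ → Fin 2 → Plane → ℝ := fun n j x => partialDeriv j (G n) x - f.weakPartial j x with hd
  have hdm : ∀ n j, AEStronglyMeasurable (d n j) (volume.restrict Ω) := fun n j =>
    (contDiff_partialDeriv (hG n).1 j).continuous.aestronglyMeasurable.sub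
      (Lp.aestronglyMeasurable _)
  have hdL : ∀ n j, MemLp (d n j) 2 (volume.restrict Ω) := fun n j =>
    ((contDiff_partialDeriv (hG n).1 j).continuous.memLp_of_hasCompactSupport
      (hasCompactSupport_partialDeriv (hG n).2 j)).sub (Lp.memLp _)
  set e : ℕ → Fin 2 → ℝ := fun n j => ∫ x in S', ‖d n j x‖ with he
  have hfinΩ := h.dom.isFiniteMeasure
  have hd1 : ∀ n j, Integrable (d n j) (volume.restrict Ω) := fun n j =>
    (hdL n j).integrable (by norm_num)
  have he0 : ∀ j, Filter.Tendsto (fun n => e n j) Filter.atTop (𝓝 0) := by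
    intro j
    have h1 : Filter.Tendsto (fun n => eLpNorm (d n j) 1 (volume.restrict S')) Filter.atTop
        (𝓝 0) := by
      have h2 := ENNReal.Tendsto.mul_const (hG1 S' hS'c hS'Ω j) (b := (volume.restrict S') univ ^
        (1 / (1 : ℝ≥0∞).toReal - 1 / (2 : ℝ≥0∞).toReal)) (Or.inr (by
          refine ENNReal.rpow_ne_top_of_nonneg (by norm_num) (measure_ne_top _ _)))
      rw [zero_mul] at h2
      refine tendsto_of_tendsto_of_tendsto_of_le_of_le tendsto_const_nhds h2 (fun _ => zero_le)
        fun n => ?_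
      exact eLpNorm_le_eLpNorm_mul_rpow_measure_univ (by norm_num)
        ((hdm n j).mono_measure (Measure.restrict_mono hS'Ω le_rfl))
    have h2 := (ENNReal.tendsto_toReal ENNReal.zero_ne_top).comp h1
    rw [ENNReal.toReal_zero] at h2
    refine h2.congr fun n => ?_
    change _ = ∫ x in S', ‖d n j x‖
    rw [Function.comp_apply, eLpNorm_one_eq_lintegral_enorm,
      integral_norm_eq_lintegral_enorm ((hdm n j).mono_measure (Measure.restrict_mono hS'Ω le_rfl))]
  set K := flowLip A t s with hK
  have hflow : ∀ r ∈ Icc s t, ∀ n,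
      ‖(∫ x in Ω, ψ x * fderiv ℝ (G n) (h.lip.flow r t x) (V r (h.lip.flow r t x)))
        - inner ℝ hψL.toLp (h.evol t r (h.advect r f))‖ ≤ A r * (B * K ^ 2 * ∑ j, e n j) := by
    intro r hr n
    have hbr := h.isBiLip t r
    have hdr : ∀ j, ∫ x in Ω, S'.indicator (fun y => ‖d n j y‖) (h.lip.flow r t x)
        ≤ K ^ 2 * e n j := by
      intro j
      have i0 : Integrable (S'.indicator fun y => ‖d n j y‖) (volume.restrict Ω) :=
        (hd1 n j).norm.indicator hS'c.measurableSet
      refine (hbr.integral_comp_le i0 fun x =>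
        indicator_nonneg (fun _ _ => norm_nonneg _) x).trans ?_
      rw [setIntegral_indicator hS'c.measurableSet, inter_eq_right.2 hS'Ω]
      refine mul_le_mul_of_nonneg_right ?_ (integral_nonneg fun _ => norm_nonneg _)
      have := h.flowLip_mono hr.1 hr.2
      have := one_le_flowLip A t r
      gcongr
    have hir : ∀ j, Integrable (fun x => S'.indicator (fun y => ‖d n j y‖) (h.lip.flow r t x))
        (volume.restrict Ω) := fun j =>
      hbr.integrable_comp ((hd1 n j).norm.indicator hS'c.measurableSet)
    have e1 : (∫ x in Ω, ψ x * fderiv ℝ (G n) (h.lip.flow r t x) (V r (h.lip.flow r t x)))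
        - inner ℝ hψL.toLp (h.evol t r (h.advect r f))
        = ∫ x in Ω, ψ x * ∑ j, V r (h.lip.flow r t x) j * d n j (h.lip.flow r t x) := by
      rw [← integral_mul_eq_inner, ← integral_sub]
      · refine integral_congr_ae ?_
        filter_upwards [h.coeFn_evol t r (h.advect r f),
          hbr.ae_comp (h.coeFn_advect r f)] with x h1 h2
        rw [h1, h2, map_eq_sum_coord, ← mul_sub, ← Finset.sum_sub_distrib]
        congr 1
        refine Finset.sum_congr rfl fun j _ => ?_
        simp only [hd, smul_eq_mul, partialDeriv, mul_sub]
      · have i1 : Integrable ψ (volume.restrict Ω) := memLp_one_iff_integrable.1 (hψ.memLp 1 _)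
        have hdc : Continuous (fderiv ℝ (G n)) := (hG n).1.continuous_fderiv (by simp)
        obtain ⟨C, hC⟩ := hdc.bounded_above_of_compact_support ((hG n).2.fderiv ℝ)
        refine i1.mul_bdd (c := C * A r) ?_ (ae_of_all _ fun x => ?_)
        · exact ((hdc.comp hbr.continuous).clm_apply
            ((h.lip.continuous r).comp hbr.continuous)).aestronglyMeasurable
        · exact (ContinuousLinearMap.le_opNorm _ _).trans (mul_le_mul (hC _) (h.lip.norm_le _ _)
            (norm_nonneg _) ((norm_nonneg _).trans (hC 0)))
      · exact MemLp.integrable_mul hψL (Lp.memLp _)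
    rw [e1]
    have e2 : ∀ x, ‖ψ x * ∑ j, V r (h.lip.flow r t x) j * d n j (h.lip.flow r t x)‖
        ≤ ∑ j, B * A r * S'.indicator (fun y => ‖d n j y‖) (h.lip.flow r t x) := by
      intro x
      rw [norm_mul, ← Finset.mul_sum, mul_assoc]
      by_cases hx : x ∈ S
      · have hx' : h.lip.flow r t x ∈ S' := ⟨(r, x), ⟨hr, hx⟩, rfl⟩
        simp_rw [indicator_of_mem hx']
        refine mul_le_mul (hB x) ?_ (norm_nonneg _) hB0
        rw [Finset.mul_sum]
        refine norm_sum_le_of_le _ fun j _ => ?_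
        rw [norm_mul]
        exact mul_le_mul_of_nonneg_right (h.abs_coord_le r j _) (norm_nonneg _)
      · rw [image_eq_zero_of_notMem_tsupport hx, norm_zero, zero_mul]
        refine mul_nonneg hB0 (mul_nonneg (h.lip.nonneg r) (Finset.sum_nonneg fun j _ => ?_))
        exact indicator_nonneg (fun _ _ => norm_nonneg _) _
    refine (norm_integral_le_of_norm_le (integrable_finsetSum _ fun j _ => (hir j).const_mul _)
      (ae_of_all _ e2)).trans ?_
    rw [integral_finsetSum _ fun j _ => (hir j).const_mul _]
    simp_rw [integral_const_mul]
    rw [← Finset.mul_sum]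
    have h3 : ∑ j, ∫ x in Ω, S'.indicator (fun y => ‖d n j y‖) (h.lip.flow r t x)
        ≤ K ^ 2 * ∑ j, e n j := by
      rw [Finset.mul_sum]
      exact Finset.sum_le_sum fun j _ => hdr j
    refine (mul_le_mul_of_nonneg_left h3 (mul_nonneg hB0 (h.lip.nonneg r))).trans (le_of_eq ?_)
    ring
  have lim3 : Filter.Tendsto (fun n => ∫ r in s..t, ∫ x in Ω, ψ x *
      fderiv ℝ (G n) (h.lip.flow r t x) (V r (h.lip.flow r t x))) Filter.atTop
      (𝓝 (∫ r in s..t, (inner ℝ hψL.toLp (h.evol t r (h.advect r f)) : ℝ))) := by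
    rw [tendsto_iff_norm_sub_tendsto_zero]
    have hz : Filter.Tendsto (fun n => (∫ r in s..t, A r) * (B * K ^ 2 * ∑ j, e n j))
        Filter.atTop (𝓝 0) := by
      have := ((tendsto_finsetSum Finset.univ fun j _ => he0 j).const_mul (B * K ^ 2)).const_mul
        (∫ r in s..t, A r)
      simpa using this
    refine squeeze_zero (fun _ => norm_nonneg _) (fun n => ?_) hz
    rw [← intervalIntegral.integral_sub (h.integral_mul_flow_sub hst (hG n).1 (hG n).2 hψ).1 hiint,
      ← intervalIntegral.integral_mul_const]
    refine intervalIntegral.norm_integral_le_of_norm_le hst (ae_of_all _ fun r hr =>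
      hflow r (Ioc_subset_Icc_self hr) n) ((h.lip.integrable s t).mul_const _)
  have lim4 : Filter.Tendsto (fun n => ∫ x in Ω, ψ x * (G n (h.lip.flow s t x) - G n x))
      Filter.atTop (𝓝 ((∫ x in Ω, ψ x * f.toLp (h.lip.flow s t x)) - ∫ x in Ω, ψ x * f.toLp x)) := by
    refine (lim1.sub lim2).congr fun n => ?_
    rw [← integral_sub]
    · simp_rw [mul_sub]
    · have hGX : MemLp (fun x => G n (h.lip.flow s t x)) 2 (volume.restrict Ω) :=
        ⟨((hG n).1.continuous.comp hb.continuous).aestronglyMeasurable,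
        (hb.eLpNorm_comp_le hb.mapsTo (hGL n).1).trans_lt
          (ENNReal.mul_lt_top ENNReal.ofReal_lt_top (hGL n).2)⟩
      exact MemLp.integrable_mul hψL hGX
    · exact MemLp.integrable_mul hψL (hGL n)
  have hfinal := tendsto_nhds_unique (lim4.congr fun n =>
    (h.integral_mul_flow_sub hst (hG n).1 (hG n).2 hψ).2) lim3.neg
  have e5 : ∫ x in Ω, ψ x * h.evol t s f.toLp x = ∫ x in Ω, ψ x * f.toLp (h.lip.flow s t x) := by
    refine integral_congr_ae ?_
    filter_upwards [h.coeFn_evol t s f.toLp] with x hx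
    rw [hx]
  rw [e5]
  linarith

end TangentField

/-! ### The norm of `H¹` and integration by parts in the advection term -/

/-- The `H¹` norm is bounded by the sum of the `L²` norms of the function and its derivatives. -/
lemma Sobolev.norm_le_add {Ω : Set Plane} (f : Sobolev Ω ℝ 1 2) :
    ‖f‖ ≤ ‖f.toLp‖ + ∑ i, ‖f.weakPartial i‖ := by
  have h1 : ‖f‖ = Real.sqrt (∑ α, ‖f.1 α‖ ^ 2) := PiLp.norm_eq_of_L2 f.1
  have h2 : ∑ α, ‖f.1 α‖ ≤ ‖f.toLp‖ + ∑ i, ‖f.weakPartial i‖ := by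
    have hsub : (Finset.univ : Finset (MultiIndex 1))
        ⊆ {MultiIndex.zero 1, MultiIndex.unit 0, MultiIndex.unit 1} := fun α _ => by
      rcases multiIndex_one_cases α with h | ⟨i, h⟩
      · simp [h]
      · fin_cases i <;> simp [h]
    refine (Finset.sum_le_sum_of_subset_of_nonneg hsub fun _ _ _ => norm_nonneg _).trans ?_
    rw [Finset.sum_insert (by decide), Finset.sum_insert (by decide), Finset.sum_singleton,
      Fin.sum_univ_two]
    exact le_rfl
  rw [h1]
  refine (Real.sqrt_le_sqrt (Finset.sum_sq_le_sq_sum_of_nonneg fun _ _ => norm_nonneg _)).trans ?_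
  rw [Real.sqrt_sq (Finset.sum_nonneg fun _ _ => norm_nonneg _)]
  exact h2

lemma Sobolev.gradNorm_le {Ω : Set Plane} (f : Sobolev Ω ℝ 1 2) :
    f.gradNorm ≤ ∑ i, ‖f.weakPartial i‖ := by
  rw [Sobolev.gradNorm]
  refine (Real.sqrt_le_sqrt (Finset.sum_sq_le_sq_sum_of_nonneg fun _ _ => norm_nonneg _)).trans ?_
  rw [Real.sqrt_sq (Finset.sum_nonneg fun _ _ => norm_nonneg _)]

namespace TangentField

variable {Ω : Set Plane} {V : ℝ → Plane → Plane} {A : ℝ → ℝ}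

/-- Integration by parts in the advection term, for smooth functions. -/
lemma abs_integral_mul_partialDeriv_le (h : TangentField Ω V A) (r : ℝ) (j : Fin 2) {ψ : Plane → ℝ}
    (hψ : IsTestFunction Ω ψ) {G : Plane → ℝ} (hG : ContDiff ℝ ∞ G) (hGc : HasCompactSupport G) :
    |∫ x in Ω, ψ x * V r x j * partialDeriv j G x|
      ≤ A r * ∫ x in Ω, (‖ψ x‖ + ‖partialDeriv j ψ x‖) * ‖G x‖ := by
  set w : Plane → ℝ := fun x => V r x j with hw
  have hwL : LipschitzWith ⟨A r, h.lip.nonneg r⟩ w := LipschitzWith.of_dist_le_mul fun x y => by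
    rw [dist_eq_norm, dist_eq_norm]
    exact (PiLp.norm_apply_le (V r x - V r y) j).trans (h.lip.lipschitz r x y)
  have hb : ∀ x, ‖fderiv ℝ w x (EuclideanSpace.single j 1)‖ ≤ A r := fun x => by
    refine (ContinuousLinearMap.le_opNorm _ _).trans ?_
    have e : ‖(EuclideanSpace.single j 1 : Plane)‖ = 1 := by simp
    rw [e, mul_one]
    exact norm_fderiv_le_of_lipschitz ℝ hwL
  have hψG : ContDiff ℝ ∞ fun x => ψ x * G x := hψ.contDiff.mul hG
  have e1 : ∀ x, partialDeriv j (fun x => ψ x * G x) x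
      = ψ x * partialDeriv j G x + G x * partialDeriv j ψ x := fun x => by
    rw [partialDeriv, fderiv_fun_mul (hψ.contDiff.differentiable (by simp) x)
      (hG.differentiable (by simp) x)]
    rfl
  have ibp := integral_partialDeriv_mul_eq hwL hψG (hGc.mul_left (f := ψ)) j
  have hψ' := hψ.partialDeriv j
  have cψ := hψ.contDiff.continuous
  have cG := hG.continuous
  have cψ' := hψ'.contDiff.continuous
  have cG' := (contDiff_partialDeriv hG j).continuous
  have i1 : Integrable fun x => (ψ x * partialDeriv j G x) * w x :=
    ((cψ.mul cG').mul hwL.continuous).integrable_of_hasCompactSupport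
      ((hψ.hasCompactSupport.mul_right).mul_right)
  have i2 : Integrable fun x => (G x * partialDeriv j ψ x) * w x :=
    ((cG.mul cψ').mul hwL.continuous).integrable_of_hasCompactSupport
      ((hGc.mul_right).mul_right)
  simp_rw [e1, add_mul] at ibp
  rw [integral_add i1 i2] at ibp
  have e2 : ∫ x in Ω, ψ x * V r x j * partialDeriv j G x = ∫ x, (ψ x * partialDeriv j G x) * w x := by
    rw [integral_mul_eq_setIntegral (Ω := Ω) (φ := fun x => ψ x * partialDeriv j G x) fun x hx => by
      rw [hψ.eq_zero x hx, zero_mul]]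
    exact integral_congr_ae (ae_of_all _ fun x => by simp only [hw]; ring)
  have e3 : A r * ∫ x in Ω, (‖ψ x‖ + ‖partialDeriv j ψ x‖) * ‖G x‖
      = ∫ x, A r * ((‖ψ x‖ + ‖partialDeriv j ψ x‖) * ‖G x‖) := by
    rw [integral_const_mul, integral_mul_eq_setIntegral (Ω := Ω) fun x hx => by
      rw [hψ.eq_zero x hx, hψ'.eq_zero x hx, norm_zero, add_zero]]
  have i3 : Integrable fun x => A r * ((‖ψ x‖ + ‖partialDeriv j ψ x‖) * ‖G x‖) :=
    (((cψ.norm.add cψ'.norm).mul cG.norm).integrable_of_hasCompactSupport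
      (hGc.norm.mul_left)).const_mul _
  have i4 : Integrable fun x => ψ x * G x * fderiv ℝ w x (EuclideanSpace.single j 1) := by
    have := (cψ.mul cG).integrable_of_hasCompactSupport (μ := volume) hψ.hasCompactSupport.mul_right
    refine this.mul_bdd (c := A r) (measurable_fderiv_apply_const ℝ w _).aestronglyMeasurable
      (ae_of_all _ hb)
  have e4 : ∫ x, (ψ x * partialDeriv j G x) * w x = -∫ x, (ψ x * G x *
      fderiv ℝ w x (EuclideanSpace.single j 1) + (G x * partialDeriv j ψ x) * w x) := by
    rw [integral_add i4 i2]
    linarith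
  rw [e2, e3, e4, abs_neg]
  refine norm_integral_le_of_norm_le (G := ℝ) i3 (ae_of_all _ fun x => ?_)
  have b1 := hb x
  have b2 : ‖w x‖ ≤ A r := h.abs_coord_le r j x
  refine (norm_add_le _ _).trans ?_
  rw [norm_mul, norm_mul, norm_mul, norm_mul]
  have b3 := mul_le_mul_of_nonneg_left b1 (mul_nonneg (norm_nonneg (ψ x)) (norm_nonneg (G x)))
  have b4 := mul_le_mul_of_nonneg_left b2
    (mul_nonneg (norm_nonneg (G x)) (norm_nonneg (partialDeriv j ψ x)))
  linarith

/-- The advection term is controlled, in the sense of distributions, by the `L²` norm of the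
function. -/
theorem exists_abs_inner_advect_le (h : TangentField Ω V A) {ψ : Plane → ℝ}
    (hψ : IsTestFunction Ω ψ) : ∃ C ≥ 0, ∀ (r : ℝ) (f : Sobolev Ω ℝ 1 2),
      |∫ x in Ω, ψ x * h.advect r f x| ≤ C * A r * ‖f.toLp‖ := by
  have hm : ∀ j, MemLp (fun x => ‖ψ x‖ + ‖partialDeriv j ψ x‖) 2 (volume.restrict Ω) := fun j =>
    (hψ.memLp 2 _).norm.add ((hψ.partialDeriv j).memLp 2 _).norm
  refine ⟨∑ j, ‖(hm j).toLp‖, Finset.sum_nonneg fun _ _ => norm_nonneg _, fun r f => ?_⟩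
  obtain ⟨G, hG, hG0, hG1⟩ := exists_smooth_approx h.dom.isOpen h.dom.isBounded f.hasWeakPartial
  have hGL : ∀ n, MemLp (G n) 2 (volume.restrict Ω) := fun n =>
    (hG n).1.continuous.memLp_of_hasCompactSupport (hG n).2
  set S := tsupport ψ with hS
  have hSc : IsCompact S := hψ.hasCompactSupport.isCompact
  have hψV : ∀ j (μ : Measure Plane) [IsFiniteMeasureOnCompacts μ],
      MemLp (fun x => ψ x * V r x j) 2 μ := fun j μ _ => by
    refine MemLp.of_le_mul (c := A r) (hψ.memLp 2 μ) (hψ.contDiff.continuous.aestronglyMeasurable.mul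
      (h.measurable_coord r j).aestronglyMeasurable) (ae_of_all _ fun x => ?_)
    rw [norm_mul, mul_comm]
    exact mul_le_mul_of_nonneg_right (h.abs_coord_le r j x) (norm_nonneg _)
  have hS2 : ∀ (j : Fin 2) (w : Plane → ℝ), ∫ x in S, (ψ x * V r x j) * w x
      = ∫ x in Ω, (ψ x * V r x j) * w x := fun j w => by
    rw [← integral_mul_eq_setIntegral (Ω := S) (φ := fun x => ψ x * V r x j) fun x hx => by
        rw [image_eq_zero_of_notMem_tsupport hx, zero_mul],
      ← integral_mul_eq_setIntegral (Ω := Ω) (φ := fun x => ψ x * V r x j) fun x hx => by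
        rw [hψ.eq_zero x hx, zero_mul]]
  have key : ∀ j, |∫ x in Ω, (ψ x * V r x j) * f.weakPartial j x|
      ≤ ‖(hm j).toLp‖ * A r * ‖f.toLp‖ := by
    intro j
    have l1 : Filter.Tendsto (fun n => ∫ x in Ω, (ψ x * V r x j) * partialDeriv j (G n) x)
        Filter.atTop (𝓝 (∫ x in Ω, (ψ x * V r x j) * f.weakPartial j x)) := by
      rw [← hS2]
      simp_rw [← hS2]
      refine tendsto_integral_mul (hψV j _) ?_ (fun n => ?_) (hG1 S hSc hψ.tsupport_subset j)
      · exact (Lp.memLp (f.weakPartial j)).mono_measure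
          (Measure.restrict_mono hψ.tsupport_subset le_rfl)
      · exact (contDiff_partialDeriv (hG n).1 j).continuous.memLp_of_hasCompactSupport
          (hasCompactSupport_partialDeriv (hG n).2 j)
    have l2 : Filter.Tendsto (fun n => ‖(hm j).toLp‖ * A r * ‖(hGL n).toLp‖) Filter.atTop
        (𝓝 (‖(hm j).toLp‖ * A r * ‖f.toLp‖)) := by
      have h1 : Filter.Tendsto (fun n => (hGL n).toLp) Filter.atTop
          (𝓝 (Lp.memLp f.toLp).toLp) :=
        (Lp.tendsto_Lp_iff_tendsto_eLpNorm'' _ hGL _ (Lp.memLp f.toLp)).2 hG0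
      rw [Lp.toLp_coeFn] at h1
      exact h1.norm.const_mul _
    refine le_of_tendsto_of_tendsto l1.abs l2 (Filter.Eventually.of_forall fun n => ?_)
    refine (h.abs_integral_mul_partialDeriv_le r j hψ (hG n).1 (hG n).2).trans ?_
    simp only
    rw [mul_comm ‖(hm j).toLp‖, mul_assoc]
    refine mul_le_mul_of_nonneg_left ?_ (h.lip.nonneg r)
    have e1 : ∫ x in Ω, (‖ψ x‖ + ‖partialDeriv j ψ x‖) * ‖G n x‖
        = inner ℝ (hm j).toLp (hGL n).norm.toLp := by
      rw [← integral_mul_eq_inner]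
      refine integral_congr_ae ?_
      filter_upwards [(hGL n).norm.coeFn_toLp] with x hx
      rw [hx]
    rw [e1]
    refine (real_inner_le_norm _ _).trans (le_of_eq ?_)
    congr 1
    rw [Lp.norm_toLp, Lp.norm_toLp, eLpNorm_norm]
  have e : ∫ x in Ω, ψ x * h.advect r f x = ∑ j, ∫ x in Ω, (ψ x * V r x j) * f.weakPartial j x := by
    have hint : ∀ j, Integrable (fun x => (ψ x * V r x j) * f.weakPartial j x)
        (volume.restrict Ω) := fun j => MemLp.integrable_mul (hψV j _) (Lp.memLp _)
    rw [← integral_finsetSum _ fun j _ => hint j]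
    refine integral_congr_ae ?_
    filter_upwards [h.coeFn_advect r f] with x hx
    rw [hx, Finset.mul_sum]
    exact Finset.sum_congr rfl fun j _ => (mul_assoc _ _ _).symm
  rw [e, Finset.sum_mul, Finset.sum_mul]
  exact (Finset.abs_sum_le_sum_abs _ _).trans (Finset.sum_le_sum fun j _ => key j)

end TangentField

/-! ### The solution given by Duhamel's formula -/

lemma intervalIntegrable_clm {E F : Type*} [NormedAddCommGroup E] [NormedSpace ℝ E]
    [NormedAddCommGroup F] [NormedSpace ℝ F] (L : E →L[ℝ] F) {q : ℝ → E} {a b : ℝ}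
    (hq : IntervalIntegrable q volume a b) : IntervalIntegrable (fun r => L (q r)) volume a b :=
  ⟨L.integrable_comp hq.1, L.integrable_comp hq.2⟩

namespace TangentField

variable {Ω : Set Plane} {V : ℝ → Plane → Plane} {A : ℝ → ℝ}

/-- The solution of `θ_t + V · ∇θ = -g`, `θ(0) = f`, given by Duhamel's formula. -/
def duhamel (h : TangentField Ω V A) (f : L2 Ω) (g : ℝ → L2 Ω) (t : ℝ) : L2 Ω :=
  h.evol t 0 (f - ∫ s in (0 : ℝ)..t, h.evol 0 s (g s))

variable {g : ℝ → L2 Ω}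

lemma duhamel_zero (h : TangentField Ω V A) (f : L2 Ω) : h.duhamel f g 0 = f := by
  rw [duhamel, intervalIntegral.integral_same, sub_zero, h.evol_self]

lemma continuous_duhamel (h : TangentField Ω V A) (hg : ∀ a b, IntervalIntegrable g volume a b)
    (f : L2 Ω) : Continuous (h.duhamel f g) := by
  have h1 : Continuous fun t => ∫ s in (0 : ℝ)..t, h.evol 0 s (g s) :=
    intervalIntegral.continuous_primitive (fun a b => h.intervalIntegrable_evol 0 (hg a b)) 0
  have h2 : Continuous fun t : ℝ => (((t, (0 : ℝ)), f - ∫ s in (0 : ℝ)..t, h.evol 0 s (g s)) :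
      (ℝ × ℝ) × L2 Ω) :=
    (continuous_id.prodMk continuous_const).prodMk (continuous_const.sub h1)
  have h3 := h.continuous_evol.comp h2
  exact h3

lemma duhamel_eq (h : TangentField Ω V A) (hg : ∀ a b, IntervalIntegrable g volume a b)
    (f : L2 Ω) (s t : ℝ) :
    h.duhamel f g t = h.evol t s (h.duhamel f g s) - ∫ r in s..t, h.evol t r (g r) := by
  have hi := fun a b => h.intervalIntegrable_evol 0 (hg a b)
  rw [duhamel, duhamel, h.evol_evol, ← intervalIntegral.integral_add_adjacent_intervals (hi 0 s)
    (hi s t), ← sub_sub, map_sub, ← (h.evol t 0).intervalIntegral_comp_comm (hi s t)]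
  simp only [h.evol_evol]

/-- The solution has values in `H¹`, with a bound for its gradient. -/
theorem exists_duhamel_sobolev (h : TangentField Ω V A) {g : ℝ → Sobolev Ω ℝ 1 2}
    (hg : ∀ a b, IntervalIntegrable g volume a b) (f : Sobolev Ω ℝ 1 2) {t : ℝ} (ht : 0 ≤ t) :
    ∃ Θ : Sobolev Ω ℝ 1 2, Θ.toLp = h.duhamel f.toLp (fun s => (g s).toLp) t ∧
      ∀ i, ‖Θ.weakPartial i‖ ≤ 2 * flowLip A t 0 ^ 2 * (‖f‖ + ∫ s in (0 : ℝ)..t, ‖g s‖) := by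
  have hgL : ∀ a b, IntervalIntegrable (fun s => (g s).toLp) volume a b := fun a b =>
    intervalIntegrable_clm (Sobolev.toLpCLM Ω ℝ 1 2) (hg a b)
  have hbd : ∀ (w : Sobolev Ω ℝ 1 2), ∑ j, ‖w.weakPartial j‖ ≤ 2 * ‖w‖ := fun w => by
    rw [Fin.sum_univ_two]
    linarith [w.norm_weakPartial_le 0, w.norm_weakPartial_le 1]
  set K := flowLip A t 0 with hK
  have hK1 : 1 ≤ K := one_le_flowLip A t 0
  obtain ⟨F₀, hF₀, hF₀'⟩ := h.exists_evol_sobolev t 0 f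
  choose G hG hG' using fun s => h.exists_evol_sobolev t s (g s)
  have hGm : AEStronglyMeasurable G (volume.restrict (uIoc 0 t)) := by
    refine Sobolev.aestronglyMeasurable_of_toLp h.dom.isOpen ?_
    simp_rw [hG]
    exact (h.intervalIntegrable_evol t (hgL 0 t)).aestronglyMeasurable_restrict_uIoc
  have hGw : ∀ s ∈ uIoc 0 t, ∀ i, ‖(G s).weakPartial i‖ ≤ 2 * K ^ 2 * ‖g s‖ := by
    intro s hs i
    rw [uIoc_of_le ht] at hs
    refine (hG' s i).trans ?_
    have h1 := h.flowLip_mono hs.1.le hs.2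
    have h2 := one_le_flowLip A t s
    have h3 : flowLip A t s ^ 2 ≤ K ^ 2 := by gcongr
    have h4 := mul_le_mul h3 (hbd (g s)) (Finset.sum_nonneg fun _ _ => norm_nonneg _)
      (by positivity)
    linarith
  have hGi : IntervalIntegrable G volume 0 t := by
    refine ((hg 0 t).norm.const_mul (K + 4 * K ^ 2)).mono_fun' hGm ?_
    filter_upwards [ae_restrict_mem measurableSet_uIoc] with s hs
    have hs' := hs
    rw [uIoc_of_le ht] at hs'
    refine (G s).norm_le_add.trans ?_
    have h1 : ‖(G s).toLp‖ ≤ K * ‖g s‖ := by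
      rw [hG]
      exact (h.norm_evol_le t s _).trans (mul_le_mul (h.flowLip_mono hs'.1.le hs'.2)
        (g s).norm_toLp_le (norm_nonneg _) (by positivity))
    rw [Fin.sum_univ_two]
    linarith [hGw s hs 0, hGw s hs 1]
  refine ⟨F₀ - ∫ s in (0 : ℝ)..t, G s, ?_, fun i => ?_⟩
  · have e1 : (F₀ - ∫ s in (0 : ℝ)..t, G s).toLp
        = F₀.toLp - Sobolev.toLpCLM Ω ℝ 1 2 (∫ s in (0 : ℝ)..t, G s) := rfl
    rw [e1, ← ContinuousLinearMap.intervalIntegral_comp_comm _ hGi, h.duhamel_eq hgL f.toLp 0 t,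
      h.duhamel_zero, hF₀]
    simp only [Sobolev.toLpCLM_apply, hG]
  · have e1 : (F₀ - ∫ s in (0 : ℝ)..t, G s).weakPartial i
        = F₀.weakPartial i - Sobolev.weakPartialCLM Ω ℝ 0 2 i (∫ s in (0 : ℝ)..t, G s) := rfl
    rw [e1, ← ContinuousLinearMap.intervalIntegral_comp_comm _ hGi, mul_add,
      ← intervalIntegral.integral_const_mul]
    refine (norm_sub_le _ _).trans (add_le_add ?_ ?_)
    · refine (hF₀' i).trans ?_
      have := mul_le_mul_of_nonneg_left (hbd f) (by positivity : 0 ≤ K ^ 2)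
      linarith
    · refine intervalIntegral.norm_integral_le_of_norm_le ht (ae_of_all _ fun s hs => ?_)
        ((hg 0 t).norm.const_mul _)
      rw [← uIoc_of_le ht] at hs
      exact hGw s hs i

set_option maxHeartbeats 1000000 in
/-- The transport equation for Duhamel's solution, in integrated form. Tested with a smooth `ψ`, the
increments of the solution over short intervals agree with those of the integral up to an error of
smaller order. -/
theorem duhamel_sub (h : TangentField Ω V A) {g : ℝ → Sobolev Ω ℝ 1 2}
    (hg : ∀ a b, IntervalIntegrable g volume a b) (f : Sobolev Ω ℝ 1 2)
    {Θ : ℝ → Sobolev Ω ℝ 1 2}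
    (hΘ : ∀ t, 0 ≤ t → (Θ t).toLp = h.duhamel f.toLp (fun s => (g s).toLp) t)
    {M T : ℝ} (hT : 0 ≤ T) (hM : ∀ t ∈ Icc 0 T, ∑ i, ‖(Θ t).weakPartial i‖ ≤ M) :
    IntervalIntegrable (fun r => (g r).toLp + h.advect r (Θ r)) volume 0 T ∧
    h.duhamel f.toLp (fun s => (g s).toLp) T
      = f.toLp - ∫ r in (0 : ℝ)..T, ((g r).toLp + h.advect r (Θ r)) := by
  set θ := h.duhamel f.toLp (fun s => (g s).toLp) with hθ
  have hgL : ∀ a b, IntervalIntegrable (fun s => (g s).toLp) volume a b := fun a b =>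
    intervalIntegrable_clm (Sobolev.toLpCLM Ω ℝ 1 2) (hg a b)
  have hθc : Continuous θ := h.continuous_duhamel hgL f.toLp
  have hM0 : 0 ≤ M := (Finset.sum_nonneg fun _ _ => norm_nonneg _).trans (hM 0 (left_mem_Icc.2 hT))
  have hΘm : AEStronglyMeasurable Θ (volume.restrict (Icc 0 T)) := by
    refine Sobolev.aestronglyMeasurable_of_toLp h.dom.isOpen ?_
    refine (hθc.aestronglyMeasurable (μ := volume.restrict (Icc 0 T))).congr ?_
    filter_upwards [ae_restrict_mem measurableSet_Icc] with t ht
    exact (hΘ t ht.1).symm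
  have hQ : ∀ a b, 0 ≤ a → a ≤ b → b ≤ T →
      IntervalIntegrable (fun r => (g r).toLp + h.advect r (Θ r)) volume a b := by
    intro a b ha hab hb
    refine (hgL a b).add (h.intervalIntegrable_advect (M := M) ?_ fun r hr => ?_)
    · exact hΘm.mono_measure (Measure.restrict_mono ((uIoc_of_le hab).le.trans
        (Ioc_subset_Icc_self.trans (Icc_subset_Icc ha hb))) le_rfl)
    · rw [uIoc_of_le hab] at hr
      exact hM r ⟨ha.trans hr.1.le, hr.2.trans hb⟩
  refine ⟨hQ 0 T le_rfl hT le_rfl, ?_⟩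
  rw [← sub_eq_zero]
  refine L2.eq_zero_of_inner h.dom.isOpen fun ψ hψ => ?_
  have hψL := hψ.memLp 2 (volume.restrict Ω)
  rw [integral_mul_eq_inner hψL]
  set D : ℝ → ℝ := fun t => inner ℝ hψL.toLp
    (θ t + ∫ r in (0 : ℝ)..t, ((g r).toLp + h.advect r (Θ r))) with hD
  suffices hDD : D T = D 0 by
    simp only [hD, intervalIntegral.integral_same, add_zero] at hDD
    have e0 : θ 0 = f.toLp := h.duhamel_zero _
    rw [e0] at hDD
    rw [inner_sub_right, inner_sub_right]
    rw [inner_add_right] at hDD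
    linarith
  have hfin := h.dom.isFiniteMeasure
  obtain ⟨C, hC0, hC⟩ := h.exists_abs_inner_advect_le hψ
  obtain ⟨B, hB⟩ := hψ.contDiff.continuous.bounded_above_of_compact_support hψ.hasCompactSupport
  have hB0 : 0 ≤ B := (norm_nonneg _).trans (hB 0)
  obtain ⟨L, hL⟩ := (hψ.contDiff.of_le (m := 1) (by simp)).lipschitzWith_of_hasCompactSupport
    hψ.hasCompactSupport one_ne_zero
  set one : L2 Ω := (memLp_const (μ := volume.restrict Ω) (p := 2) (1 : ℝ)).toLp with hone
  -- the measure controlling the increments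
  set J : ℝ → ℝ := fun r => C * A r + ‖one‖ * (A r * M + ‖g r‖) with hJ
  have hJi : ∀ a b, IntervalIntegrable J volume a b := fun a b =>
    ((h.lip.integrable a b).const_mul C).add
      ((((h.lip.integrable a b).mul_const M).add (hg a b).norm).const_mul _)
  refine eq_of_forall_norm_sub_le (I := fun t => ∫ r in (0 : ℝ)..t, J r) hT fun ε hε => ?_
  -- continuity of the quantities controlling the error
  set E : ℝ → ℝ := fun d => L * d * Real.exp (2 * d) ^ 2 + (Real.exp (2 * d) ^ 2 - 1) * B with hE
  have hEc : Filter.Tendsto E (𝓝 0) (𝓝 0) := by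
    have : Continuous E := by fun_prop
    simpa [hE] using this.tendsto 0
  obtain ⟨η, hη, hηE⟩ := Metric.tendsto_nhds_nhds.1 hEc ε hε
  have hIc := continuous_primitive h.lip.integrable 0
  obtain ⟨δ₁, hδ₁, hI₁⟩ := Metric.uniformContinuousOn_iff.1
    (isCompact_Icc.uniformContinuousOn_of_continuous (hIc.continuousOn (s := Icc 0 T))) η hη
  obtain ⟨δ₂, hδ₂, hI₂⟩ := Metric.uniformContinuousOn_iff.1
    (isCompact_Icc.uniformContinuousOn_of_continuous (hθc.continuousOn (s := Icc 0 T))) ε hε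
  refine ⟨min δ₁ δ₂, lt_min hδ₁ hδ₂, fun s t hs hst ht hlt => ?_⟩
  have hsT : s ∈ Icc 0 T := ⟨hs, hst.trans ht⟩
  have ht0 : 0 ≤ t := hs.trans hst
  set P : ℝ → L2 Ω := fun r => (g r).toLp + h.advect r (Θ s) with hP
  have hPi : IntervalIntegrable P volume s t := (hgL s t).add
    (h.intervalIntegrable_advect (f := fun _ => Θ s) aestronglyMeasurable_const fun _ _ => le_rfl)
  have hPE := h.intervalIntegrable_evol t hPi
  have hQi := hQ s t hs hst ht
  have e1 : θ t - θ s = -∫ r in s..t, h.evol t r (P r) := by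
    have e2 := h.evol_sub_self hst (Θ s)
    have e3 := h.duhamel_eq hgL f.toLp s t
    rw [hΘ s hs] at e2
    rw [← hθ] at e3
    have e4 : ∫ r in s..t, h.evol t r (P r) = (∫ r in s..t, h.evol t r ((g r).toLp))
        + ∫ r in s..t, h.evol t r (h.advect r (Θ s)) := by
      rw [← intervalIntegral.integral_add (h.intervalIntegrable_evol t (hgL s t))
        (h.intervalIntegrable_evol t (h.intervalIntegrable_advect (f := fun _ => Θ s)
          aestronglyMeasurable_const fun _ _ => le_rfl))]
      simp only [hP, map_add]
    rw [e4, e3, neg_add, ← e2]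
    abel
  have e5 : D t - D s = ∫ r in s..t, (inner ℝ hψL.toLp
      ((g r).toLp + h.advect r (Θ r) - h.evol t r (P r)) : ℝ) := by
    have hi := (innerSL ℝ hψL.toLp).intervalIntegral_comp_comm (hQi.sub hPE)
    simp only [innerSL_apply_apply] at hi
    rw [hi, intervalIntegral.integral_sub hQi hPE]
    simp only [hD]
    rw [← inner_sub_right, ← intervalIntegral.integral_add_adjacent_intervals
      (hQ 0 s le_rfl hs (hst.trans ht)) hQi]
    congr 1
    rw [sub_eq_iff_eq_add] at e1
    rw [e1]
    abel
  rw [e5, intervalIntegral.integral_interval_sub_left (hJi _ _) (hJi _ _),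
    ← intervalIntegral.integral_const_mul]
  refine intervalIntegral.norm_integral_le_of_norm_le hst (ae_of_all _ fun r hr => ?_)
    ((hJi s t).const_mul ε)
  have hr0 : 0 ≤ r := hs.trans hr.1.le
  have hrT : r ∈ Icc 0 T := ⟨hr0, hr.2.trans ht⟩
  have htT : t ∈ Icc 0 T := ⟨ht0, ht⟩
  have e6 : (g r).toLp + h.advect r (Θ r) - h.evol t r (P r)
      = h.advect r (Θ r - Θ s) - (h.evol t r (P r) - P r) := by
    rw [h.advect_sub]
    simp only [hP]
    abel
  rw [e6, inner_sub_right, inner_sub_right]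
  have b1 : |(inner ℝ hψL.toLp (h.advect r (Θ r - Θ s)) : ℝ)| ≤ C * A r * ε := by
    rw [← integral_mul_eq_inner]
    refine (hC r _).trans (mul_le_mul_of_nonneg_left ?_ (mul_nonneg hC0 (h.lip.nonneg r)))
    have e7 : (Θ r - Θ s).toLp = θ r - θ s := by
      rw [← hΘ r hr0, ← hΘ s hs]; rfl
    rw [e7, ← dist_eq_norm]
    refine (hI₂ r hrT s hsT ?_).le
    rw [Real.dist_eq, abs_of_nonneg (by linarith [hr.1])]
    linarith [hr.2, min_le_right δ₁ δ₂]
  have b2 : |(inner ℝ hψL.toLp (h.evol t r (P r)) : ℝ) - inner ℝ hψL.toLp (P r)|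
      ≤ ε * (‖one‖ * (A r * M + ‖g r‖)) := by
    have hPr : Integrable (P r) (volume.restrict Ω) := (Lp.memLp (P r)).integrable (by norm_num)
    have d0 : 0 ≤ ∫ τ in r..t, A τ :=
      intervalIntegral.integral_nonneg hr.2 fun τ _ => h.lip.nonneg τ
    have c1 := (h.isBiLip t r).abs_integral_mul_comp_sub_le hPr
      hψ.contDiff.continuous.measurable (B := B) hB L.2 (fun x y => by
        rw [← Real.norm_eq_abs, ← dist_eq_norm, ← dist_eq_norm]; exact hL.dist_le_mul x y)
      (d := ∫ τ in r..t, A τ) (fun x => by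
        refine (h.lip.norm_flow_sub_le r t x).trans (le_of_eq ?_)
        rw [intervalIntegral.integral_symm, abs_neg, abs_of_nonneg d0])
    have c2 : ∫ x in Ω, ψ x * h.evol t r (P r) x = ∫ x in Ω, ψ x * P r (h.lip.flow r t x) := by
      refine integral_congr_ae ?_
      filter_upwards [h.coeFn_evol t r (P r)] with x hx
      rw [hx]
    rw [← integral_mul_eq_inner, ← integral_mul_eq_inner, c2]
    refine c1.trans ?_
    have c3 : ∫ x in Ω, |P r x| ≤ ‖one‖ * (A r * M + ‖g r‖) := by
      have c4 : ∫ x in Ω, |P r x| = inner ℝ one (Lp.memLp (P r)).norm.toLp := by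
        rw [← integral_mul_eq_inner]
        refine integral_congr_ae ?_
        filter_upwards [(Lp.memLp (P r)).norm.coeFn_toLp] with x hx
        rw [hx, one_mul, Real.norm_eq_abs]
      rw [c4]
      refine (real_inner_le_norm _ _).trans (mul_le_mul_of_nonneg_left ?_ (norm_nonneg _))
      rw [Lp.norm_toLp, eLpNorm_norm, ← Lp.norm_def]
      refine (norm_add_le _ _).trans ?_
      have c5 := (h.norm_advect_le r (Θ s)).trans
        (mul_le_mul_of_nonneg_left (hM s hsT) (h.lip.nonneg r))
      linarith [(g r).norm_toLp_le]
    have c6 : E (∫ τ in r..t, A τ) ≤ ε := by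
      have c7 : ∫ τ in r..t, A τ < η := by
        have := hI₁ t htT r hrT (by
          rw [Real.dist_eq, abs_of_nonneg (by linarith [hr.2])]
          linarith [hr.1, min_le_left δ₁ δ₂])
        rw [Real.dist_eq, intervalIntegral.integral_interval_sub_left (h.lip.integrable _ _)
          (h.lip.integrable _ _), abs_of_nonneg d0] at this
        exact this
      have := hηE (x := ∫ τ in r..t, A τ) (by rwa [Real.dist_eq, sub_zero, abs_of_nonneg d0])
      rw [Real.dist_eq, sub_zero] at this
      exact (le_abs_self _).trans this.le
    have c8 : flowLip A t r = Real.exp (2 * ∫ τ in r..t, A τ) := by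
      rw [flowLip_symm, flowLip, intervalIntegral.integral_symm, abs_neg, abs_of_nonneg d0]
    rw [c8]
    exact mul_le_mul c6 c3 (integral_nonneg fun _ => abs_nonneg _) hε.le
  rw [Real.norm_eq_abs]
  refine (abs_sub _ _).trans ((add_le_add b1 b2).trans (le_of_eq ?_))
  simp only [hJ]
  ring

end TangentField

/-! ### Lipschitz extension of a measurable family of vector fields -/

/-- The McShane extension of the function with the values `w n` at the points `d n`, truncated at
height `N`. Being defined by a countable infimum, it depends measurably on the data. -/
def mcShane (d : ℕ → Plane) (L N : ℝ) (w : ℕ → ℝ) (x : Plane) : ℝ :=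
  max (-N) (min N (⨅ n, (w n + L * ‖x - d n‖)))

section McShane

variable {d : ℕ → Plane} {L N : ℝ} {w : ℕ → ℝ}

lemma bddBelow_mcShane (hL : 0 ≤ L) (hN : ∀ n, |w n| ≤ N) (x : Plane) :
    BddBelow (range fun n => w n + L * ‖x - d n‖) := by
  refine ⟨-N, ?_⟩
  rintro _ ⟨n, rfl⟩
  have := mul_nonneg hL (norm_nonneg (x - d n))
  have := (abs_le.1 (hN n)).1
  simp only
  linarith

lemma mcShane_apply (hL : 0 ≤ L) (hN : ∀ n, |w n| ≤ N)
    (hw : ∀ n m, |w n - w m| ≤ L * ‖d n - d m‖) (m : ℕ) : mcShane d L N w (d m) = w m := by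
  have h1 : ⨅ n, (w n + L * ‖d m - d n‖) = w m := by
    refine le_antisymm ?_ (le_ciInf fun n => ?_)
    · refine (ciInf_le (bddBelow_mcShane hL hN (d m)) m).trans (le_of_eq ?_)
      simp
    · have := (le_abs_self _).trans (hw m n)
      linarith
  have h2 := abs_le.1 (hN m)
  rw [mcShane, h1, min_eq_right h2.2, max_eq_right h2.1]

lemma abs_mcShane_le (hN : 0 ≤ N) (x : Plane) : |mcShane d L N w x| ≤ N :=
  abs_le.2 ⟨le_max_left _ _, max_le (by linarith) (min_le_left _ _)⟩

lemma abs_mcShane_sub_le (hL : 0 ≤ L) (hN : ∀ n, |w n| ≤ N) (x y : Plane) :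
    |mcShane d L N w x - mcShane d L N w y| ≤ L * ‖x - y‖ := by
  have key : ∀ x y : Plane, (⨅ n, (w n + L * ‖x - d n‖)) ≤ (⨅ n, (w n + L * ‖y - d n‖)) + L * ‖x - y‖ := by
    intro x y
    rw [← sub_le_iff_le_add]
    refine le_ciInf fun n => ?_
    have h1 := ciInf_le (bddBelow_mcShane (d := d) hL hN x) n
    have h2 := mul_le_mul_of_nonneg_left (norm_sub_le_norm_sub_add_norm_sub x y (d n)) hL
    linarith
  have h1 := key x y
  have h2 := key y x
  rw [norm_sub_rev y x] at h2
  refine (abs_max_sub_max_le_max _ _ _ _).trans ?_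
  rw [sub_self, abs_zero, max_eq_right (abs_nonneg _)]
  refine (abs_min_sub_min_le_max _ _ _ _).trans ?_
  rw [sub_self, abs_zero, max_eq_right (abs_nonneg _)]
  exact abs_sub_le_iff.2 ⟨by linarith, by linarith⟩

end McShane

lemma norm_le_sum_abs (x : Plane) : ‖x‖ ≤ ∑ i, |x i| := by
  rw [EuclideanSpace.norm_eq]
  refine (Real.sqrt_le_sqrt (Finset.sum_sq_le_sq_sum_of_nonneg fun _ _ => norm_nonneg _)).trans ?_
  rw [Real.sqrt_sq (Finset.sum_nonneg fun _ _ => norm_nonneg _)]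
  exact le_rfl

/-- A measurable family of Lipschitz functions given on a sequence of points extends to a
measurable family of Lipschitz fields on the plane. -/
lemma exists_lipschitz_extension (d : ℕ → Plane) {w : ℕ → ℝ → Plane} {N : ℝ → ℝ} {C : ℝ}
    (hC : 0 ≤ C) (hw : ∀ n, Measurable (w n)) (hNm : Measurable N) (hN : ∀ n t, ‖w n t‖ ≤ N t)
    (hL : ∀ n m t, ‖w n t - w m t‖ ≤ C * N t * ‖d n - d m‖) :
    ∃ V : ℝ → Plane → Plane, (∀ x, Measurable fun t => V t x) ∧ (∀ t x, ‖V t x‖ ≤ 2 * N t) ∧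
      (∀ t x y, ‖V t x - V t y‖ ≤ 2 * (C * N t) * ‖x - y‖) ∧ ∀ n t, V t (d n) = w n t := by
  have hN0 : ∀ t, 0 ≤ N t := fun t => (norm_nonneg _).trans (hN 0 t)
  have hL0 : ∀ t, 0 ≤ C * N t := fun t => mul_nonneg hC (hN0 t)
  have hNi : ∀ i t n, |w n t i| ≤ N t := fun i t n =>
    (PiLp.norm_apply_le (w n t) i).trans (hN n t)
  have hLi : ∀ i t n m, |w n t i - w m t i| ≤ C * N t * ‖d n - d m‖ := fun i t n m =>
    (PiLp.norm_apply_le (w n t - w m t) i).trans (hL n m t)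
  refine ⟨fun t x => WithLp.toLp 2 fun i => mcShane d (C * N t) (N t) (fun n => w n t i) x,
    fun x => ?_, fun t x => ?_, fun t x y => ?_, fun n t => ?_⟩
  · refine (PiLp.continuous_toLp 2 _).measurable.comp (measurable_pi_lambda _ fun i => ?_)
    have hwi : ∀ n, Measurable fun t => w n t i := fun n =>
      (EuclideanSpace.proj (𝕜 := ℝ) i).measurable.comp (hw n)
    exact hNm.neg.max (hNm.min (Measurable.iInf fun n =>
      (hwi n).add ((hNm.const_mul C).mul_const _)))
  · refine (norm_le_sum_abs _).trans ?_
    rw [Fin.sum_univ_two, two_mul]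
    exact add_le_add (abs_mcShane_le (hN0 t) x) (abs_mcShane_le (hN0 t) x)
  · refine (norm_le_sum_abs _).trans ?_
    rw [Fin.sum_univ_two, mul_assoc, two_mul]
    exact add_le_add (abs_mcShane_sub_le (hL0 t) (hNi 0 t) x y)
      (abs_mcShane_sub_le (hL0 t) (hNi 1 t) x y)
  · ext i
    exact mcShane_apply (hL0 t) (hNi i t) (hLi i t) n

/-! ### The `W^{1,∞}` norm -/

/-- The essential supremum is a lower semicontinuous function on `L^p`. -/
lemma isClosed_eLpNorm_top_le {F : Type*} [NormedAddCommGroup F] {μ : Measure Plane} {p : ℝ≥0∞}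
    [Fact (1 ≤ p)] (c : ℝ≥0∞) : IsClosed {f : Lp F p μ | eLpNorm f ⊤ μ ≤ c} := by
  refine IsSeqClosed.isClosed fun f g hf hfg => ?_
  obtain ⟨φ, -, hφ⟩ := (tendstoInMeasure_of_tendsto_Lp hfg).exists_seq_tendsto_ae
  simp only [mem_ofPred_eq, eLpNorm_exponent_top] at hf ⊢
  refine eLpNormEssSup_le_of_ae_enorm_bound ?_
  have hall : ∀ᵐ x ∂μ, ∀ n, ‖f n x‖ₑ ≤ c := ae_all_iff.2 fun n => by
    filter_upwards [enorm_ae_le_eLpNormEssSup (f n) μ] with x hx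
    exact hx.trans (hf n)
  filter_upwards [hφ, hall] with x h1 h2
  exact le_of_tendsto h1.enorm (Filter.Eventually.of_forall fun n => h2 _)

lemma Sobolev.measurable_w1infNorm {Ω : Set Plane} [MeasurableSpace (Sobolev Ω Plane 2 3)]
    [BorelSpace (Sobolev Ω Plane 2 3)] :
    Measurable fun f : Sobolev Ω Plane 2 3 => f.w1infNorm := by
  have h1 : ∀ L : Sobolev Ω Plane 2 3 →L[ℝ] Lp Plane 3 (volume.restrict Ω),
      Measurable fun f => eLpNorm (L f) ⊤ (volume.restrict Ω) := fun L =>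
    measurable_of_Iic fun c => ((isClosed_eLpNorm_top_le c).preimage L.continuous).measurableSet
  refine (h1 (Sobolev.toLpCLM Ω Plane 2 3)).max (Measurable.iSup fun i => ?_)
  exact h1 (Sobolev.weakPartialCLM Ω Plane 1 3 i)

/-- The embedding of `W^{2,3}` into `W^{1,∞}`. -/
theorem IsSmoothBoundedDomain.exists_w1infNorm_le {Ω : Set Plane} (hΩ : IsSmoothBoundedDomain Ω) :
    ∃ C : ℝ≥0∞, C ≠ ⊤ ∧ ∀ f : Sobolev Ω Plane 2 3, f.w1infNorm ≤ C * ‖f‖ₑ := by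
  obtain ⟨C, hC, h⟩ := hΩ.exists_morrey Plane
  have hle : ∀ (f : Sobolev Ω Plane 2 3) (g : Lp Plane 3 (volume.restrict Ω)), ‖g‖ ≤ ‖f‖ →
      eLpNorm g 3 (volume.restrict Ω) ≤ ‖f‖ₑ := fun f g hg => by
    rw [← Lp.enorm_def, ← ofReal_norm, ← ofReal_norm]
    exact ENNReal.ofReal_le_ofReal hg
  have key : ∀ (f : Sobolev Ω Plane 2 3) (w : Lp Plane 3 (volume.restrict Ω))
      (g : Fin 2 → Lp Plane 3 (volume.restrict Ω)), (∀ i, HasWeakPartial Ω i w (g i)) → ‖w‖ ≤ ‖f‖ →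
      (∀ i, ‖g i‖ ≤ ‖f‖) → eLpNorm w ⊤ (volume.restrict Ω) ≤ C * 3 * ‖f‖ₑ := by
    intro f w g hwg hw hg
    refine (h w g hwg).trans ?_
    rw [mul_assoc, Fin.sum_univ_two]
    gcongr
    refine (add_le_add (hle f w hw) (add_le_add (hle f _ (hg 0)) (hle f _ (hg 1)))).trans
      (le_of_eq ?_)
    ring
  refine ⟨C * 3, ENNReal.mul_ne_top hC (by simp), fun f => sup_le ?_ (iSup_le fun i => ?_)⟩
  · exact key f _ _ f.hasWeakPartial f.norm_toLp_le f.norm_weakPartial_le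
  · choose g hg hg' using f.exists_hasWeakPartial_weakPartial i
    exact key f _ g hg (f.norm_weakPartial_le i) hg'

section

/-! ### The time interval -/

/-- The set of times `t ∈ [0, T]` that are finite. -/
def timeDomain (T : ℝ≥0∞) : Set ℝ := {t | 0 ≤ t ∧ ENNReal.ofReal t ≤ T}

lemma measurableSet_timeDomain (T : ℝ≥0∞) : MeasurableSet (timeDomain T) :=
  measurableSet_Ici.inter (ENNReal.measurable_ofReal measurableSet_Iic)

lemma exists_timeDomain_inter_subset {T : ℝ≥0∞} (hT : 0 < T) (b : ℝ) :
    ∃ S, 0 < S ∧ ENNReal.ofReal S ≤ T ∧ timeDomain T ∩ Iic b ⊆ Icc 0 S := by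
  by_cases h : T = ⊤
  · exact ⟨max b 1, by positivity, by simp [h], fun t ht => ⟨ht.1.1, ht.2.trans (le_max_left _ _)⟩⟩
  · exact ⟨T.toReal, ENNReal.toReal_pos hT.ne' h, by rw [ENNReal.ofReal_toReal h],
      fun t ht => ⟨ht.1.1, (ENNReal.ofReal_le_iff_le_toReal h).1 ht.1.2⟩⟩

lemma Icc_subset_timeDomain {T : ℝ≥0∞} {S : ℝ} (hS : ENNReal.ofReal S ≤ T) :
    Icc 0 S ⊆ timeDomain T :=
  fun _ ht => ⟨ht.1, (ENNReal.ofReal_le_ofReal ht.2).trans hS⟩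

/-- Properties that hold almost everywhere on all finite intervals `[0, S] ⊆ [0, T]` hold almost
everywhere on `[0, T]`. -/
lemma ae_timeDomain {T : ℝ≥0∞} (hT : 0 < T) {P : ℝ → Prop}
    (h : ∀ S, 0 < S → ENNReal.ofReal S ≤ T → ∀ᵐ t ∂timeMeasure S, P t) :
    ∀ᵐ t ∂volume.restrict (timeDomain T), P t := by
  choose S hS0 hST hS using fun k : ℕ => exists_timeDomain_inter_subset hT k
  have hsub : timeDomain T ⊆ ⋃ k, Icc 0 (S k) := fun t ht => by
    obtain ⟨k, hk⟩ := exists_nat_ge t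
    exact mem_iUnion.2 ⟨k, hS k ⟨ht, hk⟩⟩
  exact ae_restrict_of_ae_restrict_of_subset hsub
    ((ae_restrict_iUnion_iff _ _).2 fun k => h _ (hS0 k) (hST k))

lemma aestronglyMeasurable_timeDomain {E : Type*} [NormedAddCommGroup E] {T : ℝ≥0∞} (hT : 0 < T)
    {f : ℝ → E} (h : ∀ S, 0 < S → ENNReal.ofReal S ≤ T → AEStronglyMeasurable f (timeMeasure S)) :
    AEStronglyMeasurable f (volume.restrict (timeDomain T)) := by
  choose S hS0 hST hS using fun k : ℕ => exists_timeDomain_inter_subset hT k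
  have hsub : timeDomain T ⊆ ⋃ k, Icc 0 (S k) := fun t ht => by
    obtain ⟨k, hk⟩ := exists_nat_ge t
    exact mem_iUnion.2 ⟨k, hS k ⟨ht, hk⟩⟩
  exact (aestronglyMeasurable_iUnion_iff.2 fun k => h _ (hS0 k) (hST k)).mono_measure
    (Measure.restrict_mono hsub le_rfl)

lemma intervalIntegrable_indicator_timeDomain {E : Type*} [NormedAddCommGroup E] {T : ℝ≥0∞}
    (hT : 0 < T) {f : ℝ → E}
    (h : ∀ S, 0 < S → ENNReal.ofReal S ≤ T → IntegrableOn f (Icc 0 S)) (a b : ℝ) :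
    IntervalIntegrable ((timeDomain T).indicator f) volume a b := by
  rw [intervalIntegrable_iff, IntegrableOn, integrable_indicator_iff (measurableSet_timeDomain T),
    IntegrableOn, Measure.restrict_restrict (measurableSet_timeDomain T)]
  obtain ⟨S, hS0, hST, hS⟩ := exists_timeDomain_inter_subset hT (max a b)
  exact (h S hS0 hST).mono_set ((inter_subset_inter_right _ fun t ht => ht.2).trans hS)

/-! ### The continuous representative of the velocity -/

variable {Ω : Set Plane}

/-- The values of mollifications depend continuously on the function in `L³`; this gives the
measurability in time of the point values of the velocity. -/
lemma continuous_mollify_apply (n : ℕ) (hΩ : IsOpen Ω) (x : Plane) :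
    Continuous fun f : Lp Plane 3 (volume.restrict Ω) => mollify n (Ω.indicator f) x := by
  have hc : Continuous fun y : Plane => (bump n).normed volume (x - y) :=
    ((bump n).continuous_normed).comp (continuous_const.sub continuous_id)
  have hs : HasCompactSupport fun y : Plane => (bump n).normed volume (x - y) :=
    ((bump n).hasCompactSupport_normed (μ := volume)).comp_homeomorph (Homeomorph.subLeft x)
  refine (Sobolev.continuous_integral_smul hc hs).congr fun f => ?_
  rw [mollify_apply_swap, ← integral_indicator hΩ.measurableSet]
  refine integral_congr_ae (ae_of_all _ fun y => ?_)
  by_cases hy : y ∈ Ω <;> simp [hy]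

/-- The velocity is a Lipschitz vector field tangent to the boundary, whose Lipschitz constant is
controlled by the `W^{1,∞}` norm. -/
theorem IsSmoothBoundedDomain.exists_tangentField (hΩ : IsSmoothBoundedDomain Ω) :
    ∃ C, 0 ≤ C ∧ ∀ (T : ℝ≥0∞), 0 < T → ∀ v : ℝ → Sobolev Ω Plane 2 3,
      (∀ S : ℝ, 0 < S → ENNReal.ofReal S ≤ T →
          MemLp v 3 (timeMeasure S) ∧ (∀ᵐ t ∂timeMeasure S, NormalTraceZero Ω (v t).toLp)) →
      ∃ V A, TangentField Ω V A ∧ ∀ᵐ t ∂volume.restrict (timeDomain T),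
        V t =ᵐ[volume.restrict Ω] (v t).toLp ∧ A t ≤ C * (v t).w1infNorm.toReal := by
  obtain ⟨C, hC1, hC⟩ := hΩ.exists_lipschitz Plane 3
  obtain ⟨C', hC', hCle⟩ := hΩ.exists_w1infNorm_le
  have hC0 : 0 ≤ C := zero_le_one.trans hC1
  refine ⟨2 * C, by positivity, fun T hT v hv => ?_⟩
  set I := timeDomain T with hI
  set μ := volume.restrict I with hμ
  have hvm : AEStronglyMeasurable v μ := aestronglyMeasurable_timeDomain hT fun S h1 h2 =>
    (hv S h1 h2).1.aestronglyMeasurable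
  have htr : ∀ᵐ t ∂μ, NormalTraceZero Ω (v t).toLp := ae_timeDomain hT fun S h1 h2 => (hv S h1 h2).2
  have hfinite : ∀ f : Sobolev Ω Plane 2 3, f.w1infNorm ≠ ⊤ := fun f =>
    ((hCle f).trans_lt (ENNReal.mul_lt_top hC'.lt_top enorm_lt_top)).ne
  set n : ℝ → ℝ := fun t => (v t).w1infNorm.toReal with hn
  have hnm : AEMeasurable n μ := by
    borelize (Sobolev Ω Plane 2 3)
    exact (Sobolev.measurable_w1infNorm.comp_aemeasurable hvm.aemeasurable).ennreal_toReal
  -- a continuous representative, for each time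
  have hW : ∀ t, ∃ W : Plane → Plane, NormalTraceZero Ω (v t).toLp →
      ContinuousOn W (closure Ω) ∧ W =ᵐ[volume.restrict Ω] (v t).toLp ∧ IsTangent Ω W := by
    intro t
    by_cases h : NormalTraceZero Ω (v t).toLp
    · obtain ⟨W, h1, h2, h3⟩ := h
      exact ⟨W, fun _ => ⟨h1, h2, h3⟩⟩
    · exact ⟨0, fun h' => (h h').elim⟩
  choose W hW using hW
  have hWL : ∀ t, NormalTraceZero Ω (v t).toLp → (∀ x ∈ Ω, ‖W t x‖ ≤ n t) ∧
      ∀ x ∈ Ω, ∀ y ∈ Ω, ‖W t x - W t y‖ ≤ C * n t * ‖x - y‖ := by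
    intro t ht
    obtain ⟨h1, h2, -⟩ := hW t ht
    have hle : ∀ g : Lp Plane 3 (volume.restrict Ω),
        eLpNorm g ⊤ (volume.restrict Ω) ≤ (v t).w1infNorm →
        ∀ᵐ y ∂volume.restrict Ω, ‖g y‖ ≤ n t := by
      intro g hg
      rw [eLpNorm_exponent_top] at hg
      filter_upwards [enorm_ae_le_eLpNormEssSup g (volume.restrict Ω)] with y hy
      rw [hn, ← toReal_enorm]
      exact ENNReal.toReal_mono (hfinite _) (hy.trans hg)
    exact hC _ _ (v t).hasWeakPartial (W t) (h1.mono subset_closure) h2 (n t)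
      ENNReal.toReal_nonneg (hle _ le_sup_left)
      fun i => hle _ ((le_iSup (fun i => eLpNorm ((v t).weakPartial i) ⊤ (volume.restrict Ω)) i).trans
        le_sup_right)
  have hWm : ∀ x ∈ Ω, AEMeasurable (fun t => W t x) μ := by
    intro x hx
    refine aemeasurable_of_tendsto_metrizable_ae Filter.atTop
      (f := fun k t => mollify k (Ω.indicator (v t).toLp) x) (fun k => ?_) ?_
    · exact ((continuous_mollify_apply k hΩ.isOpen x).comp_aestronglyMeasurable
        ((Sobolev.toLpCLM Ω Plane 2 3).continuous.comp_aestronglyMeasurable hvm)).aemeasurable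
    · filter_upwards [htr] with t ht
      exact tendsto_mollify hΩ.isOpen _ ((hW t ht).1.mono subset_closure) (hW t ht).2.1 hx
  -- the values on a dense sequence, modified on a null set of times
  have : Nonempty Ω := hΩ.isConnected.nonempty.to_subtype
  set d : ℕ → Plane := fun k => (TopologicalSpace.denseSeq Ω k : Plane) with hd
  have hdΩ : ∀ k, d k ∈ Ω := fun k => (TopologicalSpace.denseSeq Ω k).2
  have hgood : ∀ᵐ t ∂μ, t ∈ I ∧ NormalTraceZero Ω (v t).toLp ∧ n t = hnm.mk n t ∧
      ∀ k, W t (d k) = (hWm (d k) (hdΩ k)).mk _ t := by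
    filter_upwards [ae_restrict_mem (measurableSet_timeDomain T), htr, hnm.ae_eq_mk,
      ae_all_iff.2 fun k => (hWm (d k) (hdΩ k)).ae_eq_mk] with t h1 h2 h3 h4
    exact ⟨h1, h2, h3, h4⟩
  obtain ⟨G, hGμ, hGm, hG⟩ := hgood.exists_measurable_mem
  obtain ⟨V, hVm, hVn, hVL, hVd⟩ := exists_lipschitz_extension d (C := C) hC0
    (w := fun k => G.indicator ((hWm (d k) (hdΩ k)).mk _)) (N := G.indicator (hnm.mk n))
    (fun k => (hWm (d k) (hdΩ k)).measurable_mk.indicator hGm) (hnm.measurable_mk.indicator hGm)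
    (fun k t => by
      by_cases ht : t ∈ G
      · obtain ⟨-, h2, h3, h4⟩ := hG t ht
        rw [indicator_of_mem ht, indicator_of_mem ht, ← h3, ← h4]
        exact (hWL t h2).1 _ (hdΩ k)
      · rw [indicator_of_notMem ht, indicator_of_notMem ht, norm_zero])
    (fun k m t => by
      by_cases ht : t ∈ G
      · obtain ⟨-, h2, h3, h4⟩ := hG t ht
        rw [indicator_of_mem ht, indicator_of_mem ht, indicator_of_mem ht, ← h3, ← h4, ← h4]
        exact (hWL t h2).2 _ (hdΩ k) _ (hdΩ m)
      · simp [indicator_of_notMem ht])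
  set N : ℝ → ℝ := G.indicator (hnm.mk n) with hN
  have hN0 : ∀ t, 0 ≤ N t := fun t => indicator_nonneg (fun s hs => by
    rw [← (hG s hs).2.2.1]; exact ENNReal.toReal_nonneg) t
  have hNn : ∀ t ∈ G, N t = n t := fun t ht => by rw [hN, indicator_of_mem ht, (hG t ht).2.2.1]
  have hVc : ∀ t, Continuous (V t) := fun t =>
    (LipschitzWith.of_dist_le_mul (K := ⟨2 * (C * N t), by have := hN0 t; positivity⟩) fun x y => by
      rw [dist_eq_norm, dist_eq_norm]; exact hVL t x y).continuous
  -- on the closure of the domain, the extension is the continuous representative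
  have hVW : ∀ t ∈ G, EqOn (V t) (W t) (closure Ω) := by
    intro t ht
    have hWc := (hW t (hG t ht).2.1).1
    have h1 : EqOn (V t) (W t) Ω := by
      have h2 : Continuous fun x : Ω => W t x :=
        continuousOn_iff_continuous_domRestrict.1 (hWc.mono subset_closure)
      have h3 := (TopologicalSpace.denseRange_denseSeq Ω).equalizer
        ((hVc t).comp continuous_subtype_val) h2 (by
          funext k
          refine (hVd k t).trans ?_
          rw [indicator_of_mem ht, ← (hG t ht).2.2.2 k]
          rfl)
      exact fun x hx => congrFun h3 ⟨x, hx⟩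
    exact h1.of_subset_closure (hVc t).continuousOn hWc subset_closure le_rfl
  refine ⟨V, fun t => 2 * (C * N t), ⟨⟨hVm, fun t x => ?_, hVL, ?_⟩, hΩ, fun t x hx ν hν => ?_⟩, ?_⟩
  · refine (hVn t x).trans ?_
    have := mul_le_mul_of_nonneg_right hC1 (hN0 t)
    linarith
  · have hi := intervalIntegrable_indicator_timeDomain hT (f := fun t => ‖v t‖) fun S h1 h2 =>
      ((hv S h1 h2).1.integrable (by norm_num)).norm
    intro a b
    refine ((hi a b).const_mul (2 * (C * C'.toReal))).mono_fun'
      (((hnm.measurable_mk.indicator hGm).const_mul C).const_mul 2).aestronglyMeasurable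
      (ae_of_all _ fun t => ?_)
    have hNt := hN0 t
    simp only
    rw [Real.norm_of_nonneg (by positivity)]
    by_cases ht : t ∈ G
    · rw [indicator_of_mem (hG t ht).1, hNn t ht, mul_assoc, mul_assoc]
      have h1 : n t ≤ C'.toReal * ‖v t‖ := by
        have := ENNReal.toReal_mono (ENNReal.mul_ne_top hC' enorm_ne_top) (hCle (v t))
        rwa [ENNReal.toReal_mul, toReal_enorm] at this
      gcongr
    · rw [hN, indicator_of_notMem ht, mul_zero, mul_zero]
      exact mul_nonneg (by positivity) (indicator_nonneg (fun _ _ => norm_nonneg _) t)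
  · by_cases ht : t ∈ G
    · rw [hVW t ht (frontier_subset_closure hx)]
      exact (hW t (hG t ht).2.1).2.2 x hx ν hν
    · have : V t x = 0 := by
        have := hVn t x
        rw [hN, indicator_of_notMem ht, mul_zero] at this
        exact norm_le_zero_iff.1 this
      rw [this, inner_zero_left]
  · filter_upwards [hGμ] with t ht
    refine ⟨?_, ?_⟩
    · filter_upwards [(hW t (hG t ht).2.1).2.1, ae_restrict_mem hΩ.isOpen.measurableSet] with x h1 h2
      rw [hVW t ht (subset_closure h2), h1]
    · rw [hNn t ht, mul_assoc]

end

/-! ### Primitives and weak time derivatives -/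

section WeakTimeDeriv

variable {X : Type*} [NormedAddCommGroup X] [NormedSpace ℝ X] {S : ℝ} {f g : ℝ → X}

lemma setIntegral_Icc_eq (hS : 0 ≤ S) (q : ℝ → X) : ∫ t in Icc 0 S, q t = ∫ t in (0 : ℝ)..S, q t := by
  rw [intervalIntegral.integral_of_le hS, integral_Icc_eq_integral_Ioc]

lemma intervalIntegrable_of_Icc {X : Type*} [NormedAddCommGroup X] {g : ℝ → X} (hg : IntervalIntegrable g volume 0 S) {a b : ℝ} (ha : 0 ≤ a)
    (hab : a ≤ b) (hb : b ≤ S) : IntervalIntegrable g volume a b := by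
  refine hg.mono_set ?_
  rw [uIcc_of_le hab, uIcc_of_le (ha.trans (hab.trans hb))]
  exact Icc_subset_Icc ha hb

/-- A primitive of `g` has the increments given by `g` between any two times. -/
lemma sub_eq_integral_of_primitive (hg : IntervalIntegrable g volume 0 S)
    (hf : ∀ t ∈ Icc 0 S, f t = f 0 + ∫ r in (0 : ℝ)..t, g r) {s t : ℝ} (hs : 0 ≤ s) (hst : s ≤ t)
    (ht : t ≤ S) : f t - f s = ∫ r in s..t, g r := by
  rw [hf t ⟨hs.trans hst, ht⟩, hf s ⟨hs, hst.trans ht⟩, add_sub_add_left_eq_sub,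
    intervalIntegral.integral_interval_sub_left
      (intervalIntegrable_of_Icc hg le_rfl (hs.trans hst) ht)
      (intervalIntegrable_of_Icc hg le_rfl hs (hst.trans ht))]

/-- Integration by parts for a primitive and a smooth function. -/
theorem integral_deriv_smul_add [CompleteSpace X] (hS : 0 ≤ S)
    (hg : IntervalIntegrable g volume 0 S) (hfc : ContinuousOn f (Icc 0 S))
    (hf : ∀ t ∈ Icc 0 S, f t = f 0 + ∫ r in (0 : ℝ)..t, g r) {φ : ℝ → ℝ} (hφ : ContDiff ℝ 1 φ) :
    ∫ t in (0 : ℝ)..S, (deriv φ t • f t + φ t • g t) = φ S • f S - φ 0 • f 0 := by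
  have hφ' : Continuous (deriv φ) := hφ.continuous_deriv le_rfl
  have hi1 : IntervalIntegrable (fun t => deriv φ t • f t) volume 0 S := by
    refine ContinuousOn.intervalIntegrable ?_
    rw [uIcc_of_le hS]
    exact hφ'.continuousOn.smul hfc
  have hi2 : IntervalIntegrable (fun t => φ t • g t) volume 0 S :=
    hg.continuousOn_smul hφ.continuous.continuousOn
  have hi := hi1.add hi2
  set J : ℝ → ℝ := fun t => |deriv φ t| + ‖g t‖ with hJ
  have hJi : IntervalIntegrable J volume 0 S := (hφ'.abs.intervalIntegrable 0 S).add hg.norm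
  have key := eq_of_forall_norm_sub_le (I := fun t => ∫ r in (0 : ℝ)..t, J r) hS
    (D := fun t => φ t • f t - ∫ r in (0 : ℝ)..t, (deriv φ r • f r + φ r • g r)) fun ε hε => by
      obtain ⟨δ₁, hδ₁, h₁⟩ := Metric.uniformContinuousOn_iff.1
        (isCompact_Icc.uniformContinuousOn_of_continuous hfc) ε hε
      obtain ⟨δ₂, hδ₂, h₂⟩ := Metric.uniformContinuousOn_iff.1
        (isCompact_Icc.uniformContinuousOn_of_continuous
          (hφ.continuous.continuousOn (s := Icc 0 S))) ε hε
      refine ⟨min δ₁ δ₂, lt_min hδ₁ hδ₂, fun s t hs hst ht hlt => ?_⟩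
      have e1 := sub_eq_integral_of_primitive hg hf hs hst ht
      have e2 : φ t - φ s = ∫ r in s..t, deriv φ r :=
        (intervalIntegral.integral_deriv_eq_sub (fun x _ => hφ.differentiable one_ne_zero x)
          (hφ'.intervalIntegrable s t)).symm
      have his := intervalIntegrable_of_Icc hi hs hst ht
      have hgs := intervalIntegrable_of_Icc hg hs hst ht
      have ic1 : IntervalIntegrable (fun r => deriv φ r • f t) volume s t :=
        (hφ'.smul continuous_const).intervalIntegrable s t
      have ic2 : IntervalIntegrable (fun r => φ s • g r) volume s t := hgs.smul (φ s)
      have e3 : φ t • f t - (∫ r in (0 : ℝ)..t, (deriv φ r • f r + φ r • g r))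
          - (φ s • f s - ∫ r in (0 : ℝ)..s, (deriv φ r • f r + φ r • g r))
          = ∫ r in s..t, (deriv φ r • f t + φ s • g r - (deriv φ r • f r + φ r • g r)) := by
        rw [intervalIntegral.integral_sub (ic1.add ic2) his,
          intervalIntegral.integral_add ic1 ic2, intervalIntegral.integral_smul_const,
          intervalIntegral.integral_smul, ← e2, ← e1, ← intervalIntegral.integral_interval_sub_left
            (intervalIntegrable_of_Icc hi le_rfl (hs.trans hst) ht)
            (intervalIntegrable_of_Icc hi le_rfl hs (hst.trans ht))]
        rw [sub_smul, smul_sub]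
        abel
      rw [e3, intervalIntegral.integral_interval_sub_left
        (intervalIntegrable_of_Icc hJi le_rfl (hs.trans hst) ht)
        (intervalIntegrable_of_Icc hJi le_rfl hs (hst.trans ht)),
        ← intervalIntegral.integral_const_mul]
      refine intervalIntegral.norm_integral_le_of_norm_le hst (ae_of_all _ fun r hr => ?_)
        ((intervalIntegrable_of_Icc hJi hs hst ht).const_mul ε)
      have hrS : r ∈ Icc 0 S := ⟨hs.trans hr.1.le, hr.2.trans ht⟩
      have b1 : ‖f t - f r‖ ≤ ε := by
        rw [← dist_eq_norm]
        refine (h₁ t ⟨hs.trans hst, ht⟩ r hrS ?_).le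
        rw [Real.dist_eq, abs_of_nonneg (by linarith [hr.2])]
        linarith [hr.1, min_le_left δ₁ δ₂]
      have b2 : |φ s - φ r| ≤ ε := by
        rw [← Real.dist_eq]
        refine (h₂ s ⟨hs, hst.trans ht⟩ r hrS ?_).le
        rw [Real.dist_eq, abs_sub_comm, abs_of_nonneg (by linarith [hr.1])]
        linarith [hr.2, min_le_right δ₁ δ₂]
      have e4 : deriv φ r • f t + φ s • g r - (deriv φ r • f r + φ r • g r)
          = deriv φ r • (f t - f r) + (φ s - φ r) • g r := by
        rw [smul_sub, sub_smul]; abel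
      rw [e4, hJ, mul_add]
      refine (norm_add_le _ _).trans (add_le_add ?_ ?_)
      · rw [norm_smul, Real.norm_eq_abs, mul_comm]
        exact mul_le_mul_of_nonneg_right b1 (abs_nonneg _)
      · rw [norm_smul, Real.norm_eq_abs]
        exact mul_le_mul_of_nonneg_right b2 (norm_nonneg _)
  simp only [intervalIntegral.integral_same, sub_zero] at key
  rw [← key]
  abel

lemma IsTestFunction.eq_zero_of_notMem_Ioo {φ : ℝ → ℝ} (hφ : IsTestFunction (Ioo 0 S) φ) {t : ℝ}
    (ht : t ∉ Ioo 0 S) : φ t = 0 :=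
  image_eq_zero_of_notMem_tsupport fun h => ht (hφ.tsupport_subset h)

/-- A primitive of `g` has the weak derivative `g`. -/
theorem hasWeakTimeDeriv_of_primitive [CompleteSpace X] (hS : 0 ≤ S)
    (hg : IntervalIntegrable g volume 0 S) (hfc : ContinuousOn f (Icc 0 S))
    (hf : ∀ t ∈ Icc 0 S, f t = f 0 + ∫ r in (0 : ℝ)..t, g r) : HasWeakTimeDeriv S f g := by
  intro φ hφ
  have hφ1 : ContDiff ℝ 1 φ := hφ.contDiff.of_le (by simp)
  have h := integral_deriv_smul_add hS hg hfc hf hφ1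
  rw [hφ.eq_zero_of_notMem_Ioo (by simp), hφ.eq_zero_of_notMem_Ioo (by simp), zero_smul, zero_smul,
    sub_zero, intervalIntegral.integral_add] at h
  · rw [setIntegral_Icc_eq hS, setIntegral_Icc_eq hS]
    exact eq_neg_of_add_eq_zero_left h
  · refine ContinuousOn.intervalIntegrable ?_
    rw [uIcc_of_le hS]
    exact (hφ1.continuous_deriv le_rfl).continuousOn.smul hfc
  · exact hg.continuousOn_smul hφ1.continuous.continuousOn

/-- A continuous function with weak derivative zero is constant (du Bois-Reymond). -/
theorem eq_of_hasWeakTimeDeriv_zero [CompleteSpace X] (hS : 0 < S) (hfc : ContinuousOn f (Icc 0 S))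
    (h : HasWeakTimeDeriv S f 0) : ∀ t ∈ Icc 0 S, f t = f 0 := by
  -- a test function of integral one
  obtain ⟨η, hη, hη1⟩ : ∃ η : ℝ → ℝ, IsTestFunction (Ioo 0 S) η ∧ ∫ t, η t = 1 := by
    let b : ContDiffBump (S / 2) := ⟨S / 8, S / 4, by positivity, by linarith⟩
    refine ⟨b.normed volume, ⟨b.contDiff_normed, b.hasCompactSupport_normed, ?_⟩, b.integral_normed⟩
    rw [b.tsupport_normed_eq, Real.closedBall_eq_Icc]
    intro x hx
    change x ∈ Icc (S / 2 - S / 4) (S / 2 + S / 4) at hx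
    exact ⟨by linarith [hx.1], by linarith [hx.2]⟩
  have hfi : IntegrableOn f (Icc 0 S) := hfc.integrableOn_Icc
  set c := ∫ t in Icc 0 S, η t • f t with hc
  have hint : ∀ χ : ℝ → ℝ, Continuous χ → IntegrableOn (fun t => χ t • f t) (Icc 0 S) := fun χ hχ =>
    (hχ.continuousOn.smul hfc).integrableOn_Icc
  have hzero : ∀ᵐ t ∂volume, t ∈ Ioo 0 S → f t - c = 0 := by
    refine isOpen_Ioo.ae_eq_zero_of_integral_contDiff_smul_eq_zero ?_ fun χ hχ hχc hχs => ?_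
    · exact ((hfi.mono_set Ioo_subset_Icc_self).sub
        (integrableOn_const (by simp))).locallyIntegrableOn
    · have hχt : IsTestFunction (Ioo 0 S) χ := ⟨hχ, hχc, hχs⟩
      set m := ∫ t, χ t with hm
      -- `ζ` has integral zero, hence is the derivative of a test function
      set ζ : ℝ → ℝ := fun t => χ t - m * η t with hζ
      have hζd : ContDiff ℝ ∞ ζ := hχ.sub (contDiff_const.mul hη.contDiff)
      have hζc : Continuous ζ := hζd.continuous
      have hζs : ∀ t ∉ tsupport χ ∪ tsupport η, ζ t = 0 := fun t ht => by
        simp only [mem_union, not_or] at ht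
        simp only [hζ]
        rw [image_eq_zero_of_notMem_tsupport ht.1, image_eq_zero_of_notMem_tsupport ht.2]
        simp
      have hK : IsCompact (tsupport χ ∪ tsupport η) := hχc.isCompact.union hη.hasCompactSupport.isCompact
      have hKS : tsupport χ ∪ tsupport η ⊆ Ioo 0 S := union_subset hχs hη.tsupport_subset
      obtain ⟨a, b, ha, hb, hab⟩ : ∃ a b, 0 < a ∧ b < S ∧ tsupport χ ∪ tsupport η ⊆ Icc a b := by
        have hne : (tsupport χ ∪ tsupport η).Nonempty := by
          by_contra hemp
          rw [not_nonempty_iff_eq_empty, union_empty_iff] at hemp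
          rw [tsupport_eq_empty_iff.1 hemp.2] at hη1
          simp at hη1
        obtain ⟨a, haK, ha⟩ := hK.exists_isLeast hne
        obtain ⟨b, hbK, hb⟩ := hK.exists_isGreatest hne
        exact ⟨a, b, (hKS haK).1, (hKS hbK).2, fun t ht => ⟨ha ht, hb ht⟩⟩
      have hζi : Integrable ζ :=
        (hχ.continuous.integrable_of_hasCompactSupport hχc).sub
          ((hη.contDiff.continuous.integrable_of_hasCompactSupport hη.hasCompactSupport).const_mul m)
      have hζ0 : ∫ t, ζ t = 0 := by
        simp only [hζ]
        rw [integral_sub (hχ.continuous.integrable_of_hasCompactSupport hχc)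
          ((hη.contDiff.continuous.integrable_of_hasCompactSupport hη.hasCompactSupport).const_mul m),
          integral_const_mul, hη1, mul_one, sub_self]
      set φ : ℝ → ℝ := fun t => ∫ r in (0 : ℝ)..t, ζ r with hφ
      have hφd : ∀ t, HasDerivAt φ (ζ t) t := fun t =>
        intervalIntegral.integral_hasDerivAt_right (hζc.intervalIntegrable 0 t)
          (hζc.stronglyMeasurableAtFilter _ _) hζc.continuousAt
      have hφ' : deriv φ = ζ := funext fun t => (hφd t).deriv
      have hφlt : ∀ t, t < a → φ t = 0 := fun t ht => by
        refine (intervalIntegral.integral_congr fun r hr => hζs r fun hr' => ?_).trans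
          intervalIntegral.integral_zero
        have h1 := (hab hr').1
        have h2 := hr.2
        have : max 0 t < a := max_lt ha ht
        exact absurd (h1.trans h2) (not_le.2 this)
      have hφgt : ∀ t, b < t → φ t = 0 := fun t ht => by
        refine (intervalIntegral.integral_eq_integral_of_support_subset fun r hr => ?_).trans hζ0
        have hr' : r ∈ tsupport χ ∪ tsupport η := by
          by_contra h'
          exact hr (hζs r h')
        exact ⟨(hKS hr').1, (hab hr').2.trans ht.le⟩
      have hφs : Function.support φ ⊆ Icc a b := fun t ht => by
        by_contra h'
        rw [mem_Icc, not_and_or, not_le, not_le] at h'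
        exact ht (h'.elim (hφlt t) (hφgt t))
      have hφt : IsTestFunction (Ioo 0 S) φ := by
        refine ⟨?_, HasCompactSupport.of_support_subset_isCompact isCompact_Icc hφs,
          (closure_minimal hφs isClosed_Icc).trans fun t ht => ⟨ha.trans_le ht.1, ht.2.trans_lt hb⟩⟩
        rw [contDiff_infty_iff_deriv]
        exact ⟨fun t => (hφd t).differentiableAt, by rwa [hφ']⟩
      have h1 := h φ hφt
      rw [hφ'] at h1
      simp only [Pi.zero_apply, smul_zero, integral_zero, neg_zero, hζ, sub_smul, mul_smul] at h1
      have i1 : IntegrableOn (fun t => m • η t • f t) (Icc 0 S) :=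
        (hint η hη.contDiff.continuous).smul m
      rw [integral_sub (hint χ hχ.continuous) i1] at h1
      rw [integral_smul, ← hc] at h1
      have hχ0 : ∀ t ∉ Icc 0 S, χ t = 0 := fun t ht =>
        hχt.eq_zero_of_notMem_Ioo fun h' => ht (Ioo_subset_Icc_self h')
      rw [← setIntegral_eq_integral_of_forall_compl_eq_zero (s := Icc 0 S)
        fun t ht => by rw [hχ0 t ht, zero_smul]]
      simp_rw [smul_sub]
      have i2 : IntegrableOn (fun t => χ t • c) (Icc 0 S) :=
        (hχ.continuous.smul continuous_const).integrableOn_Icc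
      rw [integral_sub (hint χ hχ.continuous) i2,
        integral_smul_const, setIntegral_eq_integral_of_forall_compl_eq_zero hχ0, ← hm]
      exact h1
  have hcl : EqOn f (fun _ => c) (Icc 0 S) := by
    have h1 : EqOn f (fun _ => c) (Ioo 0 S) := by
      refine Measure.eqOn_open_of_ae_eq (μ := volume) ?_ isOpen_Ioo
        (hfc.mono Ioo_subset_Icc_self) continuousOn_const
      rw [Filter.EventuallyEq, ae_restrict_iff' measurableSet_Ioo]
      filter_upwards [hzero] with t ht h'
      exact sub_eq_zero.1 (ht h')
    refine h1.of_subset_closure hfc continuousOn_const Ioo_subset_Icc_self ?_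
    rw [closure_Ioo hS.ne]
  intro t ht
  rw [hcl ht, hcl ⟨le_rfl, hS.le⟩]

/-- A continuous function with weak derivative `g` is a primitive of `g`. -/
theorem primitive_of_hasWeakTimeDeriv [CompleteSpace X] (hS : 0 < S)
    (hg : IntervalIntegrable g volume 0 S) (hfc : ContinuousOn f (Icc 0 S))
    (h : HasWeakTimeDeriv S f g) : ∀ t ∈ Icc 0 S, f t = f 0 + ∫ r in (0 : ℝ)..t, g r := by
  set P : ℝ → X := fun t => ∫ r in (0 : ℝ)..t, g r with hP
  have hPc : ContinuousOn P (Icc 0 S) := by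
    have := intervalIntegral.continuousOn_primitive_interval (μ := volume)
      (f := g) (a := 0) (b := S) ?_
    · rwa [uIcc_of_le hS.le] at this
    · rw [uIcc_of_le hS.le, integrableOn_Icc_iff_integrableOn_Ioc]
      exact hg.1
  have hPw : HasWeakTimeDeriv S P g := hasWeakTimeDeriv_of_primitive hS.le hg hPc fun t _ => by
    simp [hP]
  have hz : HasWeakTimeDeriv S (fun t => f t - P t) 0 := fun φ hφ => by
    have hφ' : Continuous (deriv φ) := hφ.contDiff.continuous_deriv (by simp)
    simp only [Pi.zero_apply, smul_zero, integral_zero, neg_zero, smul_sub]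
    have i1 : IntegrableOn (fun t => deriv φ t • f t) (Icc 0 S) :=
      (hφ'.continuousOn.smul hfc).integrableOn_Icc
    have i2 : IntegrableOn (fun t => deriv φ t • P t) (Icc 0 S) :=
      (hφ'.continuousOn.smul hPc).integrableOn_Icc
    rw [integral_sub i1 i2, h φ hφ, hPw φ hφ, sub_self]
  intro t ht
  have := eq_of_hasWeakTimeDeriv_zero hS (hfc.sub hPc) hz t ht
  simp only [hP, Pi.sub_apply, intervalIntegral.integral_same, sub_zero] at this
  rw [← this]
  abel

end WeakTimeDeriv

/-! ### The energy estimate -/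

/-- The derivative of the square of the norm of a primitive, in integrated form. -/
theorem norm_sq_of_primitive {X : Type*} [NormedAddCommGroup X] [InnerProductSpace ℝ X]
    [CompleteSpace X] {S : ℝ} {f g : ℝ → X} (hS : 0 ≤ S) (hg : IntervalIntegrable g volume 0 S)
    (hfc : ContinuousOn f (Icc 0 S))
    (hf : ∀ t ∈ Icc 0 S, f t = f 0 + ∫ r in (0 : ℝ)..t, g r) :
    IntervalIntegrable (fun r => (inner ℝ (g r) (f r) : ℝ)) volume 0 S ∧
      ‖f S‖ ^ 2 = ‖f 0‖ ^ 2 + 2 * ∫ r in (0 : ℝ)..S, inner ℝ (g r) (f r) := by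
  have hi : IntervalIntegrable (fun r => (inner ℝ (g r) (f r) : ℝ)) volume 0 S := by
    obtain ⟨B, hB⟩ := isCompact_Icc.exists_bound_of_continuousOn hfc
    refine (hg.norm.mul_const B).mono_fun' ?_ ?_
    · refine hg.aestronglyMeasurable_restrict_uIoc.inner ?_
      rw [uIoc_of_le hS]
      exact (hfc.mono Ioc_subset_Icc_self).aestronglyMeasurable measurableSet_Ioc
    · filter_upwards [ae_restrict_mem measurableSet_uIoc] with r hr
      rw [uIoc_of_le hS] at hr
      exact (norm_inner_le_norm _ _).trans
        (mul_le_mul_of_nonneg_left (hB r (Ioc_subset_Icc_self hr)) (norm_nonneg _))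
  refine ⟨hi, ?_⟩
  have key := eq_of_forall_norm_sub_le (I := fun t => ∫ r in (0 : ℝ)..t, 2 * ‖g r‖) hS
    (D := fun t => ‖f t‖ ^ 2 - 2 * ∫ r in (0 : ℝ)..t, (inner ℝ (g r) (f r) : ℝ)) fun ε hε => by
      obtain ⟨δ, hδ, h₁⟩ := Metric.uniformContinuousOn_iff.1
        (isCompact_Icc.uniformContinuousOn_of_continuous hfc) ε hε
      refine ⟨δ, hδ, fun s t hs hst ht hlt => ?_⟩
      have e1 := sub_eq_integral_of_primitive hg hf hs hst ht
      have his := intervalIntegrable_of_Icc hi hs hst ht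
      have hgs := intervalIntegrable_of_Icc hg hs hst ht
      have hJi : IntervalIntegrable (fun r => 2 * ‖g r‖) volume 0 S := hg.norm.const_mul 2
      have e2 := (innerSL ℝ (f t + f s)).intervalIntegral_comp_comm hgs
      have ic : IntervalIntegrable (fun r => (inner ℝ (f t + f s) (g r) : ℝ)) volume s t :=
        intervalIntegrable_clm (innerSL ℝ (f t + f s)) hgs
      simp only [innerSL_apply_apply] at e2
      have e3 : ‖f t‖ ^ 2 - 2 * (∫ r in (0 : ℝ)..t, (inner ℝ (g r) (f r) : ℝ))
          - (‖f s‖ ^ 2 - 2 * ∫ r in (0 : ℝ)..s, (inner ℝ (g r) (f r) : ℝ))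
          = ∫ r in s..t, ((inner ℝ (f t + f s) (g r) : ℝ) - 2 * inner ℝ (g r) (f r)) := by
        rw [intervalIntegral.integral_sub ic (his.const_mul 2), e2, ← e1,
          intervalIntegral.integral_const_mul, ← intervalIntegral.integral_interval_sub_left
            (intervalIntegrable_of_Icc hi le_rfl (hs.trans hst) ht)
            (intervalIntegrable_of_Icc hi le_rfl hs (hst.trans ht)), inner_add_left,
          inner_sub_right, inner_sub_right, real_inner_self_eq_norm_sq, real_inner_self_eq_norm_sq,
          real_inner_comm (f s) (f t)]
        ring
      rw [e3, intervalIntegral.integral_interval_sub_left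
        (intervalIntegrable_of_Icc hJi le_rfl (hs.trans hst) ht)
        (intervalIntegrable_of_Icc hJi le_rfl hs (hst.trans ht)),
        ← intervalIntegral.integral_const_mul]
      refine intervalIntegral.norm_integral_le_of_norm_le hst (ae_of_all _ fun r hr => ?_)
        ((intervalIntegrable_of_Icc hJi hs hst ht).const_mul ε)
      have hrS : r ∈ Icc 0 S := ⟨hs.trans hr.1.le, hr.2.trans ht⟩
      have b1 : ‖f t - f r‖ ≤ ε := by
        rw [← dist_eq_norm]
        refine (h₁ t ⟨hs.trans hst, ht⟩ r hrS ?_).le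
        rw [Real.dist_eq, abs_of_nonneg (by linarith [hr.2])]
        linarith [hr.1]
      have b2 : ‖f s - f r‖ ≤ ε := by
        rw [← dist_eq_norm]
        refine (h₁ s ⟨hs, hst.trans ht⟩ r hrS ?_).le
        rw [Real.dist_eq, abs_sub_comm, abs_of_nonneg (by linarith [hr.1])]
        linarith [hr.2]
      have e4 : (inner ℝ (f t + f s) (g r) : ℝ) - 2 * inner ℝ (g r) (f r)
          = inner ℝ ((f t - f r) + (f s - f r)) (g r) := by
        rw [real_inner_comm (f r) (g r), inner_add_left, inner_add_left, inner_sub_left,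
          inner_sub_left]
        ring
      rw [e4]
      refine (norm_inner_le_norm _ _).trans ?_
      have b3 := (norm_add_le (f t - f r) (f s - f r)).trans (add_le_add b1 b2)
      have b4 := mul_le_mul_of_nonneg_right b3 (norm_nonneg (g r))
      linarith
  simp only [intervalIntegral.integral_same, mul_zero, sub_zero] at key
  linarith

namespace TangentField

variable {Ω : Set Plane} {V : ℝ → Plane → Plane} {A : ℝ → ℝ}

/-- The field frozen at the time `r`. -/
lemma frozen (h : TangentField Ω V A) (r : ℝ) : TangentField Ω (fun _ => V r) fun _ => A r where
  lip :=
    { measurable := fun _ => measurable_const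
      norm_le := fun _ => h.lip.norm_le r
      lipschitz := fun _ => h.lip.lipschitz r
      integrable := fun _ _ => intervalIntegrable_const }
  dom := h.dom
  tangent := fun _ => h.tangent r

/-- The advection term is almost skew-symmetric. Since `V` is tangent to the boundary, the `L²`
norm grows at most exponentially along the flow of the field frozen at the time `r`, and the
inequality is obtained by differentiating at the initial time. -/
theorem neg_inner_advect_le (h : TangentField Ω V A) (r : ℝ) (f : Sobolev Ω ℝ 1 2) :
    -(inner ℝ f.toLp (h.advect r f) : ℝ) ≤ 2 * A r * ‖f.toLp‖ ^ 2 := by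
  set k := h.frozen r with hk
  set q := h.advect r f with hq
  have hqk : ∀ τ, k.advect τ f = q := fun τ => rfl
  set p : L2 Ω := f.toLp with hp
  have hA := h.lip.nonneg r
  have hconst : ∀ {σ : ℝ}, 0 ≤ σ → flowLip (fun _ => A r) σ 0 = Real.exp (2 * (σ * A r)) := by
    intro σ hσ
    rw [flowLip, intervalIntegral.integral_const, sub_zero, smul_eq_mul, abs_of_nonneg (by positivity)]
  have hcont2 : Filter.Tendsto (fun z : ℝ × ℝ => (inner ℝ p (k.evol z.1 z.2 q) : ℝ)) (𝓝 (0, 0))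
      (𝓝 (inner ℝ p q)) := by
    have h1 : Continuous fun z : ℝ × ℝ => ((z, q) : (ℝ × ℝ) × L2 Ω) := by fun_prop
    have h2 := k.continuous_evol.comp h1
    have h3 : Continuous fun z : ℝ × ℝ => (inner ℝ p (k.evol z.1 z.2 q) : ℝ) :=
      continuous_const.inner h2
    have h4 := h3.tendsto (0, 0)
    rwa [k.evol_self] at h4
  refine le_of_forall_pos_le_add fun ε hε => ?_
  obtain ⟨δ, hδ, hδε⟩ := Metric.tendsto_nhds_nhds.1 hcont2 ε hε
  have hlim : Filter.Tendsto (fun σ => σ⁻¹ • (Real.exp (2 * ((0 + σ) * A r))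
      - Real.exp (2 * (0 * A r)))) (𝓝[>] 0) (𝓝 (2 * A r)) := by
    have hd : HasDerivAt (fun σ => Real.exp (2 * (σ * A r))) (2 * A r) 0 := by
      have := (((hasDerivAt_id (0 : ℝ)).mul_const (A r)).const_mul 2).exp
      simpa using this
    exact hd.tendsto_slope_zero_right
  have hlim2 := (hlim.mul_const (‖p‖ ^ 2)).add_const ε
  refine ge_of_tendsto hlim2 ?_
  filter_upwards [Ioo_mem_nhdsGT hδ] with σ hσ
  have hσ0 : 0 < σ := hσ.1
  have e1 := k.evol_sub_self hσ0.le f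
  simp only [hqk] at e1
  have hint : IntervalIntegrable (fun τ => k.evol σ τ q) volume 0 σ :=
    k.intervalIntegrable_evol σ intervalIntegrable_const
  have e2 : (inner ℝ p (k.evol σ 0 p) : ℝ) - ‖p‖ ^ 2 = -∫ τ in (0 : ℝ)..σ, inner ℝ p (k.evol σ τ q) := by
    have e3 := (innerSL ℝ p).intervalIntegral_comp_comm hint
    simp only [innerSL_apply_apply] at e3
    rw [e3, ← inner_neg_right, ← e1, inner_sub_right, real_inner_self_eq_norm_sq]
  have e4 : (inner ℝ p (k.evol σ 0 p) : ℝ) ≤ Real.exp (2 * (σ * A r)) * ‖p‖ ^ 2 := by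
    refine (real_inner_le_norm _ _).trans ?_
    have := mul_le_mul_of_nonneg_left (k.norm_evol_le σ 0 p) (norm_nonneg p)
    rw [hconst hσ0.le] at this
    linarith
  have e5 : ∫ τ in (0 : ℝ)..σ, (inner ℝ p (k.evol σ τ q) : ℝ) ≤ σ * (inner ℝ p q + ε) := by
    have hi : IntervalIntegrable (fun τ => (inner ℝ p (k.evol σ τ q) : ℝ)) volume 0 σ :=
      intervalIntegrable_clm (innerSL ℝ p) hint
    have := intervalIntegral.integral_mono_on hσ0.le hi
      (intervalIntegrable_const (c := (inner ℝ p q + ε : ℝ))) fun τ hτ => by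
        have hz : dist ((σ, τ) : ℝ × ℝ) (0, 0) < δ := by
          rw [Prod.dist_eq, Real.dist_eq, Real.dist_eq, sub_zero, sub_zero, abs_of_nonneg hσ0.le,
            abs_of_nonneg hτ.1]
          exact max_lt hσ.2 (hτ.2.trans_lt hσ.2)
        have h3 := (le_abs_self _).trans (hδε hz).le
        linarith
    rwa [intervalIntegral.integral_const, sub_zero, smul_eq_mul] at this
  rw [zero_add, zero_mul, mul_zero, Real.exp_zero, smul_eq_mul, mul_assoc, inv_mul_eq_div,
    ← sub_le_iff_le_add, le_div_iff₀ hσ0]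
  linarith

/-- A solution of the homogeneous equation that vanishes initially vanishes. -/
theorem eq_zero_of_primitive (h : TangentField Ω V A) {S : ℝ} {w wt : ℝ → L2 Ω}
    {W : ℝ → Sobolev Ω ℝ 1 2} (hwt : IntervalIntegrable wt volume 0 S)
    (hwc : ContinuousOn w (Icc 0 S)) (hw0 : w 0 = 0)
    (hw : ∀ t ∈ Icc 0 S, w t = ∫ r in (0 : ℝ)..t, wt r)
    (hW : ∀ᵐ t ∂timeMeasure S, (W t).toLp = w t ∧ wt t = -h.advect t (W t)) :
    ∀ t ∈ Icc 0 S, w t = 0 := by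
  intro t ht
  have hw' : ∀ t ∈ Icc 0 S, w t = w 0 + ∫ r in (0 : ℝ)..t, wt r := fun t ht => by
    rw [hw0, zero_add, hw t ht]
  have hA4 : ∀ a b, IntervalIntegrable (fun r => 4 * A r) volume a b := fun a b =>
    (h.lip.integrable a b).const_mul 4
  have hle : ∀ r ∈ uIcc 0 t, ‖w r‖ ^ 2 ≤ 0 + |∫ τ in (0 : ℝ)..r, 4 * A τ * ‖w τ‖ ^ 2| := by
    intro r hr
    rw [uIcc_of_le ht.1] at hr
    have hrS : r ≤ S := hr.2.trans ht.2
    have hsub : Icc 0 r ⊆ Icc 0 S := Icc_subset_Icc le_rfl hrS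
    obtain ⟨h1, h2⟩ := norm_sq_of_primitive hr.1 (intervalIntegrable_of_Icc hwt le_rfl hr.1 hrS)
      (hwc.mono hsub) fun τ hτ => hw' τ (hsub hτ)
    rw [h2, hw0, norm_zero, ← intervalIntegral.integral_const_mul]
    have hi : IntervalIntegrable (fun τ => 4 * A τ * ‖w τ‖ ^ 2) volume 0 r := by
      refine (hA4 0 r).mul_continuousOn ?_
      rw [uIcc_of_le hr.1]
      exact ((hwc.mono hsub).norm.pow 2)
    have h3 : ∫ τ in (0 : ℝ)..r, 2 * (inner ℝ (wt τ) (w τ) : ℝ)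
        ≤ ∫ τ in (0 : ℝ)..r, 4 * A τ * ‖w τ‖ ^ 2 := by
      refine intervalIntegral.integral_mono_ae_restrict hr.1 (h1.const_mul 2) hi ?_
      filter_upwards [ae_restrict_of_ae_restrict_of_subset hsub hW] with τ hτ
      have h4 := h.neg_inner_advect_le τ (W τ)
      rw [hτ.2, inner_neg_left, real_inner_comm, ← hτ.1]
      linarith
    have h5 := le_abs_self (∫ τ in (0 : ℝ)..r, 4 * A τ * ‖w τ‖ ^ 2)
    linarith
  have hcont : ContinuousOn (fun r => ‖w r‖ ^ 2) (uIcc 0 t) := by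
    rw [uIcc_of_le ht.1]
    exact ((hwc.mono (Icc_subset_Icc le_rfl ht.2)).norm.pow 2)
  have := le_mul_exp_of_le_add_abs_integral (fun r => mul_nonneg (by norm_num) (h.lip.nonneg r)) hA4
    hcont (fun r _ => by positivity) hle
  rw [zero_mul] at this
  have h0 : ‖w t‖ ^ 2 = 0 := le_antisymm this (by positivity)
  exact norm_eq_zero.1 (pow_eq_zero_iff (two_ne_zero) |>.1 h0)

end TangentField

/-! ### Components of vector-valued Sobolev functions -/

namespace Sobolev

variable {Ω : Set Plane}

lemma norm_compLpL_proj_le (i : Fin 2) (f : Lp Plane 2 (volume.restrict Ω)) :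
    ‖(EuclideanSpace.proj (𝕜 := ℝ) i).compLpL 2 (volume.restrict Ω) f‖ ≤ ‖f‖ := by
  refine Lp.norm_le_norm_of_ae_le ?_
  filter_upwards [(EuclideanSpace.proj (𝕜 := ℝ) i).coeFn_compLpL (p := 2)
    (μ := volume.restrict Ω) f] with x hx
  rw [hx]
  exact PiLp.norm_apply_le (f x) i

lemma hasWeakPartial_proj (i j : Fin 2) {f g : Lp Plane 2 (volume.restrict Ω)}
    (h : HasWeakPartial Ω j f g) :
    HasWeakPartial Ω j ((EuclideanSpace.proj (𝕜 := ℝ) i).compLpL 2 (volume.restrict Ω) f)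
      ((EuclideanSpace.proj (𝕜 := ℝ) i).compLpL 2 (volume.restrict Ω) g) := by
  intro φ hφ
  have key : ∀ (ψ : Plane → ℝ), Continuous ψ → HasCompactSupport ψ →
      ∀ w : Lp Plane 2 (volume.restrict Ω), ∫ x in Ω,
        ψ x • (EuclideanSpace.proj (𝕜 := ℝ) i).compLpL 2 (volume.restrict Ω) w x
        = EuclideanSpace.proj (𝕜 := ℝ) i (∫ x in Ω, ψ x • w x) := by
    intro ψ hc hs w
    rw [← ContinuousLinearMap.integral_comp_comm _ (integrable_smul_Lp hc hs w)]
    refine integral_congr_ae ?_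
    filter_upwards [(EuclideanSpace.proj (𝕜 := ℝ) i).coeFn_compLpL (p := 2)
      (μ := volume.restrict Ω) w] with x hx
    rw [hx, map_smul]
  have hφj := hφ.partialDeriv j
  rw [key _ hφj.contDiff.continuous hφj.hasCompactSupport,
    key _ hφ.contDiff.continuous hφ.hasCompactSupport, h φ hφ, map_neg]

/-- The `i`-th component of a vector-valued function in `H¹`. -/
def coord (i : Fin 2) (f : Sobolev Ω Plane 1 2) : Sobolev Ω ℝ 1 2 :=
  ofWeakPartial _ _ fun j => hasWeakPartial_proj i j (f.hasWeakPartial j)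

lemma toLp_coord (i : Fin 2) (f : Sobolev Ω Plane 1 2) :
    (f.coord i).toLp = (EuclideanSpace.proj (𝕜 := ℝ) i).compLpL 2 (volume.restrict Ω) f.toLp := rfl

lemma coeFn_toLp_coord (i : Fin 2) (f : Sobolev Ω Plane 1 2) :
    (f.coord i).toLp =ᵐ[volume.restrict Ω] fun x => f.toLp x i :=
  (EuclideanSpace.proj (𝕜 := ℝ) i).coeFn_compLpL (p := 2) (μ := volume.restrict Ω) f.toLp

lemma norm_coord_le (i : Fin 2) (f : Sobolev Ω Plane 1 2) : ‖f.coord i‖ ≤ 3 * ‖f‖ := by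
  have h1 : ‖(f.coord i).toLp‖ ≤ ‖f‖ := (norm_compLpL_proj_le i f.toLp).trans f.norm_toLp_le
  have h2 : ∀ j, ‖(f.coord i).weakPartial j‖ ≤ ‖f‖ := fun j => by
    rw [coord, weakPartial_ofWeakPartial]
    exact (norm_compLpL_proj_le i (f.weakPartial j)).trans (f.norm_weakPartial_le j)
  refine (f.coord i).norm_le_add.trans ?_
  rw [Fin.sum_univ_two]
  linarith [h2 0, h2 1]

lemma aestronglyMeasurable_coord (hΩ : IsOpen Ω) (i : Fin 2) {μ : Measure ℝ}
    {u : ℝ → Sobolev Ω Plane 1 2} (hu : AEStronglyMeasurable u μ) :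
    AEStronglyMeasurable (fun t => (u t).coord i) μ := by
  refine aestronglyMeasurable_of_toLp hΩ ?_
  simp_rw [toLp_coord]
  exact ((EuclideanSpace.proj (𝕜 := ℝ) i).compLpL 2
    (volume.restrict Ω)).continuous.comp_aestronglyMeasurable
      ((toLpCLM Ω Plane 1 2).continuous.comp_aestronglyMeasurable hu)

lemma memLp_coord (hΩ : IsOpen Ω) (i : Fin 2) {μ : Measure ℝ} {p : ℝ≥0∞}
    {u : ℝ → Sobolev Ω Plane 1 2} (hu : MemLp u p μ) : MemLp (fun t => (u t).coord i) p μ :=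
  hu.of_le_mul (aestronglyMeasurable_coord hΩ i hu.aestronglyMeasurable)
    (ae_of_all _ fun t => norm_coord_le i (u t))

end Sobolev

/-! ### The transport equation -/

namespace TangentField

variable {Ω : Set Plane} {V : ℝ → Plane → Plane} {A : ℝ → ℝ}

/-- The equation at a fixed time, as an identity in `L²(Ω)`. -/
lemma equation_iff (h : TangentField Ω V A) {t : ℝ} {v : Sobolev Ω Plane 2 3}
    (hv : V t =ᵐ[volume.restrict Ω] v.toLp) (u : Sobolev Ω Plane 1 2) (θt : L2 Ω)
    (Θ : Sobolev Ω ℝ 1 2) :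
    (∀ᵐ x ∂volume.restrict Ω, θt x + ∑ i, v.toLp x i * Θ.weakPartial i x = -u.toLp x 1) ↔
      θt = -((u.coord 1).toLp + h.advect t Θ) := by
  have h1 : (-((u.coord 1).toLp + h.advect t Θ) : L2 Ω) =ᵐ[volume.restrict Ω]
      fun x => -(u.toLp x 1 + ∑ i, v.toLp x i * Θ.weakPartial i x) := by
    filter_upwards [Lp.coeFn_neg ((u.coord 1).toLp + h.advect t Θ),
      Lp.coeFn_add (u.coord 1).toLp (h.advect t Θ), u.coeFn_toLp_coord 1, h.coeFn_advect t Θ,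
      hv] with x e1 e2 e3 e4 e5
    rw [e1, Pi.neg_apply, e2, Pi.add_apply, e3, e4, e5]
  constructor
  · intro h2
    refine Lp.ext ?_
    filter_upwards [h1, h2] with x e1 e2
    rw [e1]
    linarith
  · rintro rfl
    filter_upwards [h1] with x e1
    rw [e1]
    ring

end TangentField

lemma timeMeasure_zero : timeMeasure 0 = 0 := by simp [timeMeasure]

section Solution

variable {Ω : Set Plane} {V : ℝ → Plane → Plane} {A : ℝ → ℝ} {v : ℝ → Sobolev Ω Plane 2 3}
  {u : ℝ → Sobolev Ω Plane 1 2} {θ₀ : Sobolev Ω ℝ 1 2} {S : ℝ}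

/-- Solutions in the class of the theorem are unique. -/
theorem IsTransportSolution.eqOn (h : TangentField Ω V A) (hS : 0 < S)
    (hv : ∀ᵐ t ∂timeMeasure S, V t =ᵐ[volume.restrict Ω] (v t).toLp) {θ θ' : ℝ → L2 Ω}
    (h' : IsTransportSolution Ω S v u θ₀ θ') (hθ : IsTransportSolution Ω S v u θ₀ θ) :
    EqOn θ' θ (Icc 0 S) := by
  obtain ⟨c1, i1, Θ, θt, a1, -, -, m1, d1, q1⟩ := hθ
  obtain ⟨c2, i2, Θ', θt', a2, -, -, m2, d2, q2⟩ := h'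
  have hint : ∀ {q : ℝ → L2 Ω}, MemLp q 2 (timeMeasure S) → IntervalIntegrable q volume 0 S := by
    intro q hq
    rw [intervalIntegrable_iff_integrableOn_Icc_of_le hS.le]
    exact hq.integrable (by norm_num)
  have p1 := primitive_of_hasWeakTimeDeriv hS (hint m1) c1 d1
  have p2 := primitive_of_hasWeakTimeDeriv hS (hint m2) c2 d2
  have hz := h.eq_zero_of_primitive (w := fun t => θ' t - θ t) (wt := fun t => θt' t - θt t)
    (W := fun t => Θ' t - Θ t) ((hint m2).sub (hint m1)) (c2.sub c1) (by simp [i1, i2])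
    (fun t ht => by
      rw [intervalIntegral.integral_sub (intervalIntegrable_of_Icc (hint m2) le_rfl ht.1 ht.2)
        (intervalIntegrable_of_Icc (hint m1) le_rfl ht.1 ht.2), p1 t ht, p2 t ht, i1, i2,
        add_sub_add_left_eq_sub]) ?_
  · exact fun t ht => sub_eq_zero.1 (hz t ht)
  · filter_upwards [hv, a1, a2, q1, q2] with t e1 e2 e3 e4 e5
    rw [h.equation_iff e1] at e4 e5
    refine ⟨?_, ?_⟩
    · rw [← e2, ← e3]; rfl
    · rw [e4, e5, h.advect_sub]
      abel

/-- Duhamel's formula gives a solution in the class of the theorem. -/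
theorem isTransportSolution_duhamel (h : TangentField Ω V A) (hS : 0 < S)
    (hv : ∀ᵐ t ∂timeMeasure S, V t =ᵐ[volume.restrict Ω] (v t).toLp)
    (hA : MemLp A 2 (timeMeasure S)) {g : ℝ → Sobolev Ω ℝ 1 2}
    (hg : ∀ a b, IntervalIntegrable g volume a b)
    (hgu : ∀ t ∈ Icc 0 S, g t = (u t).coord 1) (hu : MemLp u 2 (timeMeasure S)) :
    IsTransportSolution Ω S v u θ₀ (h.duhamel θ₀.toLp fun s => (g s).toLp) := by
  set θ := h.duhamel θ₀.toLp fun s => (g s).toLp with hθ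
  have hgL : ∀ a b, IntervalIntegrable (fun s => (g s).toLp) volume a b := fun a b =>
    intervalIntegrable_clm (Sobolev.toLpCLM Ω ℝ 1 2) (hg a b)
  have hθc : Continuous θ := h.continuous_duhamel hgL _
  have hθ0 : θ 0 = θ₀.toLp := h.duhamel_zero _
  choose! Θ hΘ hΘb using fun t (ht : 0 ≤ t) => h.exists_duhamel_sobolev hg θ₀ ht
  set M := ∑ _i : Fin 2, 2 * TangentField.flowLip A S 0 ^ 2 * (‖θ₀‖ + ∫ s in (0 : ℝ)..S, ‖g s‖) with hM
  have hΘM : ∀ t ∈ Icc 0 S, ∑ i, ‖(Θ t).weakPartial i‖ ≤ M := fun t ht => by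
    refine Finset.sum_le_sum fun i _ => (hΘb t ht.1 i).trans ?_
    have h1 : TangentField.flowLip A t 0 ≤ TangentField.flowLip A S 0 := by
      have h0 : ∀ {b : ℝ}, 0 ≤ b → 0 ≤ ∫ τ in (0 : ℝ)..b, A τ := fun hb =>
        intervalIntegral.integral_nonneg hb fun τ _ => h.lip.nonneg τ
      refine Real.exp_le_exp.2 (mul_le_mul_of_nonneg_left ?_ zero_le_two)
      rw [abs_of_nonneg (h0 ht.1), abs_of_nonneg (h0 hS.le)]
      exact integral_mono_right h.lip.nonneg h.lip.integrable 0 ht.2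
    have h2 : ∫ s in (0 : ℝ)..t, ‖g s‖ ≤ ∫ s in (0 : ℝ)..S, ‖g s‖ :=
      integral_mono_right (fun s => norm_nonneg _) (fun a b => (hg a b).norm) 0 ht.2
    have h3 : 0 ≤ ∫ s in (0 : ℝ)..t, ‖g s‖ :=
      intervalIntegral.integral_nonneg ht.1 fun s _ => norm_nonneg _
    have h4 := TangentField.one_le_flowLip A t 0
    gcongr
  have hΘm : AEStronglyMeasurable Θ (timeMeasure S) := by
    refine Sobolev.aestronglyMeasurable_of_toLp h.dom.isOpen ?_
    refine (hθc.aestronglyMeasurable (μ := timeMeasure S)).congr ?_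
    filter_upwards [ae_restrict_mem measurableSet_Icc] with t ht
    exact (hΘ t ht.1).symm
  obtain ⟨B, hB⟩ := isCompact_Icc.exists_bound_of_continuousOn (hθc.continuousOn (s := Icc 0 S))
  set θt : ℝ → L2 Ω := fun t => -((g t).toLp + h.advect t (Θ t)) with hθt
  have hsub : ∀ t ∈ Icc 0 S, IntervalIntegrable (fun r => (g r).toLp + h.advect r (Θ r)) volume 0 t
      ∧ θ t = θ₀.toLp - ∫ r in (0 : ℝ)..t, ((g r).toLp + h.advect r (Θ r)) := fun t ht =>
    h.duhamel_sub hg θ₀ hΘ ht.1 fun s hs => hΘM s ⟨hs.1, hs.2.trans ht.2⟩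
  refine ⟨hθc.continuousOn, hθ0, Θ, θt, ?_, ?_, ?_, ?_, ?_, ?_⟩
  · filter_upwards [ae_restrict_mem measurableSet_Icc] with t ht using hΘ t ht.1
  · refine memLp_top_of_bound hΘm (B + M) ?_
    filter_upwards [ae_restrict_mem measurableSet_Icc] with t ht
    refine (Θ t).norm_le_add.trans (add_le_add ?_ (hΘM t ht))
    rw [hΘ t ht.1]
    exact hB t ht
  · refine MemLp.of_bound hθc.aestronglyMeasurable B ?_
    filter_upwards [ae_restrict_mem measurableSet_Icc] with t ht using hB t ht
  · refine MemLp.neg (MemLp.add ?_ ?_)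
    · have h1 := Sobolev.memLp_coord h.dom.isOpen 1 hu
      have h2 : MemLp g 2 (timeMeasure S) := h1.ae_eq (by
        filter_upwards [ae_restrict_mem measurableSet_Icc] with t ht using (hgu t ht).symm)
      exact (Sobolev.toLpCLM Ω ℝ 1 2).comp_memLp' h2
    · refine hA.of_le_mul (c := M) (h.aestronglyMeasurable_advect hΘm) ?_
      filter_upwards [ae_restrict_mem measurableSet_Icc] with t ht
      rw [Real.norm_of_nonneg (h.lip.nonneg t), mul_comm]
      exact (h.norm_advect_le t (Θ t)).trans
        (mul_le_mul_of_nonneg_left (hΘM t ht) (h.lip.nonneg t))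
  · refine hasWeakTimeDeriv_of_primitive hS.le (hsub S ⟨hS.le, le_rfl⟩).1.neg hθc.continuousOn
      fun t ht => ?_
    rw [(hsub t ht).2, hθ0, sub_eq_add_neg, ← intervalIntegral.integral_neg]
  · filter_upwards [hv, ae_restrict_mem measurableSet_Icc] with t ht htS
    rw [h.equation_iff ht, hθt, ← hgu t htS]

end Solution

end TransportH1

end

theorem lemma3p2 (Ω : Set Plane) (hΩ : IsSmoothBoundedDomain Ω) :
    ∃ C : ℝ, 0 < C ∧
      ∀ (T : ℝ≥0∞), 0 < T →
      ∀ (v : ℝ → Sobolev Ω Plane 2 3) (u : ℝ → Sobolev Ω Plane 1 2) (θ₀ : Sobolev Ω ℝ 1 2),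
        (∀ S : ℝ, 0 < S → ENNReal.ofReal S ≤ T →
          MemLp v 3 (timeMeasure S) ∧
          (∀ᵐ t ∂timeMeasure S, NormalTraceZero Ω (v t).toLp) ∧
          MemLp u 2 (timeMeasure S)) →
        ∃ θ : ℝ → L2 Ω,
          (∀ S : ℝ, 0 < S → ENNReal.ofReal S ≤ T →
            IsTransportSolution Ω S v u θ₀ θ ∧
            ∀ θ' : ℝ → L2 Ω, IsTransportSolution Ω S v u θ₀ θ' → EqOn θ' θ (Icc 0 S)) ∧
          ∀ t : ℝ, 0 ≤ t → ENNReal.ofReal t ≤ T →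
            ∫⁻ s in Icc 0 t, (v s).w1infNorm < ⊤ ∧
            ∃ Θt : Sobolev Ω ℝ 1 2, Θt.toLp = θ t ∧
              Θt.gradNorm ≤ C * (‖θ₀‖ + ∫ s in Icc 0 t, ‖u s‖) *
                Real.exp (C * (∫⁻ s in Icc 0 t, (v s).w1infNorm).toReal) := by
  obtain ⟨C₁, hC₁, hfield⟩ := hΩ.exists_tangentField
  obtain ⟨C₂, hC₂, hC₂le⟩ := hΩ.exists_w1infNorm_le
  refine ⟨12 + 4 * C₁, by positivity, fun T hT v u θ₀ hvu => ?_⟩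
  obtain ⟨V, A, h, hVA⟩ := hfield T hT v fun S hS hST => ⟨(hvu S hS hST).1, (hvu S hS hST).2.1⟩
  have hae : ∀ S, ENNReal.ofReal S ≤ T → ∀ᵐ t ∂timeMeasure S,
      V t =ᵐ[volume.restrict Ω] (v t).toLp ∧ A t ≤ C₁ * (v t).w1infNorm.toReal := fun S hST =>
    ae_restrict_of_ae_restrict_of_subset (Icc_subset_timeDomain hST) hVA
  have hfin : ∀ f : Sobolev Ω Plane 2 3, f.w1infNorm ≠ ⊤ := fun f =>
    ((hC₂le f).trans_lt (ENNReal.mul_lt_top hC₂.lt_top enorm_lt_top)).ne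
  set g : ℝ → Sobolev Ω ℝ 1 2 := (timeDomain T).indicator fun t => (u t).coord 1 with hg
  have hgu : ∀ S, ENNReal.ofReal S ≤ T → ∀ t ∈ Icc 0 S, g t = (u t).coord 1 := fun S hST t ht =>
    indicator_of_mem (Icc_subset_timeDomain hST ht) _
  have hgi : ∀ a b, IntervalIntegrable g volume a b :=
    intervalIntegrable_indicator_timeDomain hT fun S hS hST =>
      (Sobolev.memLp_coord hΩ.isOpen 1 (hvu S hS hST).2.2).integrable (by norm_num)
  refine ⟨h.duhamel θ₀.toLp fun s => (g s).toLp, fun S hS hST => ?_, fun t ht htT => ?_⟩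
  · have hv : ∀ᵐ t ∂timeMeasure S, V t =ᵐ[volume.restrict Ω] (v t).toLp :=
      (hae S hST).mono fun t ht => ht.1
    have hA : MemLp A 2 (timeMeasure S) := by
      have hAm : AEStronglyMeasurable A (timeMeasure S) :=
        ((intervalIntegrable_iff_integrableOn_Icc_of_le hS.le).1
          (h.lip.integrable 0 S)).aestronglyMeasurable
      refine ((hvu S hS hST).1.mono_exponent (by norm_num)).of_le_mul (c := C₁ * C₂.toReal) hAm ?_
      filter_upwards [hae S hST] with t ht
      rw [Real.norm_of_nonneg (h.lip.nonneg t), mul_assoc]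
      refine ht.2.trans (mul_le_mul_of_nonneg_left ?_ hC₁)
      have := ENNReal.toReal_mono (ENNReal.mul_ne_top hC₂ enorm_ne_top) (hC₂le (v t))
      rwa [ENNReal.toReal_mul, toReal_enorm] at this
    have hsol := isTransportSolution_duhamel (θ₀ := θ₀) h hS hv hA hgi (hgu S hST)
      (hvu S hS hST).2.2
    exact ⟨hsol, fun θ' hθ' => hθ'.eqOn h hS hv hsol⟩
  · -- the hypotheses are also true for `t = 0`, where the measure is zero
    have hvt : MemLp v 3 (timeMeasure t) ∧ MemLp u 2 (timeMeasure t) := by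
      rcases ht.eq_or_lt with rfl | ht0
      · rw [timeMeasure_zero]
        exact ⟨memLp_measure_zero, memLp_measure_zero⟩
      · exact ⟨(hvu t ht0 htT).1, (hvu t ht0 htT).2.2⟩
    have hw : ∫⁻ s in Icc 0 t, (v s).w1infNorm < ⊤ := by
      have h1 : Integrable v (timeMeasure t) := hvt.1.integrable (by norm_num)
      refine (lintegral_mono fun s => hC₂le (v s)).trans_lt ?_
      rw [lintegral_const_mul' _ _ hC₂]
      exact ENNReal.mul_lt_top hC₂.lt_top h1.hasFiniteIntegral
    refine ⟨hw, ?_⟩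
    obtain ⟨Θ, hΘ, hΘb⟩ := h.exists_duhamel_sobolev hgi θ₀ ht
    refine ⟨Θ, hΘ, ?_⟩
    set W := (∫⁻ s in Icc 0 t, (v s).w1infNorm).toReal with hW
    have hA : ∫ s in (0 : ℝ)..t, A s ≤ C₁ * W := by
      rw [← setIntegral_Icc_eq ht, hW, integral_eq_lintegral_of_nonneg_ae
        (ae_of_all _ h.lip.nonneg) ((intervalIntegrable_iff_integrableOn_Icc_of_le ht).1
          (h.lip.integrable 0 t)).aestronglyMeasurable, ← ENNReal.toReal_ofReal hC₁,
        ← ENNReal.toReal_mul, ← lintegral_const_mul' _ _ ENNReal.ofReal_ne_top]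
      refine ENNReal.toReal_mono ?_ (lintegral_mono_ae ?_)
      · rw [lintegral_const_mul' _ _ ENNReal.ofReal_ne_top]
        exact ENNReal.mul_ne_top ENNReal.ofReal_ne_top hw.ne
      · filter_upwards [hae t htT] with s hs
        rw [← ENNReal.ofReal_toReal (hfin (v s)), ← ENNReal.ofReal_mul hC₁]
        exact ENNReal.ofReal_le_ofReal hs.2
    have hgle : ∫ s in (0 : ℝ)..t, ‖g s‖ ≤ 3 * ∫ s in Icc 0 t, ‖u s‖ := by
      have h1 : Integrable u (timeMeasure t) := hvt.2.integrable (by norm_num)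
      rw [← setIntegral_Icc_eq ht, ← integral_const_mul]
      refine integral_mono_ae ((intervalIntegrable_iff_integrableOn_Icc_of_le ht).1
        (hgi 0 t)).norm (h1.norm.const_mul 3) ?_
      filter_upwards [ae_restrict_mem measurableSet_Icc] with s hs
      rw [hgu t htT s hs]
      exact (u s).norm_coord_le 1
    have hI0 : 0 ≤ ∫ s in (0 : ℝ)..t, A s :=
      intervalIntegral.integral_nonneg ht fun s _ => h.lip.nonneg s
    have hW0 : 0 ≤ W := ENNReal.toReal_nonneg
    have hu0 : 0 ≤ ∫ s in Icc 0 t, ‖u s‖ := integral_nonneg fun _ => norm_nonneg _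
    have hexp : TangentField.flowLip A t 0 ^ 2 ≤ Real.exp ((12 + 4 * C₁) * W) := by
      rw [TangentField.flowLip, ← Real.exp_nat_mul, abs_of_nonneg hI0]
      refine Real.exp_le_exp.2 ?_
      push_cast
      linarith
    refine Θ.gradNorm_le.trans ?_
    rw [Fin.sum_univ_two]
    refine (add_le_add (hΘb 0) (hΘb 1)).trans ?_
    have h1 : ‖θ₀‖ + ∫ s in (0 : ℝ)..t, ‖g s‖ ≤ 3 * (‖θ₀‖ + ∫ s in Icc 0 t, ‖u s‖) := by
      linarith [norm_nonneg θ₀]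
    have h2 : 0 ≤ ‖θ₀‖ + ∫ s in Icc 0 t, ‖u s‖ := add_nonneg (norm_nonneg _) hu0
    calc 2 * TangentField.flowLip A t 0 ^ 2 * (‖θ₀‖ + ∫ s in (0 : ℝ)..t, ‖g s‖)
          + 2 * TangentField.flowLip A t 0 ^ 2 * (‖θ₀‖ + ∫ s in (0 : ℝ)..t, ‖g s‖)
        = 4 * (‖θ₀‖ + ∫ s in (0 : ℝ)..t, ‖g s‖) * TangentField.flowLip A t 0 ^ 2 := by ring
      _ ≤ 4 * (3 * (‖θ₀‖ + ∫ s in Icc 0 t, ‖u s‖)) * Real.exp ((12 + 4 * C₁) * W) := by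
          gcongr
      _ ≤ (12 + 4 * C₁) * (‖θ₀‖ + ∫ s in Icc 0 t, ‖u s‖) * Real.exp ((12 + 4 * C₁) * W) := by
          refine mul_le_mul_of_nonneg_right ?_ (Real.exp_pos _).le
          have := mul_nonneg hC₁ h2
          linarith
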